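/- **Setting.** Let $\Gamma\subsetneq\mathbb R^n$ be an open, convex cone with vertex at the origin, symmetric under permutations of the coordinates and containing $\Gamma_n=\{\lambda:\lambda_i>0\ \forall i\}$. Let $f$ be a symmetric function with (f1) $\partial f/\partial\lambda_i>0$ in $\Gamma$ for all $i$; (f2) $f$ concave in $\Gamma$; (f3) $f\in C^2(\Gamma)\cap C^0(\overline\Gamma)$, $f>0$ in $\Gamma$, $f=0$ on $\partial\Gamma$; (f4) $f$ homogeneous of degree one. For a symmetric $n\times n$ matrix $A$ whose vector of eigenvalues $\lambda(A)$ lies in $\Gamma$ put $F(A)=f(\lambda(A))$, $F^{ij}=\partial F/\partial A_{ij}$, and let $\mathcal M$ be the set of all matrices $(F^{ij}(T))$ with $\lambda(T)\in\Gamma$ (they are symmetric and positive definite). For $\tfrac12<s<1$ and $v:\mathbb R^n\to\mathbb R$ put $\delta(v,x,y)=v(x+y)+v(x-y)-2v(x)$ and $$F_s[v](x)=\inf_{M\in\mathcal M}\frac12\int_{\mathbb R^n}\frac{\delta(v,x,y)}{|\sqrt M^{-1}y|^{n+2s}}\det\sqrt M^{-1}\,dy\in[-\infty,\infty].$$ Let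 $\omega_n$ be the volume of the unit ball of $\mathbb R^n$. An upper semicontinuous $u:\mathbb R^n\to\mathbb R$ is *admissible* if $\lambda(D^2\psi(x))\in\Gamma$ for every $x\in\mathbb R^n$ and every $\psi$ that is $C^2$ in an open neighbourhood of $x$ and such that $u-\psi$ has a local maximum at $x$. It is *asymptotically linear* if $|u(y)|\le L|y|$ for all $|y|\ge R$, for some constants $L,R$. A function $\psi$ *touches $u$ from above* (*below*) at $x$ in a bounded open neighbourhood $N$ of $x$ if $\psi\in C^2(\overline N)$, $\psi(x)=u(x)$ and $\psi>u$ ($\psi<u$) in $N\setminus\{x\}$; we then let $v=\psi$ in $N$ and $v=u$ in $\mathbb R^n\setminus N$. **Theorem 1.1.** Assume (f1)–(f4), and let $u:\mathbb R^n\to\mathbb R$ be admissible and asymptotically linear. Then $$\lim_{s\to1^-}(1-s)F_s[u](x)=\frac{\omega_n}{4}F(D^2u(x))$$ in the viscosity sense, that is: 1. If $\psi$ touches $u$ from above at $x$ in $N$, then $\lambda(D^2\psi(x))\in\Gamma$ and $\lim_{s\to1^-}(1-s)F_s[v](x)=\frac{\omega_n}{4}F(D^2\psi(x))$. 2. If $\psi$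 touches $u$ from below at $x$ in $N$ and $\lambda(D^2\psi(x))\in\Gamma$, then $\lim_{s\to1^-}(1-s)F_s[v](x)=\frac{\omega_n}{4}F(D^2\psi(x))$. 3. If $\psi$ touches $u$ from below at $x$ in $N$ (with no condition on $D^2\psi(x)$), then $\limsup_{s\to1^-}(1-s)F_s[v](x)\le\frac{\omega_n}{4}\inf_{M\in\mathcal M}\operatorname{tr}(M\,D^2\psi(x))\in[-\infty,\infty)$. Moreover, if $u$ is $C^2$ near $x$, the limit relation holds at $x$ for $u$ itself in the classical sense. In all these cases the integrals defining $F_s[v](x)$ (respectively $F_s[u](x)$) converge absolutely for every $\frac12<s<1$ and every $M\in\mathcal M$. -/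

import Mathlib

open Set Filter Topology MeasureTheory
open scoped MatrixOrder Matrix.Norms.L2Operator

noncomputable section

namespace FracHessian

/-- Structure conditions on the cone `Γ ⊂ ℝⁿ` and the function `f` of the eigenvalues. -/
structure StructureConditions {n : ℕ} (Γ : Set (Fin n → ℝ)) (f : (Fin n → ℝ) → ℝ) : Prop where
  isOpen : IsOpen Γ
  convex : Convex ℝ Γ
  symm_cone : ∀ (σ : Equiv.Perm (Fin n)), ∀ l ∈ Γ, l ∘ σ ∈ Γ
  cone : ∀ t : ℝ, 0 < t → ∀ l ∈ Γ, t • l ∈ Γ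
  positive_subset : {l : Fin n → ℝ | ∀ i, 0 < l i} ⊆ Γ
  ne_univ : Γ ≠ univ
  symm_fun : ∀ (σ : Equiv.Perm (Fin n)), ∀ l ∈ Γ, f (l ∘ σ) = f l
  increasing : ∀ l ∈ Γ, ∀ i, 0 < fderiv ℝ f l (Pi.single i 1)
  concave : ConcaveOn ℝ Γ f
  contDiffOn : ContDiffOn ℝ 2 f Γ
  continuousOn : ContinuousOn f (closure Γ)
  pos : ∀ l ∈ Γ, 0 < f l
  zero_boundary : ∀ l ∈ frontier Γ, f l = 0
  homogeneous : ∀ t : ℝ, 0 < t → ∀ l ∈ Γ, f (t • l) = t * f l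

/-- The set of symmetric matrices whose vector of eigenvalues lies in `Γ`. -/
def matrixCone {n : ℕ} (Γ : Set (Fin n → ℝ)) : Set (Matrix (Fin n) (Fin n) ℝ) :=
  {A | ∃ h : A.IsHermitian, h.eigenvalues ∈ Γ}

open Classical in
/-- `F(A) = f(λ(A))` for symmetric `A` (used for `A ∈ matrixCone Γ`; `f` is symmetric, so the
order of the eigenvalues is irrelevant). -/
def hessOp {n : ℕ} (f : (Fin n → ℝ) → ℝ) (A : Matrix (Fin n) (Fin n) ℝ) : ℝ :=
  if h : A.IsHermitian then f h.eigenvalues else 0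

/-- `M = (F^{ij}(T))` is the symmetric matrix of first derivatives of `F` at `T`: it represents the
derivative of `F` on the space of symmetric matrices through the trace pairing. -/
def IsGradientAt {n : ℕ} (f : (Fin n → ℝ) → ℝ) (T M : Matrix (Fin n) (Fin n) ℝ) : Prop :=
  M.IsSymm ∧ ∀ H : Matrix (Fin n) (Fin n) ℝ, H.IsSymm →
    HasDerivAt (fun t : ℝ => hessOp f (T + t • H)) (M * H).trace 0

/-- The family `𝓜` of all matrices `(F^{ij}(T))` with `λ(T) ∈ Γ`. -/
def gradientMatrices {n : ℕ} (Γ : Set (Fin n → ℝ)) (f : (Fin n → ℝ) → ℝ) :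
    Set (Matrix (Fin n) (Fin n) ℝ) :=
  {M | ∃ T ∈ matrixCone Γ, IsGradientAt f T M}

/-- The Hessian matrix `D²ψ(x)`. -/
def hessianMatrix {n : ℕ} (ψ : EuclideanSpace ℝ (Fin n) → ℝ) (x : EuclideanSpace ℝ (Fin n)) :
    Matrix (Fin n) (Fin n) ℝ :=
  Matrix.of fun i j =>
    fderiv ℝ (fderiv ℝ ψ) x (EuclideanSpace.single i 1) (EuclideanSpace.single j 1)

/-- Admissible functions on `ℝⁿ` (in the viscosity sense). -/
structure Admissible {n : ℕ} (Γ : Set (Fin n → ℝ)) (u : EuclideanSpace ℝ (Fin n) → ℝ) :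
    Prop where
  upperSemicontinuous : UpperSemicontinuous u
  hessian_mem : ∀ (x : EuclideanSpace ℝ (Fin n)) (N : Set (EuclideanSpace ℝ (Fin n)))
    (ψ : EuclideanSpace ℝ (Fin n) → ℝ), IsOpen N → x ∈ N → ContDiffOn ℝ 2 ψ N →
    IsLocalMax (fun y => u y - ψ y) x → hessianMatrix ψ x ∈ matrixCone Γ

/-- At most linear growth at infinity. -/
def AsymptoticallyLinear {n : ℕ} (u : EuclideanSpace ℝ (Fin n) → ℝ) : Prop :=
  ∃ L R : ℝ, ∀ y, R ≤ ‖y‖ → |u y| ≤ L * ‖y‖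

/-- The second difference `δ(u,x,y) = u(x+y) + u(x-y) - 2u(x)`. -/
def secondDiff {n : ℕ} (u : EuclideanSpace ℝ (Fin n) → ℝ) (x y : EuclideanSpace ℝ (Fin n)) : ℝ :=
  u (x + y) + u (x - y) - 2 * u x

/-- The integrand `δ(u,x,y) |√M⁻¹ y|^{-(n+2s)} det √M⁻¹`, with `√M` the positive square root. -/
def integrand {n : ℕ} (M : Matrix (Fin n) (Fin n) ℝ) (s : ℝ) (u : EuclideanSpace ℝ (Fin n) → ℝ)
    (x y : EuclideanSpace ℝ (Fin n)) : ℝ :=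
  secondDiff u x y / ‖Matrix.toEuclideanLin (CFC.sqrt M)⁻¹ y‖ ^ ((n : ℝ) + 2 * s) *
    ((CFC.sqrt M)⁻¹).det

/-- The fractional Hessian operator `F_s[u](x)`, an infimum in `[-∞, ∞]`. -/
def fracHessian {n : ℕ} (Γ : Set (Fin n → ℝ)) (f : (Fin n → ℝ) → ℝ) (s : ℝ)
    (u : EuclideanSpace ℝ (Fin n) → ℝ) (x : EuclideanSpace ℝ (Fin n)) : EReal :=
  ⨅ M ∈ gradientMatrices Γ f, (((1 / 2 : ℝ) * ∫ y, integrand M s u x y : ℝ) : EReal)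

/-- All integrals in the definition of `F_s[u](x)` converge absolutely, for `1/2 < s < 1`. -/
def IntegralsConverge {n : ℕ} (Γ : Set (Fin n → ℝ)) (f : (Fin n → ℝ) → ℝ)
    (u : EuclideanSpace ℝ (Fin n) → ℝ) (x : EuclideanSpace ℝ (Fin n)) : Prop :=
  ∀ s ∈ Ioo (1 / 2 : ℝ) 1, ∀ M ∈ gradientMatrices Γ f, Integrable (integrand M s u x)

/-- `ω_n`, the volume of the unit ball of `ℝⁿ`. -/
def unitBallVolume (n : ℕ) : ℝ :=
  (volume (Metric.closedBall (0 : EuclideanSpace ℝ (Fin n)) 1)).toReal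

/-- `ψ` is a `C²` test function on the bounded neighbourhood `N` of `x`, equal to `u` at `x`. -/
structure IsTestFunction {n : ℕ} (u ψ : EuclideanSpace ℝ (Fin n) → ℝ)
    (N : Set (EuclideanSpace ℝ (Fin n))) (x : EuclideanSpace ℝ (Fin n)) : Prop where
  isOpen : IsOpen N
  isBounded : Bornology.IsBounded N
  mem : x ∈ N
  contDiffOn : ContDiffOn ℝ 2 ψ (closure N)
  eq_at : ψ x = u x

/-- `ψ` touches `u` strictly from above at `x` in `N`. -/
def TouchesAbove {n : ℕ} (u ψ : EuclideanSpace ℝ (Fin n) → ℝ)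
    (N : Set (EuclideanSpace ℝ (Fin n))) (x : EuclideanSpace ℝ (Fin n)) : Prop :=
  IsTestFunction u ψ N x ∧ ∀ y ∈ N \ {x}, u y < ψ y

/-- `ψ` touches `u` strictly from below at `x` in `N`. -/
def TouchesBelow {n : ℕ} (u ψ : EuclideanSpace ℝ (Fin n) → ℝ)
    (N : Set (EuclideanSpace ℝ (Fin n))) (x : EuclideanSpace ℝ (Fin n)) : Prop :=
  IsTestFunction u ψ N x ∧ ∀ y ∈ N \ {x}, ψ y < u y

open Classical in
/-- The function equal to `ψ` in `N` and to `u` outside `N`. -/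
def glue {n : ℕ} (u ψ : EuclideanSpace ℝ (Fin n) → ℝ) (N : Set (EuclideanSpace ℝ (Fin n))) :
    EuclideanSpace ℝ (Fin n) → ℝ :=
  fun y => if y ∈ N then ψ y else u y

/-- `lim_{s → 1⁻} (1-s) F_s[v](x) = ℓ`, all the integrals being absolutely convergent. -/
def StableLimit {n : ℕ} (Γ : Set (Fin n → ℝ)) (f : (Fin n → ℝ) → ℝ)
    (v : EuclideanSpace ℝ (Fin n) → ℝ) (x : EuclideanSpace ℝ (Fin n)) (l : ℝ) : Prop :=
  IntegralsConverge Γ f v x ∧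
    Tendsto (fun s : ℝ => ((1 - s : ℝ) : EReal) * fracHessian Γ f s v x) (𝓝[<] 1) (𝓝 (l : EReal))

/-- The limit equation `lim_{s → 1} (1-s) F_s[u] = (ω_n/4) F(D²u)` in the viscosity sense.
Test functions touching `u` from below are only compared with `F` where `F` is defined, that is, if
`λ(D²ψ(x)) ∈ Γ`; for the others the supersolution inequality with the infimum over `𝓜` holds. -/
structure ViscosityLimit {n : ℕ} (Γ : Set (Fin n → ℝ)) (f : (Fin n → ℝ) → ℝ)
    (u : EuclideanSpace ℝ (Fin n) → ℝ) : Prop where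
  above : ∀ x N ψ, TouchesAbove u ψ N x →
    hessianMatrix ψ x ∈ matrixCone Γ ∧
    StableLimit Γ f (glue u ψ N) x (unitBallVolume n / 4 * hessOp f (hessianMatrix ψ x))
  below : ∀ x N ψ, TouchesBelow u ψ N x → hessianMatrix ψ x ∈ matrixCone Γ →
    StableLimit Γ f (glue u ψ N) x (unitBallVolume n / 4 * hessOp f (hessianMatrix ψ x))
  below_general : ∀ x N ψ, TouchesBelow u ψ N x →
    IntegralsConverge Γ f (glue u ψ N) x ∧
    limsup (fun s : ℝ => ((1 - s : ℝ) : EReal) * fracHessian Γ f s (glue u ψ N) x) (𝓝[<] 1) ≤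
      ⨅ M ∈ gradientMatrices Γ f,
        ((unitBallVolume n / 4 * (M * hessianMatrix ψ x).trace : ℝ) : EReal)

end FracHessian

end

/-! Since F is concave and homogeneous of degree one, F(A) is the infimum of tr(MA) over 𝓜
(`le_trace`, `exists_trace_lt`). The substitution y = √M z turns each integral in F_s into the
isotropic kernel |z|^{-(n+2s)} tested against second differences along T = √M. On |z| < 1, Taylor
expansion and rotational symmetry produce ω_n/(2(1-s)) · tr(M D²v(x)) up to a small multiple of
tr(M)/(1-s). If the part |z| ≥ 1 stays bounded as s → 1, the factor 1-s kills it, so each fixed M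
contributes ω_n/4 · tr(M D²v(x)). The upper bound for the limit follows from one M at a time.

The lower bound must be uniform over 𝓜, which may be unbounded, and the tail must be controlled
although u has no local lower bound. The tail uses admissibility: by `le_trace`, u is a strict
viscosity subsolution of tr(M D²u) = 0 for every M. Comparison with the heat flow places u(x) below
the Gaussian averages, along √M, of any Lipschitz majorant; sup-convolutions carry this to u itself
(`lintegral_gaussian_submean`). Mixing Gaussians gives the same for the kernels (1+|z|²)^{-a}. So
the negative part of u(x+Tz) - u(x) integrates to no more than the positive part, which grows at
most linearly. The resulting bound depends on T only through a bound on its norm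
(`lintegral_abs_sub_le`).

Large M are handled by scaling: T is replaced by rT with r² tr M = ρ² fixed, which multiplies the
integral by r^{2s} (`exists_scaled_estimate`). The Taylor error, proportional to tr M, is absorbed
by testing `le_trace` on A - ε'I, which stays in the cone with F nearly unchanged. After scaling,
the slack is a fixed multiple of ρ² whatever M is, and it beats the remaining error O(1-s)
(`le_of_scaled_estimate`). When D²v(x) is outside the cone, only the upper bound survives. -/

noncomputable section

namespace FracHessian

/-! ### Concavity of F on symmetric matrices, from symmetric concave f. -/

section EigenvalueCone

variable {n : ℕ} {Γ : Set (Fin n → ℝ)} {f : (Fin n → ℝ) → ℝ}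

namespace StructureConditions

/-- By Birkhoff's theorem P is a convex combination of permutation matrices. Each permutation keeps
d in Γ and does not change f, so convexity of Γ and Jensen's inequality conclude. -/
theorem doublyStochastic_mulVec (hf : StructureConditions Γ f) {P : Matrix (Fin n) (Fin n) ℝ}
    (hP : P ∈ doublyStochastic ℝ (Fin n)) {d : Fin n → ℝ} (hd : d ∈ Γ) :
    P.mulVec d ∈ Γ ∧ f d ≤ f (P.mulVec d) := by
  obtain ⟨w, hw0, hw1, rfl⟩ := exists_eq_sum_perm_of_mem_doublyStochastic hP
  have hE : (∑ σ : Equiv.Perm (Fin n), w σ • σ.permMatrix ℝ).mulVec d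
      = ∑ σ : Equiv.Perm (Fin n), w σ • (d ∘ σ) := by
    rw [Matrix.sum_mulVec]
    refine Finset.sum_congr rfl fun σ _ => ?_
    rw [Matrix.smul_mulVec, Matrix.permMatrix_mulVec]
  rw [hE]
  refine ⟨hf.convex.sum_mem (fun σ _ => hw0 σ) hw1 (fun σ _ => hf.symm_cone σ d hd), ?_⟩
  have := hf.concave.le_map_sum (t := Finset.univ) (w := w) (p := fun σ : Equiv.Perm (Fin n) => d ∘ σ)
    (fun σ _ => hw0 σ) hw1 (fun σ _ => hf.symm_cone σ d hd)
  refine le_trans (le_of_eq ?_) this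
  simp [hf.symm_fun _ d hd, ← Finset.sum_mul, hw1]

/-- The sum is twice the midpoint: homogeneity turns concavity into superadditivity. -/
theorem add_mem (hf : StructureConditions Γ f) {a b : Fin n → ℝ} (ha : a ∈ Γ) (hb : b ∈ Γ) :
    a + b ∈ Γ ∧ f a + f b ≤ f (a + b) := by
  have hE : a + b = (2 : ℝ) • ((1 / 2 : ℝ) • a + (1 / 2 : ℝ) • b) := by
    ext i; simp; ring
  have hm : (1 / 2 : ℝ) • a + (1 / 2 : ℝ) • b ∈ Γ :=
    hf.convex ha hb (by norm_num) (by norm_num) (by norm_num)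
  have h2 : (0 : ℝ) ≤ 1 / 2 := by norm_num
  obtain ⟨_, hc⟩ := hf.concave
  replace hc := hc ha hb h2 h2 (by norm_num)
  rw [hE]
  refine ⟨hf.cone 2 two_pos _ hm, ?_⟩
  rw [hf.homogeneous 2 two_pos _ hm]
  simp only [smul_eq_mul] at hc
  linarith

end StructureConditions

theorem of_sq_mem_doublyStochastic {Q : Matrix (Fin n) (Fin n) ℝ}
    (hQ : Q ∈ Matrix.orthogonalGroup (Fin n) ℝ) :
    Matrix.of (fun i j => Q i j ^ 2) ∈ doublyStochastic ℝ (Fin n) := by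
  rw [mem_doublyStochastic_iff_sum]
  refine ⟨fun i j => sq_nonneg _, fun i => ?_, fun j => ?_⟩
  · have := congrFun (congrFun ((Matrix.mem_orthogonalGroup_iff (Fin n) ℝ).1 hQ) i) i
    simpa [Matrix.mul_apply, sq, Matrix.one_apply_eq] using this
  · have := congrFun (congrFun ((Matrix.mem_orthogonalGroup_iff' (Fin n) ℝ).1 hQ) j) j
    simpa [Matrix.mul_apply, sq, Matrix.one_apply_eq] using this

theorem conj_diagonal_apply_self (Q : Matrix (Fin n) (Fin n) ℝ) (d : Fin n → ℝ) :
    (fun i => (Q * Matrix.diagonal d * Q.transpose) i i) =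
      (Matrix.of (fun i j => Q i j ^ 2)).mulVec d := by
  ext i
  rw [Matrix.mul_apply]
  simp only [Matrix.mul_diagonal, Matrix.transpose_apply, Matrix.mulVec, dotProduct,
    Matrix.of_apply]
  exact Finset.sum_congr rfl fun j _ => by ring

theorem exists_orthogonal_diagonalization {A : Matrix (Fin n) (Fin n) ℝ} (hA : A.IsHermitian) :
    ∃ Q ∈ Matrix.orthogonalGroup (Fin n) ℝ,
      A = Q * Matrix.diagonal hA.eigenvalues * Q.transpose := by
  refine ⟨hA.eigenvectorUnitary, hA.eigenvectorUnitary.2, ?_⟩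
  conv_lhs => rw [hA.spectral_theorem, Unitary.conjStarAlgAut_apply]
  rfl

theorem hessOp_eq {A : Matrix (Fin n) (Fin n) ℝ} (hA : A.IsHermitian) :
    hessOp f A = f hA.eigenvalues := by
  rw [hessOp, dif_pos hA]

theorem conj_diagonal_isHermitian (Q : Matrix (Fin n) (Fin n) ℝ) (d : Fin n → ℝ) :
    (Q * Matrix.diagonal d * Q.transpose).IsHermitian := by
  have := Matrix.isHermitian_mul_mul_conjTranspose Q (Matrix.isHermitian_diagonal d)
  simpa [Matrix.conjTranspose_eq_transpose_of_trivial] using this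

theorem orthogonal_transpose_mul {Q : Matrix (Fin n) (Fin n) ℝ}
    (hQ : Q ∈ Matrix.orthogonalGroup (Fin n) ℝ) : Q.transpose * Q = 1 :=
  (Matrix.mem_orthogonalGroup_iff' (Fin n) ℝ).1 hQ

theorem orthogonal_mul_transpose {Q : Matrix (Fin n) (Fin n) ℝ}
    (hQ : Q ∈ Matrix.orthogonalGroup (Fin n) ℝ) : Q * Q.transpose = 1 :=
  (Matrix.mem_orthogonalGroup_iff (Fin n) ℝ).1 hQ

theorem orthogonal_transpose_mem {Q : Matrix (Fin n) (Fin n) ℝ}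
    (hQ : Q ∈ Matrix.orthogonalGroup (Fin n) ℝ) :
    Q.transpose ∈ Matrix.orthogonalGroup (Fin n) ℝ := by
  rw [Matrix.mem_orthogonalGroup_iff]
  exact orthogonal_transpose_mul hQ

/-- Schur's theorem: the diagonal of `A` in an orthonormal basis. -/
theorem StructureConditions.diag_conj (hf : StructureConditions Γ f)
    {A Q : Matrix (Fin n) (Fin n) ℝ} (hA : A ∈ matrixCone Γ)
    (hQ : Q ∈ Matrix.orthogonalGroup (Fin n) ℝ) :
    (fun i => (Q.transpose * A * Q) i i) ∈ Γ ∧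
      hessOp f A ≤ f (fun i => (Q.transpose * A * Q) i i) := by
  obtain ⟨hH, hd⟩ := hA
  obtain ⟨U, hU, hUA⟩ := exists_orthogonal_diagonalization hH
  have hW : Q.transpose * U ∈ Matrix.orthogonalGroup (Fin n) ℝ :=
    mul_mem (orthogonal_transpose_mem hQ) hU
  have hE : Q.transpose * A * Q =
      (Q.transpose * U) * Matrix.diagonal hH.eigenvalues * (Q.transpose * U).transpose := by
    conv_lhs => rw [hUA]
    simp only [Matrix.transpose_mul, Matrix.transpose_transpose, Matrix.mul_assoc]
  rw [hE, conj_diagonal_apply_self, hessOp_eq hH]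
  exact hf.doublyStochastic_mulVec (of_sq_mem_doublyStochastic hW) hd

theorem diag_conj_conj {Q : Matrix (Fin n) (Fin n) ℝ}
    (hQ : Q ∈ Matrix.orthogonalGroup (Fin n) ℝ) (d : Fin n → ℝ) :
    Q.transpose * (Q * Matrix.diagonal d * Q.transpose) * Q = Matrix.diagonal d := by
  calc _ = (Q.transpose * Q) * Matrix.diagonal d * (Q.transpose * Q) := by
        simp only [Matrix.mul_assoc]
    _ = _ := by rw [orthogonal_transpose_mul hQ, one_mul, mul_one]

/-- The ordering of the eigenvalues never has to be matched with d. Each of the two vectors is the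
diagonal of the matrix in an eigenbasis of the other, so Schur's inequality in both directions
forces equality. -/
theorem StructureConditions.conj_diagonal_mem (hf : StructureConditions Γ f)
    {Q : Matrix (Fin n) (Fin n) ℝ} (hQ : Q ∈ Matrix.orthogonalGroup (Fin n) ℝ)
    {d : Fin n → ℝ} (hd : d ∈ Γ) :
    Q * Matrix.diagonal d * Q.transpose ∈ matrixCone Γ ∧
      hessOp f (Q * Matrix.diagonal d * Q.transpose) = f d := by
  set A := Q * Matrix.diagonal d * Q.transpose with hAdef
  have hH : A.IsHermitian := conj_diagonal_isHermitian Q d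
  obtain ⟨U, hU, hUA⟩ := exists_orthogonal_diagonalization hH
  have hW : U.transpose * Q ∈ Matrix.orthogonalGroup (Fin n) ℝ :=
    mul_mem (orthogonal_transpose_mem hU) hQ
  have hE : Matrix.diagonal hH.eigenvalues =
      (U.transpose * Q) * Matrix.diagonal d * (U.transpose * Q).transpose := by
    rw [← diag_conj_conj hU hH.eigenvalues, ← hUA, hAdef]
    simp only [Matrix.transpose_mul, Matrix.transpose_transpose, Matrix.mul_assoc]
  have hE' : hH.eigenvalues = (Matrix.of (fun i j => (U.transpose * Q) i j ^ 2)).mulVec d := by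
    rw [← conj_diagonal_apply_self, ← hE]; ext i; simp
  obtain ⟨h1, h2⟩ := hf.doublyStochastic_mulVec (of_sq_mem_doublyStochastic hW) hd
  rw [← hE'] at h1 h2
  have hA : A ∈ matrixCone Γ := ⟨hH, h1⟩
  refine ⟨hA, le_antisymm ?_ (by rwa [hessOp_eq hH])⟩
  have h3 := (hf.diag_conj hA hQ).2
  rw [hAdef, diag_conj_conj hQ d] at h3
  simpa using h3

/-- In an eigenbasis of A + B the eigenvalues of the sum are the sums of the diagonals of A and of
B. Schur's inequality for each summand then reduces the claim to superadditivity of f. -/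
theorem StructureConditions.hessOp_add (hf : StructureConditions Γ f)
    {A B : Matrix (Fin n) (Fin n) ℝ} (hA : A ∈ matrixCone Γ) (hB : B ∈ matrixCone Γ) :
    A + B ∈ matrixCone Γ ∧ hessOp f A + hessOp f B ≤ hessOp f (A + B) := by
  have hH : (A + B).IsHermitian := hA.1.add hB.1
  obtain ⟨Q, hQ, hQA⟩ := exists_orthogonal_diagonalization hH
  obtain ⟨a1, a2⟩ := hf.diag_conj hA hQ
  obtain ⟨b1, b2⟩ := hf.diag_conj hB hQ
  obtain ⟨c1, c2⟩ := hf.add_mem a1 b1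
  have hE : hH.eigenvalues = (fun i => (Q.transpose * A * Q) i i) +
      fun i => (Q.transpose * B * Q) i i := by
    have h := diag_conj_conj hQ hH.eigenvalues
    rw [← hQA] at h
    ext i
    have h' := congrFun (congrFun h i) i
    rw [Matrix.mul_add, Matrix.add_mul] at h'
    simpa using h'.symm
  rw [← hE] at c1 c2
  exact ⟨⟨hH, c1⟩, by rw [hessOp_eq hH]; linarith⟩

theorem StructureConditions.hessOp_smul (hf : StructureConditions Γ f)
    {A : Matrix (Fin n) (Fin n) ℝ} (hA : A ∈ matrixCone Γ) {t : ℝ} (ht : 0 < t) :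
    t • A ∈ matrixCone Γ ∧ hessOp f (t • A) = t * hessOp f A := by
  obtain ⟨hH, hd⟩ := hA
  obtain ⟨Q, hQ, hQA⟩ := exists_orthogonal_diagonalization hH
  have hE : t • A = Q * Matrix.diagonal (t • hH.eigenvalues) * Q.transpose := by
    conv_lhs => rw [hQA]
    rw [Matrix.diagonal_smul, Matrix.mul_smul, Matrix.smul_mul]
  obtain ⟨h1, h2⟩ := hf.conj_diagonal_mem hQ (hf.cone t ht _ hd)
  rw [hE]
  exact ⟨h1, by rw [h2, hf.homogeneous t ht _ hd, hessOp_eq hH]⟩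

theorem StructureConditions.hessOp_pos (hf : StructureConditions Γ f)
    {A : Matrix (Fin n) (Fin n) ℝ} (hA : A ∈ matrixCone Γ) : 0 < hessOp f A := by
  rw [hessOp_eq hA.1]; exact hf.pos _ hA.2

theorem StructureConditions.posDef_mem (hf : StructureConditions Γ f)
    {A : Matrix (Fin n) (Fin n) ℝ} (hA : A.PosDef) : A ∈ matrixCone Γ :=
  ⟨hA.1, hf.positive_subset fun i => hA.eigenvalues_pos i⟩

theorem StructureConditions.concaveOn_hessOp (hf : StructureConditions Γ f) :
    ConcaveOn ℝ (matrixCone Γ) (hessOp f) := by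
  have key : ∀ A ∈ matrixCone Γ, ∀ B ∈ matrixCone Γ, ∀ a b : ℝ, 0 < a → 0 < b → a + b = 1 →
      a • A + b • B ∈ matrixCone Γ ∧
        a • hessOp f A + b • hessOp f B ≤ hessOp f (a • A + b • B) := by
    intro A hA B hB a b ha hb _
    obtain ⟨h1, h2⟩ := hf.hessOp_smul hA ha
    obtain ⟨h3, h4⟩ := hf.hessOp_smul hB hb
    obtain ⟨h5, h6⟩ := hf.hessOp_add h1 h3
    exact ⟨h5, by simpa [h2, h4] using h6⟩
  refine concaveOn_iff_forall_pos.2 ⟨convex_iff_forall_pos.2 ?_, ?_⟩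
  · intro A hA B hB a b ha hb hab
    exact (key A hA B hB a b ha hb hab).1
  · intro A hA B hB a b ha hb hab
    exact (key A hA B hB a b ha hb hab).2

/-- This is the room that later absorbs a Taylor error proportional to tr M, simultaneously for all
M. Subtracting a multiple of the identity shifts every eigenvalue, so openness of Γ and continuity
of f suffice. -/
theorem StructureConditions.sub_smul_one_mem (hf : StructureConditions Γ f)
    {A : Matrix (Fin n) (Fin n) ℝ} (hA : A ∈ matrixCone Γ) {η : ℝ} (hη : 0 < η) :
    ∃ ε : ℝ, 0 < ε ∧ A - ε • (1 : Matrix (Fin n) (Fin n) ℝ) ∈ matrixCone Γ ∧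
      hessOp f A - η < hessOp f (A - ε • (1 : Matrix (Fin n) (Fin n) ℝ)) := by
  obtain ⟨hH, hd⟩ := hA
  obtain ⟨Q, hQ, hQA⟩ := exists_orthogonal_diagonalization hH
  have hE : ∀ ε : ℝ, A - ε • (1 : Matrix (Fin n) (Fin n) ℝ) =
      Q * Matrix.diagonal (hH.eigenvalues - ε • fun _ => (1 : ℝ)) * Q.transpose := by
    intro ε
    have h1 : Matrix.diagonal (hH.eigenvalues - ε • fun _ => (1 : ℝ)) =
        Matrix.diagonal hH.eigenvalues - ε • (1 : Matrix (Fin n) (Fin n) ℝ) := by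
      rw [← Matrix.diagonal_one, ← Matrix.diagonal_smul, Matrix.diagonal_sub]; rfl
    rw [h1, Matrix.mul_sub, Matrix.sub_mul, ← hQA, Matrix.mul_smul, Matrix.smul_mul, mul_one,
      orthogonal_mul_transpose hQ]
  have hc : Continuous fun ε : ℝ => hH.eigenvalues - ε • fun _ : Fin n => (1 : ℝ) := by fun_prop
  have h0 : hH.eigenvalues - (0 : ℝ) • (fun _ : Fin n => (1 : ℝ)) = hH.eigenvalues := by simp
  have e1 : ∀ᶠ ε : ℝ in 𝓝 0, hH.eigenvalues - ε • (fun _ : Fin n => (1 : ℝ)) ∈ Γ :=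
    hc.continuousAt.eventually_mem (by rw [h0]; exact hf.isOpen.mem_nhds hd)
  have hfc : ContinuousAt f hH.eigenvalues :=
    hf.contDiffOn.continuousOn.continuousAt (hf.isOpen.mem_nhds hd)
  have hfc' : Tendsto (fun ε : ℝ => f (hH.eigenvalues - ε • fun _ : Fin n => (1 : ℝ))) (𝓝 0)
      (𝓝 (f hH.eigenvalues)) := by
    refine hfc.tendsto.comp ?_
    simpa [h0] using hc.tendsto 0
  have e2 := hfc'.eventually_const_lt (sub_lt_self _ hη)
  obtain ⟨δ, hδ, hδ'⟩ := Metric.eventually_nhds_iff.1 (e1.and e2)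
  obtain ⟨h3, h4⟩ := @hδ' (δ / 2) (by rw [Real.dist_eq, sub_zero, abs_of_pos] <;> linarith)
  obtain ⟨h5, h6⟩ := hf.conj_diagonal_mem hQ h3
  refine ⟨δ / 2, by positivity, by rwa [hE], ?_⟩
  rw [hE, h6, hessOp_eq hH]
  exact h4

end EigenvalueCone

/-! ### The family 𝓜: positivity, and F as the infimum of the linear functionals tr(M ·). -/

section GradientMatrices

variable {n : ℕ} {Γ : Set (Fin n → ℝ)} {f : (Fin n → ℝ) → ℝ}

/-- The segment from d to d + w lies in Γ by convexity, and along it the derivative of f is a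
nonnegative combination of positive partial derivatives with some positive weight. -/
theorem StructureConditions.strictMono (hf : StructureConditions Γ f) {d w : Fin n → ℝ}
    (hd : d ∈ Γ) (hdw : d + w ∈ Γ) (hw : ∀ i, 0 ≤ w i) (hw0 : ∃ i, w i ≠ 0) :
    f d < f (d + w) := by
  have hmem : ∀ t ∈ Icc (0 : ℝ) 1, d + t • w ∈ Γ := by
    intro t ht
    have := hf.convex hd hdw (sub_nonneg.2 ht.2) ht.1 (by ring)
    convert this using 1
    ext i; simp; ring
  have hder : ∀ t ∈ Icc (0 : ℝ) 1, HasDerivAt (fun t : ℝ => f (d + t • w))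
      (fderiv ℝ f (d + t • w) w) t := by
    intro t ht
    have h1 : DifferentiableAt ℝ f (d + t • w) :=
      (hf.contDiffOn.contDiffAt (hf.isOpen.mem_nhds (hmem t ht))).differentiableAt (by norm_num)
    have h2 : HasDerivAt (fun t : ℝ => d + t • w) w t := by
      simpa using ((hasDerivAt_id t).smul_const w).const_add d
    exact h1.hasFDerivAt.comp_hasDerivAt t h2
  have hpos : ∀ t ∈ Icc (0 : ℝ) 1, 0 < fderiv ℝ f (d + t • w) w := by
    intro t ht
    have hE : w = ∑ i, w i • (Pi.single i 1 : Fin n → ℝ) := by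
      ext j; simp [Finset.sum_apply, Pi.single_apply]
    have hE2 : fderiv ℝ f (d + t • w) w =
        ∑ i, w i * fderiv ℝ f (d + t • w) (Pi.single i 1) := by
      conv_lhs => rw [hE]
      simp only [map_sum, map_smul, smul_eq_mul]
      rw [← hE]
    rw [hE2]
    obtain ⟨i, hi⟩ := hw0
    refine Finset.sum_pos' (fun i _ => mul_nonneg (hw i) (hf.increasing _ (hmem t ht) i).le)
      ⟨i, Finset.mem_univ _, mul_pos ((hw i).lt_of_ne' hi) (hf.increasing _ (hmem t ht) i)⟩
  have hmono : StrictMonoOn (fun t : ℝ => f (d + t • w)) (Icc 0 1) := by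
    refine strictMonoOn_of_deriv_pos (convex_Icc 0 1)
      (fun t ht => (hder t ht).continuousAt.continuousWithinAt) fun t ht => ?_
    have ht' := interior_subset ht
    rw [(hder t ht').deriv]
    exact hpos t ht'
  simpa using hmono (left_mem_Icc.2 zero_le_one) (right_mem_Icc.2 zero_le_one) zero_lt_one

/-- Write T + P = (T - εI) + (εI + P), where the second summand is positive definite, and use
superadditivity. -/
theorem StructureConditions.add_posSemidef_mem (hf : StructureConditions Γ f)
    {T P : Matrix (Fin n) (Fin n) ℝ} (hT : T ∈ matrixCone Γ) (hP : P.PosSemidef) :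
    T + P ∈ matrixCone Γ := by
  obtain ⟨ε, hε, hm, _⟩ := hf.sub_smul_one_mem hT one_pos
  have h1 : (ε • (1 : Matrix (Fin n) (Fin n) ℝ) + P).PosDef :=
    (Matrix.PosDef.one.smul hε).add_posSemidef hP
  have := (hf.hessOp_add hm (hf.posDef_mem h1)).1
  convert this using 1
  abel

theorem StructureConditions.supergradient (hf : StructureConditions Γ f)
    {T M S : Matrix (Fin n) (Fin n) ℝ} (hT : T ∈ matrixCone Γ) (hM : IsGradientAt f T M)
    (hS : S.IsSymm) (hTS : T + S ∈ matrixCone Γ) :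
    hessOp f (T + S) - hessOp f T ≤ (M * S).trace := by
  have h1 := (hM.2 S hS).tendsto_slope_zero_right
  refine ge_of_tendsto h1 ?_
  filter_upwards [Ioo_mem_nhdsGT (zero_lt_one (α := ℝ))] with t ht
  obtain ⟨_, hc⟩ := hf.concaveOn_hessOp
  have h2 := hc hT hTS (sub_nonneg.2 ht.2.le) ht.1.le (by ring)
  have h3 : (1 - t) • T + t • (T + S) = T + t • S := by
    rw [sub_smul, one_smul, smul_add]; abel
  rw [h3] at h2
  simp only [smul_eq_mul] at h2
  rw [zero_add, zero_smul, add_zero, smul_eq_mul, ← div_eq_inv_mul, le_div_iff₀ ht.1]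
  linarith

/-- Superadditivity gives F(S) ≤ F(T+S) - F(T), and the supergradient inequality bounds the right
side. No closeness of S to T is needed, so one M serves all of the cone. -/
theorem StructureConditions.le_trace (hf : StructureConditions Γ f)
    {M S : Matrix (Fin n) (Fin n) ℝ} (hM : M ∈ gradientMatrices Γ f) (hS : S ∈ matrixCone Γ) :
    hessOp f S ≤ (M * S).trace := by
  obtain ⟨T, hT, hMT⟩ := hM
  obtain ⟨h1, h2⟩ := hf.hessOp_add hT hS
  have hS' : S.IsSymm := by
    have := hS.1; rwa [Matrix.IsHermitian, Matrix.conjTranspose_eq_transpose_of_trivial] at this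
  have := hf.supergradient hT hMT hS' h1
  linarith

theorem trace_mul_vecMulVec (M : Matrix (Fin n) (Fin n) ℝ) (v w : Fin n → ℝ) :
    (M * Matrix.vecMulVec v w).trace = w ⬝ᵥ M.mulVec v := by
  rw [Matrix.mul_vecMulVec, Matrix.trace_vecMulVec, dotProduct_comm]

/-- Test M on vvᵀ: it suffices that F strictly increases from T to T + vvᵀ. In an eigenbasis of T +
vvᵀ the eigenvalues exceed the diagonal of T by the squared coordinates of v, which are not all
zero. -/
theorem StructureConditions.posDef (hf : StructureConditions Γ f)
    {M : Matrix (Fin n) (Fin n) ℝ} (hM : M ∈ gradientMatrices Γ f) : M.PosDef := by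
  obtain ⟨T, hT, hMT⟩ := hM
  have hMH : M.IsHermitian := by
    rw [Matrix.IsHermitian, Matrix.conjTranspose_eq_transpose_of_trivial]; exact hMT.1
  refine Matrix.PosDef.of_dotProduct_mulVec_pos hMH fun v hv => ?_
  have hP : (Matrix.vecMulVec v v).PosSemidef := by
    simpa using Matrix.posSemidef_vecMulVec_self_star v
  have hTP := hf.add_posSemidef_mem hT hP
  have hPs : (Matrix.vecMulVec v v).IsSymm := by
    rw [Matrix.IsSymm, Matrix.transpose_vecMulVec]
  have h1 := hf.supergradient hT hMT hPs hTP
  rw [trace_mul_vecMulVec] at h1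
  simp only [star_trivial]
  refine lt_of_lt_of_le ?_ h1
  rw [sub_pos]
  obtain ⟨hH, hd⟩ := hTP
  obtain ⟨Q, hQ, hQA⟩ := exists_orthogonal_diagonalization hH
  obtain ⟨a1, a2⟩ := hf.diag_conj hT hQ
  have hE : hH.eigenvalues = (fun i => (Q.transpose * T * Q) i i) +
      fun i => (Q.transpose.mulVec v i) ^ 2 := by
    have h := diag_conj_conj hQ hH.eigenvalues
    rw [← hQA] at h
    ext i
    have h' := congrFun (congrFun h i) i
    rw [Matrix.mul_add, Matrix.add_mul, Matrix.mul_vecMulVec, Matrix.vecMulVec_mul,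
      ← Matrix.mulVec_transpose] at h'
    simp only [Matrix.add_apply, Matrix.vecMulVec_apply, Matrix.diagonal_apply_eq] at h'
    simp only [Pi.add_apply]
    rw [← h', sq]
  rw [hessOp_eq hH, hE]
  refine a2.trans_lt (hf.strictMono a1 (hE ▸ hd) (fun i => sq_nonneg _) ?_)
  by_contra! hcon
  apply hv
  have h0 : Q.transpose.mulVec v = 0 := by
    ext i; exact pow_eq_zero_iff two_ne_zero |>.1 (hcon i)
  have : Q.mulVec (Q.transpose.mulVec v) = v := by
    rw [Matrix.mulVec_mulVec, orthogonal_mul_transpose hQ, Matrix.one_mulVec]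
  rw [← this, h0, Matrix.mulVec_zero]

theorem posSemidef_smul_one_add {H : Matrix (Fin n) (Fin n) ℝ} (hH : H.IsHermitian) {δ : ℝ}
    (hδ : ∀ i j, |H i j| ≤ δ) : ((n * δ) • (1 : Matrix (Fin n) (Fin n) ℝ) + H).PosSemidef := by
  refine Matrix.PosSemidef.of_dotProduct_mulVec_nonneg ?_ fun v => ?_
  · exact (Matrix.isHermitian_one.smul (by simp [IsSelfAdjoint])).add hH
  simp only [star_trivial, Matrix.add_mulVec, Matrix.smul_mulVec, Matrix.one_mulVec,
    dotProduct_add, dotProduct_smul, smul_eq_mul]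
  have h1 : v ⬝ᵥ H.mulVec v = ∑ i, ∑ j, H i j * (v i * v j) := by
    simp only [dotProduct, Matrix.mulVec, Finset.mul_sum]
    exact Finset.sum_congr rfl fun i _ => Finset.sum_congr rfl fun j _ => by ring
  have h2 : ∀ i j, -(δ * ((v i ^ 2 + v j ^ 2) / 2)) ≤ H i j * (v i * v j) := by
    intro i j
    have h3 : |H i j * (v i * v j)| ≤ δ * ((v i ^ 2 + v j ^ 2) / 2) := by
      rw [abs_mul]
      refine mul_le_mul (hδ i j) ?_ (abs_nonneg _) ((abs_nonneg _).trans (hδ i j))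
      rw [abs_le]
      constructor <;> nlinarith [sq_nonneg (v i + v j), sq_nonneg (v i - v j)]
    linarith [neg_abs_le (H i j * (v i * v j))]
  have h4 : -(n * δ * (v ⬝ᵥ v)) ≤ v ⬝ᵥ H.mulVec v := by
    rw [h1]
    refine le_trans (le_of_eq ?_) (Finset.sum_le_sum fun i _ => Finset.sum_le_sum fun j _ => h2 i j)
    simp only [Finset.sum_neg_distrib, ← Finset.mul_sum, ← Finset.sum_div, Finset.sum_add_distrib,
      Finset.sum_const, Finset.card_univ, Fintype.card_fin, dotProduct, nsmul_eq_mul]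
    simp only [sq]
    ring
  linarith

/-- The symmetric part of a matrix given by its entries. -/
def symPart (X : Fin n → Fin n → ℝ) : Matrix (Fin n) (Fin n) ℝ :=
  Matrix.of fun i j => (X i j + X j i) / 2

theorem symPart_isHermitian (X : Fin n → Fin n → ℝ) : (symPart X).IsHermitian := by
  ext i j; simp [symPart, add_comm]

theorem symPart_add (X Y : Fin n → Fin n → ℝ) : symPart (X + Y) = symPart X + symPart Y := by
  ext i j; simp [symPart]; ring

theorem symPart_smul (t : ℝ) (X : Fin n → Fin n → ℝ) : symPart (t • X) = t • symPart X := by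
  ext i j; simp [symPart]; ring

theorem symPart_of_isSymm {A : Matrix (Fin n) (Fin n) ℝ} (hA : A.IsSymm) :
    symPart (fun i j => A i j) = A := by
  ext i j; simp [symPart, hA.apply i j]

/-- A perturbation with entries at most ε/(n+1) is bounded below by -nε/(n+1) · I, which is strictly
less than the available margin εI. -/
theorem StructureConditions.isOpen_symPart (hf : StructureConditions Γ f) :
    IsOpen {X : Fin n → Fin n → ℝ | symPart X ∈ matrixCone Γ} := by
  rw [Metric.isOpen_iff]
  intro X hX
  obtain ⟨ε, hε, hm, _⟩ := hf.sub_smul_one_mem hX one_pos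
  refine ⟨ε / (n + 1), by positivity, fun Y hY => ?_⟩
  have hd : ∀ i j, |symPart (Y - X) i j| ≤ ε / (n + 1) := by
    intro i j
    have h1 : ∀ i j, |Y i j - X i j| ≤ ε / (n + 1) := fun i j => by
      have h2 := (dist_le_pi_dist (Y i) (X i) j).trans (dist_le_pi_dist Y X i)
      rw [Real.dist_eq] at h2
      exact h2.trans (Metric.mem_ball.1 hY).le
    have h3 := abs_le.1 (h1 i j)
    have h4 := abs_le.1 (h1 j i)
    simp only [symPart, Matrix.of_apply, Pi.sub_apply]
    rw [abs_le]; constructor <;> linarith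
  have h1 := posSemidef_smul_one_add (symPart_isHermitian _) hd
  have hpos : 0 < ε - n * (ε / (n + 1)) := by
    have : ε - n * (ε / (n + 1)) = ε / (n + 1) := by field_simp; ring
    rw [this]; positivity
  have h2 := (Matrix.PosDef.one (n := Fin n) (R := ℝ)).smul hpos |>.add_posSemidef h1
  have h3 := (hf.hessOp_add hm (hf.posDef_mem h2)).1
  have h4 : symPart Y = symPart X + symPart (Y - X) := by rw [← symPart_add]; simp
  change symPart Y ∈ matrixCone Γ
  convert h3 using 1
  rw [h4, sub_smul]; abel

theorem trace_mul_eq_sum (M A : Matrix (Fin n) (Fin n) ℝ) (hM : M.IsSymm) :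
    (M * A).trace = ∑ i, ∑ j, M i j * A i j := by
  simp only [Matrix.trace, Matrix.diag_apply, Matrix.mul_apply]
  rw [Finset.sum_comm]
  exact Finset.sum_congr rfl fun i _ => Finset.sum_congr rfl fun j _ => by rw [hM.apply]

/-- `F(A)` is the infimum of `tr (M A)` over the gradients of `F`. -/
theorem StructureConditions.exists_trace_lt (hf : StructureConditions Γ f)
    {A : Matrix (Fin n) (Fin n) ℝ} (hA : A ∈ matrixCone Γ) {η : ℝ} (hη : 0 < η) :
    ∃ M ∈ gradientMatrices Γ f, (M * A).trace < hessOp f A + η := by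
  -- F is extended to all arrays through their symmetric part, so that it lives on an open subset of
  -- a space with Lebesgue measure and Rademacher's theorem applies.
  set D : Set (Fin n → Fin n → ℝ) := {X | symPart X ∈ matrixCone Γ} with hD
  set G : (Fin n → Fin n → ℝ) → ℝ := fun X => hessOp f (symPart X) with hG
  have hDo : IsOpen D := hf.isOpen_symPart
  obtain ⟨hcv, hcc⟩ := hf.concaveOn_hessOp
  have hconc : ConcaveOn ℝ D G := by
    refine ⟨fun X hX Y hY a b ha hb hab => ?_, fun X hX Y hY a b ha hb hab => ?_⟩
    · have := hcv hX hY ha hb hab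
      simpa [hD, symPart_add, symPart_smul] using this
    · have := hcc hX hY ha hb hab
      simpa [hG, symPart_add, symPart_smul] using this
  have hAs : A.IsSymm := by
    have := hA.1; rwa [Matrix.IsHermitian, Matrix.conjTranspose_eq_transpose_of_trivial] at this
  set a : Fin n → Fin n → ℝ := fun i j => A i j with ha
  have haA : symPart a = A := symPart_of_isSymm hAs
  have haD : a ∈ D := by rw [hD]; change symPart a ∈ matrixCone Γ; rwa [haA]
  obtain ⟨K, t, ht, hK⟩ := hconc.locallyLipschitzOn hDo haD
  rw [hDo.nhdsWithin_eq haD] at ht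
  obtain ⟨r, hr, hrt⟩ := Metric.mem_nhds_iff.1 (inter_mem ht (hDo.mem_nhds haD))
  -- Small enough that two errors of size Kδ stay below η: one from F(T) against F(A), one from the
  -- derivative applied to A - T.
  set δ : ℝ := min r (η / (2 * (K + 1))) with hδ
  have hδ0 : 0 < δ := lt_min hr (by positivity)
  have hKδ : 2 * (K * δ) < η := by
    have h1 : δ * (2 * (K + 1)) ≤ η := by
      have := min_le_right r (η / (2 * ((K : ℝ) + 1)))
      rwa [← hδ, le_div_iff₀ (by positivity)] at this
    nlinarith [K.2]
  have hball : Metric.ball a δ ⊆ t ∩ D := (Metric.ball_subset_ball (min_le_left _ _)).trans hrt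
  have hLip : LipschitzOnWith K G (Metric.ball a δ) := hK.mono fun x hx => (hball hx).1
  -- F need not be known to be differentiable at A itself; a concave function is locally Lipschitz,
  -- hence differentiable at some point arbitrarily near A.
  obtain ⟨X, hXb, hXd⟩ : ∃ X ∈ Metric.ball a δ, DifferentiableAt ℝ G X := by
    have h1 := hLip.ae_differentiableWithinAt_of_mem (μ := volume)
    have h2 : volume (Metric.ball a δ) ≠ 0 := (Metric.measure_ball_pos volume a hδ0).ne'
    obtain ⟨X, hX, hX'⟩ := (frequently_ae_mem_iff.2 h2).and_eventually h1 |>.exists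
    exact ⟨X, hX, (hX' hX).differentiableAt (Metric.isOpen_ball.mem_nhds hX)⟩
  set ℓ := fderiv ℝ G X with hℓ
  set T := symPart X with hT
  have hTm : T ∈ matrixCone Γ := (hball hXb).2
  have hder : ∀ Y : Fin n → Fin n → ℝ,
      HasDerivAt (fun t : ℝ => hessOp f (T + t • symPart Y)) (ℓ Y) 0 := by
    intro Y
    have h1 : HasDerivAt (fun t : ℝ => X + t • Y) Y 0 := by
      simpa using ((hasDerivAt_id (0 : ℝ)).smul_const Y).const_add X
    have h2 : HasFDerivAt G ℓ (X + (0 : ℝ) • Y) := by simpa using hXd.hasFDerivAt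
    have h3 := h2.comp_hasDerivAt (0 : ℝ) h1
    simpa [hG, Function.comp_def, symPart_add, symPart_smul] using h3
  -- The derivative sees only the symmetric part of the direction, which makes its coefficient
  -- matrix M symmetric.
  have hsymm : ∀ Y : Fin n → Fin n → ℝ, ℓ Y = ℓ (fun i j => symPart Y i j) := by
    intro Y
    refine (hder Y).unique ?_
    have := hder (fun i j => symPart Y i j)
    rwa [symPart_of_isSymm] at this
    have := symPart_isHermitian Y
    rwa [Matrix.IsHermitian, Matrix.conjTranspose_eq_transpose_of_trivial] at this
  set M : Matrix (Fin n) (Fin n) ℝ := Matrix.of fun i j => ℓ (Pi.single i (Pi.single j 1)) with hM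
  have hMs : M.IsSymm := by
    ext i j
    simp only [hM, Matrix.transpose_apply, Matrix.of_apply]
    rw [hsymm, hsymm (Pi.single i _)]
    congr 1
    have hs : ∀ i j : Fin n, (Pi.single i (Pi.single j 1) : Fin n → Fin n → ℝ) =
        fun k l => if k = i ∧ l = j then 1 else 0 := by
      intro i j
      ext k l
      by_cases hk : k = i
      · subst hk; simp [Pi.single_apply]
      · simp [hk]
    ext k l
    rw [hs, hs]
    simp only [symPart, Matrix.of_apply]
    rw [add_comm]
    congr 2 <;> simp only [and_comm]
  have hMt : ∀ Y : Matrix (Fin n) (Fin n) ℝ, (M * Y).trace = ℓ (fun i j => Y i j) := by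
    intro Y
    rw [trace_mul_eq_sum M Y hMs]
    have hE : (fun i j => Y i j) = ∑ i, ∑ j, Y i j • (Pi.single i (Pi.single j 1) :
        Fin n → Fin n → ℝ) := by
      ext k l
      simp [Finset.sum_apply, Pi.single_apply, apply_ite, ite_apply]
    rw [hE]
    simp only [map_sum, map_smul, smul_eq_mul, hM, Matrix.of_apply]
    exact Finset.sum_congr rfl fun i _ => Finset.sum_congr rfl fun j _ => mul_comm _ _
  have hMg : IsGradientAt f T M := by
    refine ⟨hMs, fun H hH => ?_⟩
    rw [hMt]
    have := hder (fun i j => H i j)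
    rwa [symPart_of_isSymm hH] at this
  have hMmem : M ∈ gradientMatrices Γ f := ⟨T, hTm, hMg⟩
  refine ⟨M, hMmem, ?_⟩
  -- Euler's identity: differentiate F((1+t)T) = (1+t)F(T) at t = 0.
  have hEuler : (M * T).trace = hessOp f T := by
    have h1 := hMg.2 T (by
      have := hTm.1
      rwa [Matrix.IsHermitian, Matrix.conjTranspose_eq_transpose_of_trivial] at this)
    have h2 : HasDerivAt (fun t : ℝ => (1 + t) * hessOp f T) (hessOp f T) 0 := by
      simpa using ((hasDerivAt_id (0 : ℝ)).const_add 1).mul_const (hessOp f T)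
    refine h1.unique (h2.congr_of_eventuallyEq ?_)
    filter_upwards [Ioi_mem_nhds (show (-1 : ℝ) < 0 by norm_num)] with t ht
    have h3 : T + t • T = (1 + t) • T := by rw [add_smul, one_smul]
    rw [h3]
    exact (hf.hessOp_smul hTm (by linarith [mem_Ioi.1 ht])).2
  have h1 : (M * A).trace = hessOp f T + ℓ (a - X) := by
    have e1 : (M * A).trace = ℓ a := hMt A
    have e2 : (M * T).trace = ℓ X := by rw [hsymm X]; exact hMt T
    rw [map_sub, ← hEuler, e1, e2]
    ring
  have h2 : |ℓ (a - X)| ≤ K * δ := by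
    have h3 := norm_fderiv_le_of_lipschitzOn ℝ (Metric.isOpen_ball.mem_nhds hXb) hLip
    have h4 := ℓ.le_of_opNorm_le h3 (a - X)
    rw [Real.norm_eq_abs] at h4
    refine h4.trans (mul_le_mul_of_nonneg_left ?_ K.2)
    rw [← dist_eq_norm, dist_comm]
    exact (Metric.mem_ball.1 hXb).le
  have h3 : |G X - G a| ≤ K * δ := by
    have h4 := hLip.dist_le_mul X hXb a (Metric.mem_ball_self hδ0)
    rw [Real.dist_eq] at h4
    exact h4.trans (mul_le_mul_of_nonneg_left (Metric.mem_ball.1 hXb).le K.2)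
  have h4 : G a = hessOp f A := by rw [hG]; simp only [haA]
  have h5 : G X = hessOp f T := rfl
  rw [h4, h5] at h3
  have h6 := le_abs_self (ℓ (a - X))
  have h7 := le_abs_self (hessOp f T - hessOp f A)
  rw [h1]
  linarith

end GradientMatrices

/-! ### The Gaussian probability measure and integration by parts. -/

section Gaussian

variable {E : Type*} [NormedAddCommGroup E] [InnerProductSpace ℝ E] [FiniteDimensional ℝ E]
  [MeasurableSpace E] [BorelSpace E]

variable (E) in
/-- The probability measure with density `exp (-π ‖ζ‖²)`. -/
def gaussian : Measure E :=
  volume.withDensity fun ζ => ENNReal.ofReal (Real.exp (-Real.pi * ‖ζ‖ ^ 2))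

/-- A non-integrable function would have integral 0 by convention, but the closed form of the
integral is positive. -/
theorem integrable_exp_neg_mul_sq_norm {b : ℝ} (hb : 0 < b) :
    Integrable fun v : E => Real.exp (-b * ‖v‖ ^ 2) := by
  by_contra h
  have h1 := GaussianFourier.integral_rexp_neg_mul_sq_norm (V := E) hb
  rw [integral_undef h] at h1
  have : 0 < (Real.pi / b) ^ (Module.finrank ℝ E / 2 : ℝ) := by positivity
  exact this.ne h1

theorem lintegral_gaussian {k : E → ENNReal} (hk : Measurable k) :
    ∫⁻ ζ, k ζ ∂(gaussian E) =
      ∫⁻ ζ, ENNReal.ofReal (Real.exp (-Real.pi * ‖ζ‖ ^ 2)) * k ζ := by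
  rw [gaussian, lintegral_withDensity_eq_lintegral_mul _ (by fun_prop) hk]
  rfl

theorem integral_gaussian {F : Type*} [NormedAddCommGroup F] [NormedSpace ℝ F] (k : E → F) :
    ∫ ζ, k ζ ∂(gaussian E) = ∫ ζ, Real.exp (-Real.pi * ‖ζ‖ ^ 2) • k ζ := by
  rw [gaussian, integral_withDensity_eq_integral_toReal_smul (by fun_prop)
    (ae_of_all _ fun _ => ENNReal.ofReal_lt_top)]
  simp [ENNReal.toReal_ofReal (Real.exp_pos _).le]

theorem integrable_gaussian_iff {F : Type*} [NormedAddCommGroup F] [NormedSpace ℝ F] {k : E → F} :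
    Integrable k (gaussian E) ↔ Integrable fun ζ => Real.exp (-Real.pi * ‖ζ‖ ^ 2) • k ζ := by
  rw [gaussian, integrable_withDensity_iff_integrable_smul' (by fun_prop)
    (ae_of_all _ fun _ => ENNReal.ofReal_lt_top)]
  simp [ENNReal.toReal_ofReal (Real.exp_pos _).le]

instance : IsProbabilityMeasure (gaussian E) := by
  constructor
  rw [gaussian, withDensity_apply _ MeasurableSet.univ, Measure.restrict_univ,
    ← ofReal_integral_eq_lintegral_ofReal (integrable_exp_neg_mul_sq_norm Real.pi_pos)
      (ae_of_all _ fun _ => (Real.exp_pos _).le),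
    GaussianFourier.integral_rexp_neg_mul_sq_norm Real.pi_pos, div_self Real.pi_ne_zero]
  simp

theorem integrable_norm_gaussian : Integrable (fun ζ : E => ‖ζ‖) (gaussian E) := by
  rw [integrable_gaussian_iff]
  refine (integrable_exp_neg_mul_sq_norm (E := E) (b := Real.pi / 2) (by positivity)).mono'
    (by fun_prop) (ae_of_all _ fun ζ => ?_)
  have h1 : ‖ζ‖ ≤ Real.exp (Real.pi / 2 * ‖ζ‖ ^ 2) := by
    have h2 := Real.add_one_le_exp (Real.pi / 2 * ‖ζ‖ ^ 2)
    nlinarith [Real.pi_gt_three, sq_nonneg (‖ζ‖ - 1), sq_nonneg ‖ζ‖]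
  rw [norm_smul, norm_norm, Real.norm_eq_abs, Real.abs_exp]
  calc Real.exp (-Real.pi * ‖ζ‖ ^ 2) * ‖ζ‖
      ≤ Real.exp (-Real.pi * ‖ζ‖ ^ 2) * Real.exp (Real.pi / 2 * ‖ζ‖ ^ 2) := by gcongr
    _ = Real.exp (-(Real.pi / 2) * ‖ζ‖ ^ 2) := by rw [← Real.exp_add]; ring_nf

theorem integrable_of_linear_growth_gaussian {F : Type*} [NormedAddCommGroup F]
    {k : E → F} (hk : AEStronglyMeasurable k (gaussian E)) {C D : ℝ}
    (hC : ∀ ζ, ‖k ζ‖ ≤ C + D * ‖ζ‖) : Integrable k (gaussian E) :=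
  ((integrable_const C).add (integrable_norm_gaussian.const_mul D)).mono' hk
    (ae_of_all _ hC)

/-- Integration by parts against the Gaussian measure. -/
theorem integral_mul_inner_gaussian {k : E → ℝ} (hk : Differentiable ℝ k)
    {C D : ℝ} (hC : ∀ x, |k x| ≤ C) (hD : ∀ x, ‖fderiv ℝ k x‖ ≤ D) (e : E)
    (hm : Continuous (fderiv ℝ k)) :
    ∫ ζ, k ζ * inner ℝ ζ e ∂(gaussian E) =
      (2 * Real.pi)⁻¹ * ∫ ζ, fderiv ℝ k ζ e ∂(gaussian E) := by
  have hg : ∀ ζ : E, HasFDerivAt (fun ζ : E => Real.exp (-Real.pi * ‖ζ‖ ^ 2))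
      (Real.exp (-Real.pi * ‖ζ‖ ^ 2) • (-Real.pi) • ((2 : ℕ) • innerSL ℝ ζ)) ζ := by
    intro ζ
    exact ((hasStrictFDerivAt_norm_sq ζ).hasFDerivAt.const_mul (-Real.pi)).exp
  have i1 : Integrable (fun ζ => fderiv ℝ k ζ e) (gaussian E) :=
    integrable_of_linear_growth_gaussian (C := D * ‖e‖) (D := 0)
      (by fun_prop) fun ζ => by
        simpa using (fderiv ℝ k ζ).le_of_opNorm_le (hD ζ) e
  have i2 : Integrable k (gaussian E) :=
    integrable_of_linear_growth_gaussian (C := C) (D := 0)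
      hk.continuous.aestronglyMeasurable fun ζ => by simpa using hC ζ
  have i3 : Integrable (fun ζ => k ζ * inner ℝ ζ e) (gaussian E) :=
    integrable_of_linear_growth_gaussian (C := 0) (D := C * ‖e‖)
      (hk.continuous.mul (by fun_prop)).aestronglyMeasurable fun ζ => by
        rw [norm_mul, zero_add]
        calc ‖k ζ‖ * ‖(inner ℝ ζ e : ℝ)‖ ≤ C * (‖ζ‖ * ‖e‖) :=
              mul_le_mul (hC ζ) (norm_inner_le_norm ζ e) (norm_nonneg _)
                ((abs_nonneg _).trans (hC ζ))
          _ = _ := by ring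
  have i4 := i3.const_mul (-2 * Real.pi)
  rw [integrable_gaussian_iff] at i1 i2 i3 i4
  have h := integral_mul_fderiv_eq_neg_fderiv_mul_of_integrable (𝕜 := ℝ) (μ := volume) (f := k)
    (g := fun ζ : E => Real.exp (-Real.pi * ‖ζ‖ ^ 2)) (v := e) ?_ ?_ ?_ (fun ζ _ => hk ζ)
    (fun ζ _ => (hg ζ).differentiableAt)
  · simp only [(hg _).fderiv] at h
    rw [integral_gaussian, integral_gaussian]
    simp only [smul_eq_mul]
    have e1 : ∫ ζ : E, k ζ * (Real.exp (-Real.pi * ‖ζ‖ ^ 2) •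
        (-Real.pi) • ((2 : ℕ) • innerSL ℝ ζ)) e =
        (-2 * Real.pi) * ∫ ζ : E, Real.exp (-Real.pi * ‖ζ‖ ^ 2) * (k ζ * inner ℝ ζ e) := by
      rw [← integral_const_mul]
      congr 1; ext ζ
      simp; ring
    have e2 : ∫ ζ : E, fderiv ℝ k ζ e * Real.exp (-Real.pi * ‖ζ‖ ^ 2) =
        ∫ ζ : E, Real.exp (-Real.pi * ‖ζ‖ ^ 2) * fderiv ℝ k ζ e := by
      congr 1; ext ζ; ring
    rw [e1, e2] at h
    rw [eq_inv_mul_iff_mul_eq₀ (by positivity)]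
    linarith
  · refine i1.congr (ae_of_all _ fun ζ => ?_)
    simp [mul_comm]
  · refine i4.congr (ae_of_all _ fun ζ => ?_)
    simp only [(hg _).fderiv]
    simp; ring
  · refine i2.congr (ae_of_all _ fun ζ => ?_)
    simp [mul_comm]

end Gaussian

/-! ### Gaussian averages as solutions of a heat equation. -/

section GaussianAverage

variable {E : Type*} [NormedAddCommGroup E] [InnerProductSpace ℝ E] [FiniteDimensional ℝ E]
  [MeasurableSpace E] [BorelSpace E]

/-- The average of `k` over the Gaussian with covariance proportional to `σ² T Tᵀ`, centred at `x`. -/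
def gaussAvg {F : Type*} [NormedAddCommGroup F] [NormedSpace ℝ F] (T : E →L[ℝ] E) (k : E → F)
    (x : E) (σ : ℝ) : F :=
  ∫ ζ, k (x + σ • T ζ) ∂(gaussian E)

variable {F : Type*} [NormedAddCommGroup F] [NormedSpace ℝ F]

omit [FiniteDimensional ℝ E] [MeasurableSpace E] [BorelSpace E] [NormedSpace ℝ F] in
theorem norm_le_of_lipschitz {k : E → F} {K : NNReal} (hk : LipschitzWith K k) (T : E →L[ℝ] E)
    (x : E) (σ : ℝ) (ζ : E) :
    ‖k (x + σ • T ζ)‖ ≤ ‖k 0‖ + K * ‖x‖ + K * |σ| * ‖T‖ * ‖ζ‖ := by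
  have h1 : ‖k (x + σ • T ζ)‖ ≤ ‖k 0‖ + K * ‖x + σ • T ζ‖ := by
    have h2 := hk.dist_le_mul (x + σ • T ζ) 0
    rw [dist_eq_norm, dist_zero_right] at h2
    have h3 := norm_le_norm_add_norm_sub' (k (x + σ • T ζ)) (k 0)
    linarith
  have h4 : ‖x + σ • T ζ‖ ≤ ‖x‖ + |σ| * (‖T‖ * ‖ζ‖) := by
    refine (norm_add_le _ _).trans ?_
    rw [norm_smul, Real.norm_eq_abs]
    gcongr
    exact T.le_opNorm ζ
  nlinarith [K.2]

omit [NormedSpace ℝ F] in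
theorem integrable_comp_of_lipschitz {k : E → F} {K : NNReal} (hk : LipschitzWith K k)
    (T : E →L[ℝ] E) (x : E) (σ : ℝ) :
    Integrable (fun ζ => k (x + σ • T ζ)) (gaussian E) :=
  integrable_of_linear_growth_gaussian
    (hk.continuous.comp (by fun_prop : Continuous fun ζ => x + σ • T ζ)).aestronglyMeasurable
    (norm_le_of_lipschitz hk T x σ)

/-- Besides joint continuity, this bounds the distance between k and its average uniformly over the
whole space, which later confines the maximum in the comparison argument. -/
theorem dist_gaussAvg_le {k : E → F} {K : NNReal} (hk : LipschitzWith K k) (T : E →L[ℝ] E)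
    (x y : E) (σ τ : ℝ) :
    ‖gaussAvg T k x σ - gaussAvg T k y τ‖ ≤
      K * (‖x - y‖ + |σ - τ| * ‖T‖ * ∫ ζ, ‖ζ‖ ∂(gaussian E)) := by
  rw [gaussAvg, gaussAvg, ← integral_sub (integrable_comp_of_lipschitz hk T x σ)
    (integrable_comp_of_lipschitz hk T y τ)]
  have hi : Integrable (fun ζ : E => (K : ℝ) * (‖x - y‖ + |σ - τ| * ‖T‖ * ‖ζ‖)) (gaussian E) :=
    ((integrable_const _).add (integrable_norm_gaussian.const_mul _)).const_mul _
  refine (norm_integral_le_of_norm_le hi (ae_of_all _ fun ζ => ?_)).trans (le_of_eq ?_)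
  · have h1 := hk.dist_le_mul (x + σ • T ζ) (y + τ • T ζ)
    rw [dist_eq_norm, dist_eq_norm] at h1
    refine h1.trans (mul_le_mul_of_nonneg_left ?_ K.2)
    have h2 : x + σ • T ζ - (y + τ • T ζ) = (x - y) + (σ - τ) • T ζ := by
      rw [sub_smul]; abel
    rw [h2]
    refine (norm_add_le _ _).trans ?_
    rw [norm_smul, Real.norm_eq_abs, mul_assoc]
    gcongr
    exact T.le_opNorm ζ
  · rw [integral_const_mul, integral_add (integrable_const _) (integrable_norm_gaussian.const_mul _),
      integral_const_mul]
    simp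

theorem continuous_gaussAvg {k : E → F} {K : NNReal} (hk : LipschitzWith K k) (T : E →L[ℝ] E) :
    Continuous fun p : E × ℝ => gaussAvg T k p.1 p.2 := by
  rw [continuous_iff_continuousAt]
  intro p
  rw [ContinuousAt, tendsto_iff_norm_sub_tendsto_zero]
  refine squeeze_zero (fun _ => norm_nonneg _)
    (fun q => dist_gaussAvg_le hk T q.1 p.1 q.2 p.2) ?_
  have : Continuous fun q : E × ℝ =>
      (K : ℝ) * (‖q.1 - p.1‖ + |q.2 - p.2| * ‖T‖ * ∫ ζ, ‖ζ‖ ∂(gaussian E)) := by fun_prop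
  simpa using this.tendsto p

theorem gaussAvg_zero [CompleteSpace F] (k : E → F) (T : E →L[ℝ] E) (x : E) :
    gaussAvg T k x 0 = k x := by
  simp [gaussAvg]

theorem hasFDerivAt_gaussAvg {k : E → F} (hk : ContDiff ℝ 1 k) {K : NNReal}
    (hK : ∀ x, ‖fderiv ℝ k x‖ ≤ K) (T : E →L[ℝ] E) (x : E) (σ : ℝ) :
    HasFDerivAt (fun x => gaussAvg T k x σ) (gaussAvg T (fderiv ℝ k) x σ) x := by
  have hL : LipschitzWith K k := lipschitzWith_of_nnnorm_fderiv_le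
    (hk.differentiable (by norm_num)) fun x => by exact_mod_cast hK x
  have hc := hk.continuous_fderiv (by norm_num)
  refine hasFDerivAt_integral_of_dominated_of_fderiv_le (s := univ)
    (F' := fun x ζ => fderiv ℝ k (x + σ • T ζ)) (bound := fun _ => K)
    univ_mem
    (Eventually.of_forall fun y => (integrable_comp_of_lipschitz hL T y σ).aestronglyMeasurable)
    (integrable_comp_of_lipschitz hL T x σ)
    (hc.comp (by fun_prop : Continuous fun ζ => x + σ • T ζ)).aestronglyMeasurable
    (ae_of_all _ fun ζ y _ => hK _) (integrable_const _) (ae_of_all _ fun ζ y _ => ?_)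
  have h1 := ((hk.differentiable (by norm_num)) (y + σ • T ζ)).hasFDerivAt
  have h2 : HasFDerivAt (fun y : E => y + σ • T ζ) (ContinuousLinearMap.id ℝ E) y :=
    (hasFDerivAt_id y).add_const _
  simpa only [Function.comp_def, ContinuousLinearMap.comp_id] using h1.comp y h2

theorem continuous_gaussAvg_left {k : E → F} (hk : Continuous k) {K : ℝ}
    (hK : ∀ x, ‖k x‖ ≤ K) (T : E →L[ℝ] E) (σ : ℝ) :
    Continuous fun x => gaussAvg T k x σ :=
  continuous_of_dominated (bound := fun _ => K)
    (fun x => (hk.comp (by fun_prop : Continuous fun ζ => x + σ • T ζ)).aestronglyMeasurable)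
    (fun x => ae_of_all _ fun ζ => hK _) (integrable_const _)
    (ae_of_all _ fun ζ => hk.comp (by fun_prop))

variable {φ : E → ℝ} {K₁ K₂ : NNReal}

theorem contDiff_gaussAvg (hφ : ContDiff ℝ 2 φ) (h1 : ∀ x, ‖fderiv ℝ φ x‖ ≤ K₁)
    (h2 : ∀ x, ‖fderiv ℝ (fderiv ℝ φ) x‖ ≤ K₂) (T : E →L[ℝ] E) (σ : ℝ) :
    ContDiff ℝ 2 (fun x => gaussAvg T φ x σ) ∧
    fderiv ℝ (fderiv ℝ fun x => gaussAvg T φ x σ) =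
      fun x => gaussAvg T (fderiv ℝ (fderiv ℝ φ)) x σ := by
  have hφ1 : ContDiff ℝ 1 (fderiv ℝ φ) := hφ.fderiv_right (by norm_num)
  have e1 : ∀ x, HasFDerivAt (fun x => gaussAvg T φ x σ) (gaussAvg T (fderiv ℝ φ) x σ) x :=
    fun x => hasFDerivAt_gaussAvg (hφ.of_le (by norm_num)) h1 T x σ
  have e2 : ∀ x, HasFDerivAt (fun x => gaussAvg T (fderiv ℝ φ) x σ)
      (gaussAvg T (fderiv ℝ (fderiv ℝ φ)) x σ) x :=
    fun x => hasFDerivAt_gaussAvg hφ1 h2 T x σ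
  have e3 : fderiv ℝ (fun x => gaussAvg T φ x σ) = fun x => gaussAvg T (fderiv ℝ φ) x σ :=
    funext fun x => (e1 x).fderiv
  have e4 : fderiv ℝ (fun x => gaussAvg T (fderiv ℝ φ) x σ) =
      fun x => gaussAvg T (fderiv ℝ (fderiv ℝ φ)) x σ := funext fun x => (e2 x).fderiv
  refine ⟨?_, by rw [e3, e4]⟩
  have hc : ContDiff ℝ 1 (fun x => gaussAvg T (fderiv ℝ φ) x σ) := by
    rw [contDiff_one_iff_fderiv, e4]
    exact ⟨fun x => (e2 x).differentiableAt,
      continuous_gaussAvg_left (hφ1.continuous_fderiv (by norm_num)) h2 T σ⟩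
  have := (contDiff_succ_iff_hasFDerivAt (n := 1)).2 ⟨_, hc, e1⟩
  exact_mod_cast this

/-- The heat equation satisfied by Gaussian averages. -/
theorem hasDerivAt_gaussAvg {ι : Type*} [Fintype ι] (e : OrthonormalBasis ι ℝ E)
    (hφ : ContDiff ℝ 2 φ) (h1 : ∀ x, ‖fderiv ℝ φ x‖ ≤ K₁)
    (h2 : ∀ x, ‖fderiv ℝ (fderiv ℝ φ) x‖ ≤ K₂) (T : E →L[ℝ] E) (x : E) (σ : ℝ) :
    HasDerivAt (fun σ => gaussAvg T φ x σ)
      (σ / (2 * Real.pi) * ∑ i, gaussAvg T (fderiv ℝ (fderiv ℝ φ)) x σ (T (e i)) (T (e i))) σ := by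
  have hφ1 : ContDiff ℝ 1 (fderiv ℝ φ) := hφ.fderiv_right (by norm_num)
  have hd : Differentiable ℝ φ := hφ.differentiable (by norm_num)
  have hd1 : Differentiable ℝ (fderiv ℝ φ) := hφ1.differentiable (by norm_num)
  have hc1 : Continuous (fderiv ℝ φ) := hφ1.continuous
  have hc2 : Continuous (fderiv ℝ (fderiv ℝ φ)) := hφ1.continuous_fderiv (by norm_num)
  have hL : LipschitzWith K₁ φ := lipschitzWith_of_nnnorm_fderiv_le hd
    fun x => by exact_mod_cast h1 x
  have key := (hasDerivAt_integral_of_dominated_loc_of_deriv_le (μ := gaussian E) (s := univ)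
    (x₀ := σ) (F := fun σ ζ => φ (x + σ • T ζ)) (F' := fun σ ζ => fderiv ℝ φ (x + σ • T ζ) (T ζ))
    (bound := fun ζ => K₁ * (‖T‖ * ‖ζ‖)) univ_mem
    (Eventually.of_forall fun τ => (integrable_comp_of_lipschitz hL T x τ).aestronglyMeasurable)
    (integrable_comp_of_lipschitz hL T x σ)
    (Continuous.aestronglyMeasurable (by fun_prop))
    (ae_of_all _ fun ζ τ _ => ?_) ((integrable_norm_gaussian.const_mul _).const_mul _)
    (ae_of_all _ fun ζ τ _ => ?_)).2
  · refine key.congr_deriv ?_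
    -- Expanding ζ in the basis isolates the factors ⟨ζ, e i⟩ on which Gaussian integration by parts
    -- acts. It yields 1/(2π), the chain rule yields σ, and the second derivative falls on T(e i)
    -- twice.
    have e1 : ∀ ζ, fderiv ℝ φ (x + σ • T ζ) (T ζ) =
        ∑ i, fderiv ℝ φ (x + σ • T ζ) (T (e i)) * inner ℝ ζ (e i) := by
      intro ζ
      have h3 := congrArg ((fderiv ℝ φ (x + σ • T ζ)).comp T) (e.sum_repr' ζ)
      simp only [map_sum, map_smul, smul_eq_mul, ContinuousLinearMap.comp_apply] at h3
      rw [← h3]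
      exact Finset.sum_congr rfl fun i _ => by rw [real_inner_comm, mul_comm]
    have hk' : ∀ i ζ, HasFDerivAt (fun ζ => fderiv ℝ φ (x + σ • T ζ) (T (e i)))
        (σ • ((fderiv ℝ (fderiv ℝ φ) (x + σ • T ζ)).flip (T (e i))).comp T) ζ := by
      intro i ζ
      have g1 := (hd1 (x + σ • T ζ)).hasFDerivAt
      have g2 : HasFDerivAt (fun ζ => x + σ • T ζ) (σ • T) ζ :=
        ((T.hasFDerivAt (x := ζ)).const_smul σ).const_add x
      have g3 := (g1.comp ζ g2).clm_apply (hasFDerivAt_const (T (e i)) ζ)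
      refine g3.congr_fderiv ?_
      ext v
      simp
    have hkf : ∀ i, fderiv ℝ (fun ζ => fderiv ℝ φ (x + σ • T ζ) (T (e i))) = fun ζ =>
        σ • ((fderiv ℝ (fderiv ℝ φ) (x + σ • T ζ)).flip (T (e i))).comp T :=
      fun i => funext fun ζ => (hk' i ζ).fderiv
    have hib : ∀ i, Integrable (fun ζ => fderiv ℝ φ (x + σ • T ζ) (T (e i)) * inner ℝ ζ (e i))
        (gaussian E) := by
      intro i
      refine integrable_of_linear_growth_gaussian (C := 0) (D := K₁ * ‖T (e i)‖)
        (Continuous.aestronglyMeasurable (by fun_prop)) fun ζ => ?_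
      rw [norm_mul, zero_add]
      refine mul_le_mul ((fderiv ℝ φ (x + σ • T ζ)).le_of_opNorm_le (h1 _) _) ?_ (norm_nonneg _)
        (by positivity)
      simpa using norm_inner_le_norm (𝕜 := ℝ) ζ (e i)
    have hi2 := integrable_of_linear_growth_gaussian (F := E →L[ℝ] E →L[ℝ] ℝ)
        (k := fun ζ => fderiv ℝ (fderiv ℝ φ) (x + σ • T ζ)) (C := K₂) (D := 0)
        (Continuous.aestronglyMeasurable (by fun_prop)) fun ζ => by simpa using h2 _
    simp only [e1]
    rw [integral_finsetSum _ fun i _ => hib i, Finset.mul_sum]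
    refine Finset.sum_congr rfl fun i _ => ?_
    rw [integral_mul_inner_gaussian (fun ζ => (hk' i ζ).differentiableAt)
      (C := K₁ * ‖T (e i)‖) (D := |σ| * (K₂ * ‖T (e i)‖ * ‖T‖))
      (fun ζ => (fderiv ℝ φ (x + σ • T ζ)).le_of_opNorm_le (h1 _) _) (fun ζ => ?bd) (e i) ?ct]
    · rw [gaussAvg, ContinuousLinearMap.integral_apply hi2,
        ContinuousLinearMap.integral_apply, hkf]
      · simp only [_root_.smul_apply, ContinuousLinearMap.comp_apply,
          ContinuousLinearMap.flip_apply, smul_eq_mul, integral_const_mul]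
        rw [div_eq_mul_inv]; ring
      · exact hi2.apply_continuousLinearMap _
    case ct =>
      rw [hkf]
      have : Continuous fun ζ => fderiv ℝ (fderiv ℝ φ) (x + σ • T ζ) := by fun_prop
      have h3 : Continuous fun ζ => (fderiv ℝ (fderiv ℝ φ) (x + σ • T ζ)).flip (T (e i)) :=
        ((ContinuousLinearMap.flipₗᵢ ℝ E E ℝ).continuous.comp this).clm_apply continuous_const
      exact (h3.clm_comp (continuous_const (y := T))).const_smul σ
    case bd =>
      rw [hkf, norm_smul, Real.norm_eq_abs]
      refine mul_le_mul_of_nonneg_left ?_ (abs_nonneg _)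
      refine (ContinuousLinearMap.opNorm_comp_le _ _).trans ?_
      refine mul_le_mul_of_nonneg_right ?_ (norm_nonneg _)
      refine (ContinuousLinearMap.le_of_opNorm_le _ ?_ _)
      rw [ContinuousLinearMap.opNorm_flip]
      exact h2 _
  · refine ((fderiv ℝ φ (x + τ • T ζ)).le_of_opNorm_le (h1 _) _).trans ?_
    gcongr
    exact T.le_opNorm ζ
  · have g1 := (hd (x + τ • T ζ)).hasFDerivAt
    have g2 : HasDerivAt (fun τ : ℝ => x + τ • T ζ) (T ζ) τ := by
      simpa using ((hasDerivAt_id τ).smul_const (T ζ)).const_add x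
    exact g1.comp_hasDerivAt τ g2

end GaussianAverage

/-! ### Comparison of viscosity subsolutions with the heat flow. -/

section Comparison

variable {E : Type*} [NormedAddCommGroup E] [InnerProductSpace ℝ E] [FiniteDimensional ℝ E]
  [MeasurableSpace E] [BorelSpace E] {ι : Type*} [Fintype ι]

/-- `u` is a strict viscosity subsolution of `tr (Tᵀ D²u T) = 0`. -/
def IsSubsolution (e : OrthonormalBasis ι ℝ E) (T : E →L[ℝ] E) (u : E → ℝ) : Prop :=
  ∀ (x : E) (ψ : E → ℝ), ContDiff ℝ 2 ψ → IsLocalMax (fun y => u y - ψ y) x →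
    0 < ∑ i, fderiv ℝ (fderiv ℝ ψ) x (T (e i)) (T (e i))

omit [FiniteDimensional ℝ E] [MeasurableSpace E] [BorelSpace E] in
theorem contDiff_const_mul_norm_sq (ε : ℝ) : ContDiff ℝ 2 fun y : E => ε * ‖y‖ ^ 2 :=
  contDiff_const.mul (contDiff_norm_sq ℝ)

omit [FiniteDimensional ℝ E] [MeasurableSpace E] [BorelSpace E] in
theorem fderiv_fderiv_const_mul_norm_sq (ε : ℝ) (x v w : E) :
    fderiv ℝ (fderiv ℝ fun y : E => ε * ‖y‖ ^ 2) x v w = 2 * ε * inner ℝ v w := by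
  have h1 : (fderiv ℝ fun y : E => ε * ‖y‖ ^ 2) = ⇑((2 * ε) • innerSL ℝ : E →L[ℝ] E →L[ℝ] ℝ) := by
    ext y z
    rw [((hasStrictFDerivAt_norm_sq y).hasFDerivAt.const_mul ε).fderiv]
    simp; ring
  rw [h1, ContinuousLinearMap.fderiv]
  rfl

/-- Parabolic maximum principle with σ as time: the averages H solve the heat equation with initial
value φ ≥ u. If u exceeded H at (x, S), a penalised difference would have a positive maximum over a
compact cylinder, away from σ = 0 and from the lateral boundary. There the slice of H at time σ is
an admissible test function for u, and the strict subsolution inequality contradicts the sign of the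
time derivative. -/
theorem le_gaussAvg_of_contDiff {u φ : E → ℝ} {e : OrthonormalBasis ι ℝ E} {T : E →L[ℝ] E}
    (husc : UpperSemicontinuous u) (hsub : IsSubsolution e T u)
    (hφ : ContDiff ℝ 2 φ) {K₁ K₂ : NNReal} (h1 : ∀ x, ‖fderiv ℝ φ x‖ ≤ K₁)
    (h2 : ∀ x, ‖fderiv ℝ (fderiv ℝ φ) x‖ ≤ K₂) (huφ : ∀ x, u x ≤ φ x) (x : E) {S : ℝ}
    (hS : 0 ≤ S) : u x ≤ gaussAvg T φ x S := by
  by_contra! hlt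
  have hL : LipschitzWith K₁ φ := lipschitzWith_of_nnnorm_fderiv_le
    (hφ.differentiable (by norm_num)) fun x => by exact_mod_cast h1 x
  set q : ℝ := ∑ i, ‖T (e i)‖ ^ 2 with hq
  have hq0 : 0 ≤ q := Finset.sum_nonneg fun i _ => sq_nonneg _
  -- With this constant the penalty ‖y‖² + cσ² solves the same heat equation, so it does not disturb
  -- the contradiction.
  set c : ℝ := q / (2 * Real.pi) with hc
  have hc0 : 0 ≤ c := by have := Real.pi_pos; positivity
  set m : ℝ := ∫ ζ, ‖ζ‖ ∂(gaussian E) with hm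
  have hm0 : 0 ≤ m := integral_nonneg fun _ => norm_nonneg _
  obtain ⟨ε, hε, hεx⟩ : ∃ ε : ℝ, 0 < ε ∧ ε * (‖x‖ ^ 2 + c * S ^ 2) < u x - gaussAvg T φ x S := by
    have hpos : 0 < ‖x‖ ^ 2 + c * S ^ 2 + 1 := by positivity
    refine ⟨(u x - gaussAvg T φ x S) / (‖x‖ ^ 2 + c * S ^ 2 + 1), div_pos (by linarith) hpos, ?_⟩
    rw [div_mul_eq_mul_div, div_lt_iff₀ hpos]
    nlinarith
  set Ψ : E × ℝ → ℝ := fun p => u p.1 - (gaussAvg T φ p.1 p.2 + ε * (‖p.1‖ ^ 2 + c * p.2 ^ 2))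
    with hΨ
  -- At radius R the penalty ε‖y‖² beats the uniform bound on φ - H. The added 1 ensures ‖y‖ ≤ ‖y‖².
  set R : ℝ := max ‖x‖ (K₁ * (S * ‖T‖ * m) / ε + 1) with hR
  have hcont : Continuous fun p : E × ℝ =>
      gaussAvg T φ p.1 p.2 + ε * (‖p.1‖ ^ 2 + c * p.2 ^ 2) :=
    (continuous_gaussAvg hL T).add (by fun_prop)
  have hΨu : UpperSemicontinuous Ψ := by
    have g1 : UpperSemicontinuous fun p : E × ℝ => u p.1 := husc.comp continuous_fst
    have g2 := g1.add (hcont.neg.upperSemicontinuous)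
    simp only [hΨ, sub_eq_add_neg]
    exact g2
  have hxmem : (x, S) ∈ Metric.closedBall (0 : E) R ×ˢ Icc 0 S :=
    ⟨by simp [hR], ⟨hS, le_rfl⟩⟩
  obtain ⟨⟨y, σ⟩, ⟨hy, hσ⟩, hmax⟩ := (hΨu.upperSemicontinuousOn _).exists_isMaxOn ⟨_, hxmem⟩
    ((isCompact_closedBall (0 : E) R).prod isCompact_Icc)
  have hpos : 0 < Ψ (y, σ) := by
    have := hmax hxmem
    refine lt_of_lt_of_le ?_ this
    simp only [hΨ]; linarith
  have hub : ∀ z : E, φ z - gaussAvg T φ z σ ≤ K₁ * (S * ‖T‖ * m) := by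
    intro z
    have g1 := dist_gaussAvg_le hL T z z 0 σ
    rw [gaussAvg_zero, sub_self, norm_zero, zero_add, zero_sub, abs_neg, abs_of_nonneg hσ.1] at g1
    refine (le_abs_self _).trans (g1.trans ?_)
    have := hσ.2
    gcongr
  have hyR : ‖y‖ < R := by
    by_contra! hcon
    have g1 := hub y
    have g2 := huφ y
    have hR1 : 1 ≤ ‖y‖ := by
      have : 0 ≤ K₁ * (S * ‖T‖ * m) / ε := by positivity
      linarith [le_max_right ‖x‖ (K₁ * (S * ‖T‖ * m) / ε + 1)]
    have g3 : K₁ * (S * ‖T‖ * m) ≤ ε * ‖y‖ := by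
      rw [mul_comm ε, ← div_le_iff₀ hε]
      linarith [le_max_right ‖x‖ (K₁ * (S * ‖T‖ * m) / ε + 1)]
    have g4 : ε * ‖y‖ ≤ ε * ‖y‖ ^ 2 := by gcongr; nlinarith
    have g5 : 0 ≤ ε * (c * σ ^ 2) := by positivity
    simp only [hΨ] at hpos
    linarith
  have hσ0 : 0 < σ := by
    refine lt_of_le_of_ne hσ.1 fun h0 => ?_
    simp only [hΨ, ← h0, gaussAvg_zero] at hpos
    have g2 := huφ y
    have g3 : 0 ≤ ε * (‖y‖ ^ 2 + c * 0 ^ 2) := by positivity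
    linarith
  obtain ⟨hH, hHd⟩ := contDiff_gaussAvg hφ h1 h2 T σ
  set D : ℝ := ∑ i, gaussAvg T (fderiv ℝ (fderiv ℝ φ)) y σ (T (e i)) (T (e i)) with hD
  have hloc : IsLocalMax (fun z => u z - (gaussAvg T φ z σ + ε * ‖z‖ ^ 2)) y := by
    have g1 : ∀ᶠ z in 𝓝 y, z ∈ Metric.closedBall (0 : E) R :=
      Filter.mem_of_superset (Metric.isOpen_ball.mem_nhds (by simpa using hyR))
        Metric.ball_subset_closedBall
    filter_upwards [g1] with z hz
    have g2 : Ψ (z, σ) ≤ Ψ (y, σ) := hmax (show (z, σ) ∈ _ from ⟨hz, hσ⟩)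
    simp only [hΨ] at g2
    linarith
  have hvis := hsub y _ (hH.add (contDiff_const_mul_norm_sq ε)) hloc
  have hfd : ∀ v, fderiv ℝ (fderiv ℝ fun z => gaussAvg T φ z σ + ε * ‖z‖ ^ 2) y v v =
      gaussAvg T (fderiv ℝ (fderiv ℝ φ)) y σ v v + 2 * ε * ‖v‖ ^ 2 := by
    intro v
    have d1 := hH.differentiable (by norm_num)
    have d2 := (contDiff_const_mul_norm_sq (E := E) ε).differentiable (by norm_num)
    have e1 : (fderiv ℝ fun z => gaussAvg T φ z σ + ε * ‖z‖ ^ 2) =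
        fun z => fderiv ℝ (fun z => gaussAvg T φ z σ) z + fderiv ℝ (fun z => ε * ‖z‖ ^ 2) z :=
      funext fun z => fderiv_fun_add (d1 z) (d2 z)
    rw [e1, fderiv_fun_add
      ((hH.fderiv_right (m := 1) (by norm_num)).differentiable (by norm_num) y)
      (((contDiff_const_mul_norm_sq (E := E) ε).fderiv_right (m := 1) (by norm_num)).differentiable
        (by norm_num) y), hHd]
    simp only [add_apply, fderiv_fderiv_const_mul_norm_sq, real_inner_self_eq_norm_sq]
  simp only [hfd, Finset.sum_add_distrib, ← Finset.mul_sum] at hvis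
  rw [← hD, ← hq] at hvis
  have hder : HasDerivAt (fun τ => gaussAvg T φ y τ + ε * (‖y‖ ^ 2 + c * τ ^ 2))
      (σ / (2 * Real.pi) * D + ε * (c * (2 * σ))) σ := by
    refine (hasDerivAt_gaussAvg e hφ h1 h2 T y σ).add ?_
    have := ((((hasDerivAt_id σ).pow 2).const_mul c).const_add (‖y‖ ^ 2)).const_mul ε
    simpa using this
  -- Left difference quotients are used because the maximum may occur at the final time σ = S.
  have hle : σ / (2 * Real.pi) * D + ε * (c * (2 * σ)) ≤ 0 := by
    refine le_of_tendsto hder.tendsto_slope_zero_left ?_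
    filter_upwards [Ioo_mem_nhdsLT (neg_lt_zero.2 hσ0)] with t ht
    have g2 : Ψ (y, σ + t) ≤ Ψ (y, σ) :=
      hmax (show (y, σ + t) ∈ _ from ⟨hy, by linarith [ht.1], by linarith [ht.2, hσ.2]⟩)
    simp only [hΨ] at g2
    rw [smul_eq_mul]
    exact mul_nonpos_of_nonpos_of_nonneg (inv_nonpos.2 ht.2.le) (by linarith)
  have hpi := Real.pi_pos
  have hE : σ / (2 * Real.pi) * D + ε * (c * (2 * σ)) =
      σ / (2 * Real.pi) * (D + 2 * ε * q) := by
    rw [hc]; field_simp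
  rw [hE] at hle
  have : 0 < σ / (2 * Real.pi) * (D + 2 * ε * q) := by positivity
  linarith

end Comparison

/-! ### From smooth majorants to u: mollification, sup-convolution, Gaussian sub-mean value
property. -/

section Submean

variable {E : Type*} [NormedAddCommGroup E] [InnerProductSpace ℝ E] [FiniteDimensional ℝ E]
  [MeasurableSpace E] [BorelSpace E] {ι : Type*} [Fintype ι]

-- Applied to a bump function and to its derivative: a Lipschitz constant of each convolution bounds
-- the first and second derivatives of the mollification.
open scoped Convolution in
theorem exists_lipschitzWith_convolution {F G H : Type*} [NormedAddCommGroup F] [NormedSpace ℝ F]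
    [NormedAddCommGroup G] [NormedSpace ℝ G] [NormedAddCommGroup H] [NormedSpace ℝ H]
    {k : E → F} {g : E → G} {K : NNReal} (hk : Continuous k) (hks : HasCompactSupport k)
    (hg : LipschitzWith K g) (L : F →L[ℝ] G →L[ℝ] H) :
    ∃ K' : NNReal, LipschitzWith K' (k ⋆[L, volume] g) := by
  have hex : ConvolutionExists k g L volume :=
    hks.convolutionExists_left L hk hg.continuous.locallyIntegrable
  have hki : Integrable k := hk.integrable_of_hasCompactSupport hks
  have hI : 0 ≤ ∫ t, ‖k t‖ := integral_nonneg fun _ => norm_nonneg _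
  refine ⟨⟨‖L‖ * (∫ t, ‖k t‖) * K, by positivity⟩, LipschitzWith.of_dist_le_mul fun x y => ?_⟩
  rw [dist_eq_norm, convolution, convolution, ← integral_sub (hex x) (hex y)]
  refine (norm_integral_le_of_norm_le (g := fun t => ‖k t‖ * (‖L‖ * (K * dist x y)))
    (hki.norm.mul_const _) (ae_of_all _ fun t => ?_)).trans (le_of_eq ?_)
  · rw [← map_sub]
    have h1 := hg.dist_le_mul (x - t) (y - t)
    rw [dist_sub_right, dist_eq_norm] at h1
    calc _ ≤ ‖L‖ * ‖k t‖ * ‖g (x - t) - g (y - t)‖ := L.le_opNorm₂ _ _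
      _ ≤ ‖L‖ * ‖k t‖ * (K * dist x y) := by gcongr
      _ = _ := by ring
  · rw [integral_mul_const]
    change _ = ‖L‖ * (∫ t, ‖k t‖) * (K : ℝ) * dist x y
    ring

/-- Lipschitz functions are uniform limits of `C²` functions with bounded derivatives. -/
theorem exists_contDiff_approx {φ : E → ℝ} {K : NNReal} (hφ : LipschitzWith K φ) {δ : ℝ}
    (hδ : 0 < δ) : ∃ (φ' : E → ℝ) (K₁ K₂ : NNReal), ContDiff ℝ 2 φ' ∧
      (∀ x, ‖fderiv ℝ φ' x‖ ≤ K₁) ∧ (∀ x, ‖fderiv ℝ (fderiv ℝ φ') x‖ ≤ K₂) ∧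
      ∀ x, |φ' x - φ x| ≤ K * δ := by
  let b : ContDiffBump (0 : E) := ⟨δ / 2, δ, by positivity, by linarith⟩
  have hbc : HasCompactSupport (b.normed volume) := b.hasCompactSupport_normed
  have hbs : ContDiff ℝ 2 (b.normed volume) := b.contDiff_normed
  have hli : LocallyIntegrable φ := hφ.continuous.locallyIntegrable
  obtain ⟨K₁, h1⟩ := exists_lipschitzWith_convolution hbs.continuous hbc hφ
    (ContinuousLinearMap.lsmul ℝ ℝ)
  obtain ⟨K₂, h2⟩ := exists_lipschitzWith_convolution (hbs.continuous_fderiv (by norm_num))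
    (hbc.fderiv ℝ) hφ ((ContinuousLinearMap.lsmul ℝ ℝ).precompL E)
  have hd := fun x => hbc.hasFDerivAt_convolution_left (ContinuousLinearMap.lsmul ℝ ℝ)
    (hbs.of_le (by norm_num)) hli x
  refine ⟨_, K₁, K₂, hbc.contDiff_convolution_left (n := 2) (ContinuousLinearMap.lsmul ℝ ℝ) hbs hli,
    fun x => norm_fderiv_le_of_lipschitz ℝ h1, fun x => ?_, fun x => ?_⟩
  · rw [funext fun x => (hd x).fderiv]
    exact norm_fderiv_le_of_lipschitz ℝ h2
  · rw [← Real.dist_eq]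
    refine b.dist_normed_convolution_le hφ.continuous.aestronglyMeasurable fun y hy => ?_
    refine (hφ.dist_le_mul y x).trans ?_
    gcongr
    exact (Metric.mem_ball.1 hy).le

/-- Mollification moves φ by at most Kδ; raising it by Kδ keeps it above u, at a total cost 2Kδ. -/
theorem le_integral_gaussian_of_lipschitz {u φ : E → ℝ} {e : OrthonormalBasis ι ℝ E}
    {T : E →L[ℝ] E} (husc : UpperSemicontinuous u) (hsub : IsSubsolution e T u)
    {K : NNReal} (hφ : LipschitzWith K φ) (huφ : ∀ x, u x ≤ φ x) (x : E) :
    u x ≤ ∫ ζ, φ (x + T ζ) ∂(gaussian E) := by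
  refine le_of_forall_pos_le_add fun η hη => ?_
  set δ := η / (2 * (K + 1)) with hδ
  have hδ0 : 0 < δ := by positivity
  obtain ⟨φ', K₁, K₂, hs, h1, h2, h3⟩ := exists_contDiff_approx hφ hδ0
  have hL : LipschitzWith K₁ φ' := lipschitzWith_of_nnnorm_fderiv_le
    (hs.differentiable (by norm_num)) fun x => by exact_mod_cast h1 x
  have hfd : fderiv ℝ (fun x => φ' x + K * δ) = fderiv ℝ φ' := funext fun x => fderiv_add_const _
  have h4 := le_gaussAvg_of_contDiff (φ := fun x => φ' x + K * δ) husc hsub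
    (hs.add contDiff_const) (by rw [hfd]; exact h1) (by rw [hfd]; exact h2)
    (fun y => by have := (abs_le.1 (h3 y)).1; linarith [huφ y]) x zero_le_one
  have i1 := integrable_comp_of_lipschitz hL T x 1
  have i2 := integrable_comp_of_lipschitz hφ T x 1
  simp only [gaussAvg, one_smul] at h4 i1 i2
  refine h4.trans ?_
  have h5 : ∫ ζ, (φ' (x + T ζ) + K * δ) ∂(gaussian E) ≤
      ∫ ζ, (φ (x + T ζ) + 2 * (K * δ)) ∂(gaussian E) := by
    refine integral_mono (i1.add (integrable_const _)) (i2.add (integrable_const _)) fun ζ => ?_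
    have := (abs_le.1 (h3 (x + T ζ))).2
    simp only
    linarith
  refine h5.trans ?_
  rw [integral_add i2 (integrable_const _)]
  have h6 : 2 * (K * δ) ≤ η := by
    have : δ * (2 * (K + 1)) = η := by rw [hδ]; field_simp
    nlinarith [K.2]
  simpa using h6

/-- The sup-convolution of `u` with the cone of slope `k`. -/
def supConv (u : E → ℝ) (k : ℝ) (x : E) : ℝ := ⨆ y, (u y - k * ‖x - y‖)

section SupConv

variable {u : E → ℝ} {C : ℝ}

omit [InnerProductSpace ℝ E] [FiniteDimensional ℝ E] [MeasurableSpace E] [BorelSpace E] in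
theorem supConv_term_le (hC : ∀ y, u y ≤ C * (1 + ‖y‖)) (hC0 : 0 ≤ C) {k : ℝ} (x y : E) :
    u y - k * ‖x - y‖ ≤ C + C * ‖x‖ - (k - C) * ‖x - y‖ := by
  have h1 : ‖y‖ ≤ ‖x‖ + ‖x - y‖ := by
    have := norm_le_norm_add_norm_sub' y x
    rwa [norm_sub_rev] at this
  nlinarith [hC y]

omit [InnerProductSpace ℝ E] [FiniteDimensional ℝ E] [MeasurableSpace E] [BorelSpace E] in
theorem supConv_bddAbove (hC : ∀ y, u y ≤ C * (1 + ‖y‖)) (hC0 : 0 ≤ C) {k : ℝ} (hk : C ≤ k)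
    (x : E) : BddAbove (range fun y => u y - k * ‖x - y‖) := by
  refine ⟨C + C * ‖x‖, ?_⟩
  rintro _ ⟨y, rfl⟩
  have := supConv_term_le hC hC0 (k := k) x y
  have h2 := mul_nonneg (sub_nonneg.2 hk) (norm_nonneg (x - y))
  linarith

omit [InnerProductSpace ℝ E] [FiniteDimensional ℝ E] [MeasurableSpace E] [BorelSpace E] in
theorem le_supConv (hC : ∀ y, u y ≤ C * (1 + ‖y‖)) (hC0 : 0 ≤ C) {k : ℝ} (hk : C ≤ k)
    (x : E) : u x ≤ supConv u k x := by
  have h := le_ciSup (supConv_bddAbove hC hC0 hk x) x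
  simp only [sub_self, norm_zero, mul_zero, sub_zero] at h
  exact h

omit [InnerProductSpace ℝ E] [FiniteDimensional ℝ E] [MeasurableSpace E] [BorelSpace E] in
theorem lipschitzWith_supConv (hC : ∀ y, u y ≤ C * (1 + ‖y‖)) (hC0 : 0 ≤ C) {k : NNReal}
    (hk : C ≤ k) : LipschitzWith k (supConv u k) := by
  refine LipschitzWith.of_le_add_mul k fun x z => ciSup_le fun y => ?_
  have h1 := le_ciSup (supConv_bddAbove hC hC0 hk z) y
  have h2 : ‖z - y‖ ≤ ‖x - y‖ + dist x z := by
    rw [dist_comm, dist_eq_norm]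
    have := norm_add_le (x - y) (z - x)
    rwa [show x - y + (z - x) = z - y by abel] at this
  simp only [supConv]
  nlinarith [k.2]

omit [InnerProductSpace ℝ E] [FiniteDimensional ℝ E] [MeasurableSpace E] [BorelSpace E] in
theorem supConv_anti (hC : ∀ y, u y ≤ C * (1 + ‖y‖)) (hC0 : 0 ≤ C) {k k' : ℝ} (hk : C ≤ k)
    (hkk : k ≤ k') (x : E) : supConv u k' x ≤ supConv u k x := by
  refine ciSup_mono (supConv_bddAbove hC hC0 hk x) fun y => ?_
  have := mul_le_mul_of_nonneg_right hkk (norm_nonneg (x - y))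
  linarith

-- Near x, semicontinuity keeps u(y) below any b > u(x). At distance at least δ, the excess slope j
-- beyond the growth rate C pushes the competitors below b once jδ is large.
omit [InnerProductSpace ℝ E] [FiniteDimensional ℝ E] [MeasurableSpace E] [BorelSpace E] in
theorem tendsto_supConv (husc : UpperSemicontinuous u) (hC : ∀ y, u y ≤ C * (1 + ‖y‖))
    (hC0 : 0 ≤ C) (x : E) : Tendsto (fun j : ℕ => supConv u (C + j) x) atTop (𝓝 (u x)) := by
  rw [tendsto_order]
  refine ⟨fun a ha => Eventually.of_forall fun j => ha.trans_le
    (le_supConv hC hC0 (by simp) x), fun a ha => ?_⟩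
  obtain ⟨b, hb, hba⟩ := exists_between ha
  obtain ⟨δ, hδ, hδ'⟩ := Metric.eventually_nhds_iff.1 (husc x b hb)
  obtain ⟨j₀, hj₀⟩ := exists_nat_ge ((C + C * ‖x‖ - b) / δ)
  filter_upwards [eventually_ge_atTop j₀] with j hj
  refine lt_of_le_of_lt (ciSup_le fun y => ?_) hba
  by_cases hy : dist y x < δ
  · have h1 := hδ' hy
    have h2 : 0 ≤ (C + j) * ‖x - y‖ := by positivity
    linarith
  · have h1 := supConv_term_le hC hC0 (k := C + j) x y
    rw [dist_comm, dist_eq_norm, not_lt] at hy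
    have h2 : C + C * ‖x‖ - b ≤ j * δ := by
      rw [div_le_iff₀ hδ] at hj₀
      have : (j₀ : ℝ) ≤ j := by exact_mod_cast hj
      nlinarith
    have h3 : (j : ℝ) * δ ≤ j * ‖x - y‖ := by gcongr
    have h4 : (C + j - C) * ‖x - y‖ = j * ‖x - y‖ := by ring
    linarith

end SupConv

theorem lintegral_neg_part_le_of_integral_nonneg {α : Type*} [MeasurableSpace α] {μ : Measure α}
    {k : α → ℝ} (hk : Integrable k μ) (h0 : 0 ≤ ∫ a, k a ∂μ) :
    ∫⁻ a, ENNReal.ofReal (-k a) ∂μ ≤ ∫⁻ a, ENNReal.ofReal (k a) ∂μ := by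
  rw [integral_eq_lintegral_pos_part_sub_lintegral_neg_part hk, sub_nonneg] at h0
  have h1 : ∫⁻ a, ENNReal.ofReal (-k a) ∂μ ≠ ⊤ := by
    refine ne_top_of_le_ne_top hk.2.ne (lintegral_mono fun a => ?_)
    rw [← ofReal_norm]
    exact ENNReal.ofReal_le_ofReal (neg_le_abs _)
  have h2 : ∫⁻ a, ENNReal.ofReal (k a) ∂μ ≠ ⊤ := by
    refine ne_top_of_le_ne_top hk.2.ne (lintegral_mono fun a => ?_)
    rw [← ofReal_norm]
    exact ENNReal.ofReal_le_ofReal (le_abs_self _)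
  exact (ENNReal.toReal_le_toReal h1 h2).1 h0

/-- The sub-mean value property of viscosity subsolutions with respect to Gaussians. -/
theorem lintegral_gaussian_submean {u : E → ℝ} {e : OrthonormalBasis ι ℝ E} {T : E →L[ℝ] E}
    (husc : UpperSemicontinuous u) {C : ℝ} (hC : ∀ y, u y ≤ C * (1 + ‖y‖)) (hC0 : 0 ≤ C)
    (hsub : IsSubsolution e T u) (x : E) :
    ∫⁻ ζ, ENNReal.ofReal (u x - u (x + T ζ)) ∂(gaussian E) ≤
      ∫⁻ ζ, ENNReal.ofReal (u (x + T ζ) - u x) ∂(gaussian E) := by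
  set a : ℕ → E → ℝ := fun j ζ => supConv u (C + j) (x + T ζ) - u x with ha
  have hL : ∀ j : ℕ, ∃ K : NNReal, (K : ℝ) = C + j ∧ LipschitzWith K (supConv u (C + j)) := by
    intro j
    have h0 : 0 ≤ C + j := by positivity
    have h1 : ((C + j).toNNReal : ℝ) = C + j := Real.coe_toNNReal _ h0
    refine ⟨(C + j).toNNReal, h1, ?_⟩
    have := lipschitzWith_supConv (k := (C + j).toNNReal) hC hC0 (by rw [h1]; simp)
    rwa [h1] at this
  have hint : ∀ j, Integrable (a j) (gaussian E) := by
    intro j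
    obtain ⟨K, _, hK⟩ := hL j
    have := integrable_comp_of_lipschitz hK T x 1
    simp only [one_smul] at this
    exact this.sub (integrable_const _)
  have hnn : ∀ j, 0 ≤ ∫ ζ, a j ζ ∂(gaussian E) := by
    intro j
    obtain ⟨K, _, hK⟩ := hL j
    have h1 := le_integral_gaussian_of_lipschitz husc hsub hK
      (fun y => le_supConv hC hC0 (by simp) y) x
    have h2 := integrable_comp_of_lipschitz hK T x 1
    simp only [one_smul] at h2
    rw [ha]
    simp only
    rw [integral_sub h2 (integrable_const _)]
    simpa using h1
  have hmeas : ∀ j, Measurable (a j) := by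
    intro j
    obtain ⟨K, _, hK⟩ := hL j
    exact ((hK.continuous.comp (by fun_prop : Continuous fun ζ => x + T ζ)).sub
      continuous_const).measurable
  have hlim : ∀ ζ, Tendsto (fun j => a j ζ) atTop (𝓝 (u (x + T ζ) - u x)) := fun ζ =>
    (tendsto_supConv husc hC hC0 _).sub_const _
  have hanti : ∀ ζ, Antitone fun j => a j ζ := by
    intro ζ i j hij
    have : (i : ℝ) ≤ j := by exact_mod_cast hij
    exact sub_le_sub_right (supConv_anti hC hC0 (by simp) (by linarith) _) _
  -- The sup-convolutions decrease to u. Their positive parts decrease from an integrable one, while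
  -- the negative parts increase, so the limit passes in [0,∞] without any lower bound on u.
  have hR : Tendsto (fun j => ∫⁻ ζ, ENNReal.ofReal (a j ζ) ∂(gaussian E)) atTop
      (𝓝 (∫⁻ ζ, ENNReal.ofReal (u (x + T ζ) - u x) ∂(gaussian E))) := by
    refine lintegral_tendsto_of_tendsto_of_antitone (fun j => (hmeas j).ennreal_ofReal.aemeasurable)
      (ae_of_all _ fun ζ i j hij => ENNReal.ofReal_le_ofReal (hanti ζ hij)) ?_
      (ae_of_all _ fun ζ => (ENNReal.continuous_ofReal.tendsto _).comp (hlim ζ))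
    refine ne_top_of_le_ne_top (hint 0).2.ne (lintegral_mono fun ζ => ?_)
    rw [← ofReal_norm]
    exact ENNReal.ofReal_le_ofReal (le_abs_self _)
  have hLs : Tendsto (fun j => ∫⁻ ζ, ENNReal.ofReal (-a j ζ) ∂(gaussian E)) atTop
      (𝓝 (∫⁻ ζ, ENNReal.ofReal (u x - u (x + T ζ)) ∂(gaussian E))) := by
    refine lintegral_tendsto_of_tendsto_of_monotone
      (fun j => (hmeas j).neg.ennreal_ofReal.aemeasurable)
      (ae_of_all _ fun ζ i j hij => ENNReal.ofReal_le_ofReal (neg_le_neg (hanti ζ hij)))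
      (ae_of_all _ fun ζ => ?_)
    refine (ENNReal.continuous_ofReal.tendsto _).comp ?_
    simpa using (hlim ζ).neg
  exact le_of_tendsto_of_tendsto' hLs hR fun j =>
    lintegral_neg_part_le_of_integral_nonneg (hint j) (hnn j)

end Submean

/-! ### Mixtures of Gaussians and absolute integrability of u against polynomial kernels. -/

section Mixtures

variable {E : Type*} [NormedAddCommGroup E] [InnerProductSpace ℝ E] [FiniteDimensional ℝ E]
  [MeasurableSpace E] [BorelSpace E] {ι : Type*} [Fintype ι]

omit [FiniteDimensional ℝ E] [MeasurableSpace E] [BorelSpace E] in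
theorem IsSubsolution.smul {e : OrthonormalBasis ι ℝ E} {T : E →L[ℝ] E} {u : E → ℝ}
    (h : IsSubsolution e T u) {r : ℝ} (hr : 0 < r) : IsSubsolution e (r • T) u := by
  intro x ψ hψ hmax
  have h1 := h x ψ hψ hmax
  have h2 : ∑ i, fderiv ℝ (fderiv ℝ ψ) x ((r • T) (e i)) ((r • T) (e i)) =
      r ^ 2 * ∑ i, fderiv ℝ (fderiv ℝ ψ) x (T (e i)) (T (e i)) := by
    rw [Finset.mul_sum]
    refine Finset.sum_congr rfl fun i _ => ?_
    simp only [smul_apply, map_smul, smul_eq_mul]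
    ring
  rw [h2]
  positivity

theorem lintegral_gaussian_comp_smul {k : E → ENNReal} (hk : Measurable k) {r : ℝ} (hr : 0 < r) :
    ∫⁻ ζ, k (r • ζ) ∂(gaussian E) = ENNReal.ofReal |(r ^ Module.finrank ℝ E)⁻¹| *
      ∫⁻ z, ENNReal.ofReal (Real.exp (-(Real.pi / r ^ 2 * ‖z‖ ^ 2))) * k z := by
  have hm : Measurable fun z : E =>
      ENNReal.ofReal (Real.exp (-(Real.pi / r ^ 2 * ‖z‖ ^ 2))) * k z := by fun_prop
  rw [lintegral_gaussian (k := fun ζ => k (r • ζ)) (hk.comp (measurable_const_smul r)), ← smul_eq_mul, ← lintegral_smul_measure,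
    ← Measure.map_addHaar_smul volume hr.ne', lintegral_map hm (measurable_const_smul r)]
  refine lintegral_congr fun ζ => ?_
  congr 3
  rw [norm_smul, Real.norm_eq_abs, abs_of_pos hr]
  field_simp

/-- Being a subsolution is invariant under T ↦ rT, so rescaling T by √(π/τ) gives Gaussians of every
width. -/
theorem lintegral_exp_submean {u : E → ℝ} {e : OrthonormalBasis ι ℝ E} {T : E →L[ℝ] E}
    (husc : UpperSemicontinuous u) {C : ℝ} (hC : ∀ y, u y ≤ C * (1 + ‖y‖)) (hC0 : 0 ≤ C)
    (hsub : IsSubsolution e T u) (x : E) {τ : ℝ} (hτ : 0 < τ) :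
    ∫⁻ z, ENNReal.ofReal (Real.exp (-(τ * ‖z‖ ^ 2))) * ENNReal.ofReal (u x - u (x + T z)) ≤
      ∫⁻ z, ENNReal.ofReal (Real.exp (-(τ * ‖z‖ ^ 2))) * ENNReal.ofReal (u (x + T z) - u x) := by
  have hum : Measurable u := husc.measurable
  set r := √(Real.pi / τ) with hr
  have hr0 : 0 < r := Real.sqrt_pos.2 (by have := Real.pi_pos; positivity)
  have hτr : Real.pi / r ^ 2 = τ := by
    rw [hr, Real.sq_sqrt (by have := Real.pi_pos; positivity)]
    have := Real.pi_pos
    field_simp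
  have h1 := lintegral_gaussian_submean husc hC hC0 (hsub.smul hr0) x
  have m1 : Measurable fun z : E => ENNReal.ofReal (u x - u (x + T z)) := by fun_prop
  have m2 : Measurable fun z : E => ENNReal.ofReal (u (x + T z) - u x) := by fun_prop
  have h2 := lintegral_gaussian_comp_smul m1 hr0
  have h3 := lintegral_gaussian_comp_smul m2 hr0
  simp only [map_smul] at h2 h3
  simp only [smul_apply] at h1
  rw [h2, h3, hτr] at h1
  refine (ENNReal.mul_le_mul_iff_right ?_ ENNReal.ofReal_ne_top).1 h1
  exact (ENNReal.ofReal_pos.2 (by positivity)).ne'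

-- The Gamma integral with rate 1 + ‖z‖² exhibits this kernel as a positive mixture of Gaussians. It
-- decays like ‖z‖^{-2a} but stays bounded at the origin.
omit [InnerProductSpace ℝ E] [FiniteDimensional ℝ E] [MeasurableSpace E] [BorelSpace E] in
theorem ofReal_japanese_eq_lintegral {a : ℝ} (ha : 0 < a) (z : E) :
    ENNReal.ofReal (Real.Gamma a) * ENNReal.ofReal ((1 + ‖z‖ ^ 2) ^ (-a)) =
      ∫⁻ t in Ioi (0 : ℝ), ENNReal.ofReal (t ^ (a - 1) * Real.exp (-t)) *
        ENNReal.ofReal (Real.exp (-(t * ‖z‖ ^ 2))) := by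
  have hr : 0 < 1 + ‖z‖ ^ 2 := by positivity
  have h1 := Real.integral_rpow_mul_exp_neg_mul_Ioi ha hr
  have hpos : 0 < (1 / (1 + ‖z‖ ^ 2)) ^ a * Real.Gamma a := by
    have := Real.Gamma_pos_of_pos ha; positivity
  have hi : Integrable (fun t => t ^ (a - 1) * Real.exp (-((1 + ‖z‖ ^ 2) * t)))
      (volume.restrict (Ioi (0 : ℝ))) := by
    by_contra h
    rw [integral_undef h] at h1
    exact hpos.ne h1
  have h2 := ofReal_integral_eq_lintegral_ofReal hi
    ((ae_restrict_iff' measurableSet_Ioi).2 (ae_of_all _ fun t (ht : 0 < t) => by positivity))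
  rw [h1, one_div, Real.inv_rpow hr.le, ← Real.rpow_neg hr.le, mul_comm, ENNReal.ofReal_mul
    (Real.Gamma_pos_of_pos ha).le] at h2
  rw [h2]
  refine setLIntegral_congr_fun measurableSet_Ioi fun t ht => ?_
  have ht' : 0 < t := ht
  rw [← ENNReal.ofReal_mul (by positivity), mul_assoc, ← Real.exp_add]
  ring_nf

theorem lintegral_japanese_eq {a : ℝ} (ha : 0 < a) {k : E → ENNReal} (hk : Measurable k) :
    ENNReal.ofReal (Real.Gamma a) * ∫⁻ z, ENNReal.ofReal ((1 + ‖z‖ ^ 2) ^ (-a)) * k z =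
      ∫⁻ t in Ioi (0 : ℝ), ENNReal.ofReal (t ^ (a - 1) * Real.exp (-t)) *
        ∫⁻ z, ENNReal.ofReal (Real.exp (-(t * ‖z‖ ^ 2))) * k z := by
  have m1 : Measurable fun z : E => ENNReal.ofReal ((1 + ‖z‖ ^ 2) ^ (-a)) * k z := by fun_prop
  rw [← lintegral_const_mul _ m1]
  simp only [← mul_assoc, ofReal_japanese_eq_lintegral ha]
  have h1 : ∀ z : E, (∫⁻ t in Ioi (0 : ℝ), ENNReal.ofReal (t ^ (a - 1) * Real.exp (-t)) *
      ENNReal.ofReal (Real.exp (-(t * ‖z‖ ^ 2)))) * k z =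
      ∫⁻ t in Ioi (0 : ℝ), ENNReal.ofReal (t ^ (a - 1) * Real.exp (-t)) *
      ENNReal.ofReal (Real.exp (-(t * ‖z‖ ^ 2))) * k z := fun z =>
    (lintegral_mul_const _ (by fun_prop)).symm
  simp only [h1]
  rw [lintegral_lintegral_swap (by fun_prop)]
  refine lintegral_congr fun t => ?_
  simp only [mul_assoc]
  rw [lintegral_const_mul _ (by fun_prop)]

/-- The sub-mean value property with respect to the kernels `(1 + ‖z‖²)^(-a)`. -/
theorem lintegral_japanese_submean {u : E → ℝ} {e : OrthonormalBasis ι ℝ E} {T : E →L[ℝ] E}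
    (husc : UpperSemicontinuous u) {C : ℝ} (hC : ∀ y, u y ≤ C * (1 + ‖y‖)) (hC0 : 0 ≤ C)
    (hsub : IsSubsolution e T u) (x : E) {a : ℝ} (ha : 0 < a) :
    ∫⁻ z, ENNReal.ofReal ((1 + ‖z‖ ^ 2) ^ (-a)) * ENNReal.ofReal (u x - u (x + T z)) ≤
      ∫⁻ z, ENNReal.ofReal ((1 + ‖z‖ ^ 2) ^ (-a)) * ENNReal.ofReal (u (x + T z) - u x) := by
  have hum : Measurable u := husc.measurable
  refine (ENNReal.mul_le_mul_iff_right (ENNReal.ofReal_pos.2 (Real.Gamma_pos_of_pos ha)).ne'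
    ENNReal.ofReal_ne_top).1 ?_
  rw [lintegral_japanese_eq ha (by fun_prop), lintegral_japanese_eq ha (by fun_prop)]
  refine setLIntegral_mono' measurableSet_Ioi fun t ht => ?_
  refine mul_le_mul_right ?_ _
  exact lintegral_exp_submean husc hC hC0 hsub x ht

theorem integrable_mul_japanese {q : ℝ} (hq : Module.finrank ℝ E + 1 < q) :
    Integrable fun z : E => (1 + ‖z‖) * (1 + ‖z‖ ^ 2) ^ (-(q / 2)) := by
  have h1 := integrable_rpow_neg_one_add_norm_sq (E := E) (μ := volume) (r := q - 1) (by linarith)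
  refine (h1.const_mul 2).mono' (Measurable.aestronglyMeasurable (by fun_prop))
    (ae_of_all _ fun z => ?_)
  have h0 : 0 < 1 + ‖z‖ ^ 2 := by positivity
  rw [Real.norm_eq_abs, abs_of_nonneg (by positivity)]
  have h2 : 1 + ‖z‖ ≤ 2 * (1 + ‖z‖ ^ 2) ^ (1 / 2 : ℝ) := by
    rw [← Real.sqrt_eq_rpow]
    have h3 : 1 ≤ √(1 + ‖z‖ ^ 2) := Real.one_le_sqrt.2 (by nlinarith [sq_nonneg ‖z‖])
    have h4 : ‖z‖ ≤ √(1 + ‖z‖ ^ 2) := Real.le_sqrt_of_sq_le (by linarith)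
    linarith
  calc (1 + ‖z‖) * (1 + ‖z‖ ^ 2) ^ (-(q / 2))
      ≤ 2 * (1 + ‖z‖ ^ 2) ^ (1 / 2 : ℝ) * (1 + ‖z‖ ^ 2) ^ (-(q / 2)) := by gcongr
    _ = 2 * (1 + ‖z‖ ^ 2) ^ (-(q - 1) / 2) := by
        rw [mul_assoc, ← Real.rpow_add h0]; ring_nf

/-- Weighted integrals of `|u (x + T z) - u x|`, uniformly in `T`. -/
theorem lintegral_abs_sub_le {u : E → ℝ} {e : OrthonormalBasis ι ℝ E}
    (husc : UpperSemicontinuous u) {C : ℝ} (hC : ∀ y, u y ≤ C * (1 + ‖y‖)) (hC0 : 0 ≤ C)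
    (x : E) {q ρ : ℝ} (hq : Module.finrank ℝ E + 1 < q) (hρ : 0 ≤ ρ) {T : E →L[ℝ] E}
    (hsub : IsSubsolution e T u) (hT : ∀ z, ‖T z‖ ≤ ρ * ‖z‖) :
    ∫⁻ z, ENNReal.ofReal ((1 + ‖z‖ ^ 2) ^ (-(q / 2))) * ENNReal.ofReal |u (x + T z) - u x| ≤
      2 * ENNReal.ofReal ((C * (1 + ‖x‖ + ρ) + |u x|) *
        ∫ z : E, (1 + ‖z‖) * (1 + ‖z‖ ^ 2) ^ (-(q / 2))) := by
  have hum : Measurable u := husc.measurable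
  have hq0 : 0 < q / 2 := by
    have : (0 : ℝ) ≤ Module.finrank ℝ E := Nat.cast_nonneg _
    linarith
  have h1 := lintegral_japanese_submean husc hC hC0 hsub x hq0
  have h2 : ∀ z : E, ENNReal.ofReal |u (x + T z) - u x| =
      ENNReal.ofReal (u x - u (x + T z)) + ENNReal.ofReal (u (x + T z) - u x) := by
    intro z
    rcases le_total 0 (u (x + T z) - u x) with h | h
    · rw [abs_of_nonneg h, ENNReal.ofReal_of_nonpos (p := u x - u (x + T z)) (by linarith),
        zero_add]
    · rw [abs_of_nonpos h, ENNReal.ofReal_of_nonpos h, add_zero, neg_sub]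
  simp only [h2, mul_add (ENNReal.ofReal _)]
  rw [lintegral_add_left (by fun_prop), two_mul]
  -- The growth bound on u enters only through the positive part; the sub-mean value property `h1`
  -- transfers the estimate to the negative part.
  have h3 : ∫⁻ z, ENNReal.ofReal ((1 + ‖z‖ ^ 2) ^ (-(q / 2))) *
      ENNReal.ofReal (u (x + T z) - u x) ≤ ENNReal.ofReal ((C * (1 + ‖x‖ + ρ) + |u x|) *
        ∫ z : E, (1 + ‖z‖) * (1 + ‖z‖ ^ 2) ^ (-(q / 2))) := by
    rw [← integral_const_mul, ofReal_integral_eq_lintegral_ofReal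
      ((integrable_mul_japanese hq).const_mul _) (ae_of_all _ fun z => by positivity)]
    refine lintegral_mono fun z => ?_
    rw [← ENNReal.ofReal_mul (by positivity), ← mul_assoc, mul_comm]
    refine ENNReal.ofReal_le_ofReal (mul_le_mul_of_nonneg_right ?_ (by positivity))
    have h4 := hC (x + T z)
    have h5 : ‖x + T z‖ ≤ ‖x‖ + ρ * ‖z‖ := (norm_add_le _ _).trans (by linarith [hT z])
    have h6 := neg_abs_le (u x)
    have h7 : C * ‖x + T z‖ ≤ C * (‖x‖ + ρ * ‖z‖) := by gcongr
    have h8 : 0 ≤ ‖z‖ := norm_nonneg z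
    have h9 : 0 ≤ C * ‖x‖ * ‖z‖ := by positivity
    have h10 : 0 ≤ |u x| * ‖z‖ := by positivity
    have h11 : 0 ≤ C * ‖z‖ := by positivity
    have h12 : 0 ≤ C * ρ := by positivity
    nlinarith
  exact add_le_add (h1.trans h3) h3

end Mixtures

/-! ### Radial integrals of quadratic forms. -/

section Radial

variable {E : Type*} [NormedAddCommGroup E] [InnerProductSpace ℝ E] [FiniteDimensional ℝ E]
  [MeasurableSpace E] [BorelSpace E] {ι : Type*} [Fintype ι]

theorem integral_comp_isometry {F : Type*} [NormedAddCommGroup F] [NormedSpace ℝ F]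
    (R : E ≃ₗᵢ[ℝ] E) (k : E → F) : ∫ z, k (R z) = ∫ z, k z :=
  R.measurePreserving.integral_comp R.toHomeomorph.measurableEmbedding k

/-- Integrals of a quadratic form against a radial weight. -/
theorem integral_bilin_mul_radial (e : OrthonormalBasis ι ℝ E) (b : E →L[ℝ] E →L[ℝ] ℝ)
    {η : ℝ → ℝ} (hη : Measurable η) (hi : Integrable fun z : E => ‖z‖ ^ 2 * η ‖z‖) :
    Integrable (fun z => b z z * η ‖z‖) ∧
      Fintype.card ι * ∫ z, b z z * η ‖z‖ = (∑ i, b (e i) (e i)) * ∫ z : E, ‖z‖ ^ 2 * η ‖z‖ := by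
  have hmeas : ∀ v w : E, Measurable fun z : E => inner ℝ v z * inner ℝ w z * η ‖z‖ :=
    fun v w => by fun_prop
  have hint : ∀ i j, Integrable fun z : E => inner ℝ (e i) z * inner ℝ (e j) z * η ‖z‖ := by
    intro i j
    refine hi.norm.mono' (hmeas _ _).aestronglyMeasurable (ae_of_all _ fun z => ?_)
    rw [norm_mul, norm_mul, norm_mul, norm_pow, norm_norm, sq]
    refine mul_le_mul_of_nonneg_right ?_ (norm_nonneg _)
    refine mul_le_mul ?_ ?_ (norm_nonneg _) (norm_nonneg _)
    · simpa using norm_inner_le_norm (𝕜 := ℝ) (e i) z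
    · simpa using norm_inner_le_norm (𝕜 := ℝ) (e j) z
  have hexp : ∀ z, b z z * η ‖z‖ =
      ∑ i, ∑ j, b (e i) (e j) * (inner ℝ (e i) z * inner ℝ (e j) z * η ‖z‖) := by
    intro z
    have h1 : b z z = ∑ i, ∑ j, b (e i) (e j) * (inner ℝ (e i) z * inner ℝ (e j) z) := by
      have h2 : ∀ w, b w z = ∑ j, inner ℝ (e j) z * b w (e j) := by
        intro w
        have := congrArg (b w) (e.sum_repr' z)
        simpa only [map_sum, map_smul, smul_eq_mul] using this.symm
      have h3 : ∀ w, b z w = ∑ i, inner ℝ (e i) z * b (e i) w := by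
        intro w
        have := congrArg (fun y => b y w) (e.sum_repr' z)
        simpa only [map_sum, map_smul, smul_eq_mul, _root_.sum_apply, smul_apply] using this.symm
      rw [h3]
      refine Finset.sum_congr rfl fun i _ => ?_
      rw [h2, Finset.mul_sum]
      exact Finset.sum_congr rfl fun j _ => by ring
    rw [h1, Finset.sum_mul]
    refine Finset.sum_congr rfl fun i _ => ?_
    rw [Finset.sum_mul]
    exact Finset.sum_congr rfl fun j _ => by ring
  set m : ι → ι → ℝ := fun i j => ∫ z : E, inner ℝ (e i) z * inner ℝ (e j) z * η ‖z‖ with hm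
  -- The reflection sending e i to -e i and fixing e j changes the sign of the integrand.
  have hoff : ∀ i j, i ≠ j → m i j = 0 := by
    intro i j hij
    set R := (ℝ ∙ (e i))ᗮ.reflection with hR
    have h1 := integral_comp_isometry R fun z : E => inner ℝ (e i) z * inner ℝ (e j) z * η ‖z‖
    have h2 : ∀ w z, inner ℝ w (R z) = inner ℝ (R w) z := by
      intro w z
      rw [← R.inner_map_map (R w) z, hR, Submodule.reflection_reflection]
    have h3 : R (e i) = -e i := Submodule.reflection_orthogonalComplement_singleton_eq_neg (e i)
    have h4 : R (e j) = e j := by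
      refine Submodule.reflection_mem_subspace_eq_self ?_
      rw [Submodule.mem_orthogonal_singleton_iff_inner_right]
      exact e.orthonormal.2 hij
    simp only [h2, h3, h4, LinearIsometryEquiv.norm_map, inner_neg_left] at h1
    have h5 : ∫ z : E, -inner ℝ (e i) z * inner ℝ (e j) z * η ‖z‖ = - m i j := by
      rw [hm, ← integral_neg]; congr 1; ext z; ring
    rw [h5] at h1
    change -m i j = m i j at h1
    linarith
  -- The reflection exchanging e i and e j.
  have hdiag : ∀ i j, m i i = m j j := by
    intro i j
    set R := (ℝ ∙ (e i - e j))ᗮ.reflection with hR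
    have h1 := integral_comp_isometry R fun z : E => inner ℝ (e j) z * inner ℝ (e j) z * η ‖z‖
    have h2 : ∀ w z, inner ℝ w (R z) = inner ℝ (R w) z := by
      intro w z
      rw [← R.inner_map_map (R w) z, hR, Submodule.reflection_reflection]
    have h3 : R (e j) = e i := by
      have : R (e i) = e j := Submodule.reflection_sub (by simp)
      rw [← this, hR, Submodule.reflection_reflection]
    simp only [h2, h3, LinearIsometryEquiv.norm_map] at h1
    exact h1
  have hsum : ∑ i, m i i = ∫ z : E, ‖z‖ ^ 2 * η ‖z‖ := by
    rw [hm]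
    simp only
    rw [← integral_finsetSum _ fun i _ => hint i i]
    congr 1; ext z
    rw [← Finset.sum_mul, ← e.sum_sq_norm_inner_right z]
    congr 1
    exact Finset.sum_congr rfl fun i _ => by rw [Real.norm_eq_abs, sq_abs, sq]
  have hcard : ∀ i, Fintype.card ι * m i i = ∫ z : E, ‖z‖ ^ 2 * η ‖z‖ := by
    intro i
    rw [← hsum, Finset.sum_congr rfl fun j _ => hdiag j i]
    simp
  constructor
  · simp only [hexp]
    exact integrable_finsetSum _ fun i _ => integrable_finsetSum _ fun j _ => (hint i j).const_mul _
  · simp only [hexp]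
    rw [integral_finsetSum _ fun i _ => integrable_finsetSum _ fun j _ => (hint i j).const_mul _,
      Finset.mul_sum, Finset.sum_mul]
    refine Finset.sum_congr rfl fun i _ => ?_
    rw [integral_finsetSum _ fun j _ => (hint i j).const_mul _]
    simp only [integral_const_mul]
    rw [Finset.sum_eq_single i]
    · rw [← hcard i]; ring
    · intro j _ hj
      have := hoff i j hj.symm
      simp only [hm] at this
      rw [this, mul_zero]
    · simp

/-- The part of the fractional kernel inside the unit ball. -/
def nearKernel (p : ℝ) (r : ℝ) : ℝ := if r < 1 then r ^ (-p) else 0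

theorem measurable_nearKernel (p : ℝ) : Measurable (nearKernel p) :=
  Measurable.ite measurableSet_Iio (by fun_prop) measurable_const

theorem nearKernel_nonneg (p : ℝ) {r : ℝ} (hr : 0 ≤ r) : 0 ≤ nearKernel p r := by
  rw [nearKernel]; split_ifs <;> positivity

/-- Polar coordinates reduce the integral to dω ∫₀¹ r^{1-2s} dr, with d the dimension and ω the unit
ball volume. This is the only source of the factor 1/(1-s). -/
theorem integral_sq_mul_nearKernel [Nontrivial E] {s : ℝ} (hs : s < 1) :
    Integrable (fun z : E => ‖z‖ ^ 2 * nearKernel (Module.finrank ℝ E + 2 * s) ‖z‖) ∧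
    ∫ z : E, ‖z‖ ^ 2 * nearKernel (Module.finrank ℝ E + 2 * s) ‖z‖ =
      Module.finrank ℝ E * (volume (Metric.closedBall (0 : E) 1)).toReal / (2 * (1 - s)) := by
  set d := Module.finrank ℝ E with hd
  have hd1 : 1 ≤ d := Module.finrank_pos
  set k : ℝ → ℝ := fun r => r ^ 2 * nearKernel (d + 2 * s) r with hk
  have hfun : EqOn (fun y : ℝ => y ^ (d - 1) • k y)
      ((Ioo (0 : ℝ) 1).indicator fun y => y ^ (1 - 2 * s)) (Ioi 0) := by
    intro y hy
    have hy' : 0 < y := hy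
    simp only [hk, nearKernel, smul_eq_mul]
    by_cases h1 : y < 1
    · rw [if_pos h1, indicator_of_mem (show y ∈ Ioo (0 : ℝ) 1 from ⟨hy', h1⟩), ← mul_assoc,
        ← pow_add, ← Real.rpow_natCast, ← Real.rpow_add hy']
      congr 1
      push_cast [Nat.cast_sub hd1]
      ring
    · rw [if_neg h1, indicator_of_notMem (fun h => h1 h.2), mul_zero, mul_zero]
  have hIi : IntegrableOn (fun y : ℝ => y ^ (1 - 2 * s)) (Ioo 0 1) := by
    have := (intervalIntegral.intervalIntegrable_rpow' (a := 0) (b := 1)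
      (r := 1 - 2 * s) (by linarith)).1
    exact this.mono_set Ioo_subset_Ioc_self
  constructor
  · rw [integrable_fun_norm_addHaar volume (f := k), integrableOn_congr_fun hfun measurableSet_Ioi]
    exact ((integrable_indicator_iff measurableSet_Ioo).2 hIi).integrableOn
  · rw [integral_fun_norm_addHaar volume k, setIntegral_congr_fun measurableSet_Ioi hfun,
      setIntegral_indicator measurableSet_Ioo,
      inter_eq_self_of_subset_right Ioo_subset_Ioi_self, ← integral_Ioc_eq_integral_Ioo,
      ← intervalIntegral.integral_of_le zero_le_one, integral_rpow (Or.inl (by linarith))]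
    have h0 : 1 - 2 * s + 1 ≠ 0 := by linarith
    rw [Real.one_rpow, Real.zero_rpow h0, nsmul_eq_mul, smul_eq_mul,
      Measure.addHaar_closedBall_eq_addHaar_ball, Measure.real, ← hd]
    rw [show 2 * (1 - s) = 1 - 2 * s + 1 by ring]
    ring

/-- The quadratic part of the fractional Laplacian of a quadratic form. -/
theorem integral_bilin_mul_nearKernel [Nontrivial E] (e : OrthonormalBasis ι ℝ E)
    (b : E →L[ℝ] E →L[ℝ] ℝ) {s : ℝ} (hs : s < 1) :
    Integrable (fun z => b z z * nearKernel (Module.finrank ℝ E + 2 * s) ‖z‖) ∧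
    ∫ z, b z z * nearKernel (Module.finrank ℝ E + 2 * s) ‖z‖ =
      (volume (Metric.closedBall (0 : E) 1)).toReal / (2 * (1 - s)) * ∑ i, b (e i) (e i) := by
  obtain ⟨h1, h2⟩ := integral_sq_mul_nearKernel (E := E) hs
  obtain ⟨h3, h4⟩ := integral_bilin_mul_radial e b (measurable_nearKernel _) h1
  refine ⟨h3, ?_⟩
  have hd : 0 < (Module.finrank ℝ E : ℝ) := by exact_mod_cast Module.finrank_pos
  rw [h2, ← Module.finrank_eq_card_basis e.toBasis] at h4
  refine mul_left_cancel₀ hd.ne' (h4.trans ?_)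
  ring

end Radial

/-! ### Second-order expansion of second differences. -/

section Taylor

variable {E : Type*} [NormedAddCommGroup E] [NormedSpace ℝ E]

/-- Mean value inequality on the ball of radius ‖y‖. The derivative of the error is Dv(x+z) -
Dv(x-z) - 2Az, using symmetry of the Hessian A, and it is at most ε‖y‖ because Dv is differentiable
at x. -/
theorem secondDiff_taylor {v : E → ℝ} {x : E} (hv : ContDiffAt ℝ 2 v x) {ε : ℝ} (hε : 0 < ε) :
    ∃ ρ > 0, ∀ y, ‖y‖ < ρ →
      |v (x + y) + v (x - y) - 2 * v x - fderiv ℝ (fderiv ℝ v) x y y| ≤ ε * ‖y‖ ^ 2 := by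
  set A := fderiv ℝ (fderiv ℝ v) x with hA
  have hsymm : ∀ a b, A a b = A b a := fun a b =>
    (hv.isSymmSndFDerivAt (by simp)).eq a b
  have hv1 : ContDiffAt ℝ 1 (fderiv ℝ v) x := hv.fderiv_right (by norm_num)
  have hA' : HasFDerivAt (fderiv ℝ v) A x := (hv1.differentiableAt (by norm_num)).hasFDerivAt
  obtain ⟨r₁, hr₁, h1⟩ : ∃ r > 0, ∀ y, ‖y‖ < r → DifferentiableAt ℝ v (x + y) := by
    have h2 : ∀ᶠ z in 𝓝 x, DifferentiableAt ℝ v z :=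
      (hv.eventually (by simp)).mono fun z hz => hz.differentiableAt (by norm_num)
    obtain ⟨r, hr, h3⟩ := Metric.eventually_nhds_iff.1 h2
    exact ⟨r, hr, fun y hy => h3 (by simpa [dist_eq_norm] using hy)⟩
  obtain ⟨r₂, hr₂, h2⟩ : ∃ r > 0, ∀ y, ‖y‖ < r →
      ‖fderiv ℝ v (x + y) - fderiv ℝ v x - A y‖ ≤ ε / 2 * ‖y‖ := by
    have h2 := (hasFDerivAt_iff_isLittleO_nhds_zero.1 hA').def (half_pos hε)
    obtain ⟨r, hr, h3⟩ := Metric.eventually_nhds_iff.1 h2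
    exact ⟨r, hr, fun y hy => h3 (by simpa [dist_eq_norm] using hy)⟩
  refine ⟨min r₁ r₂, lt_min hr₁ hr₂, fun y hy => ?_⟩
  have hder : ∀ z ∈ Metric.ball (0 : E) (min r₁ r₂),
      HasFDerivAt (fun y => v (x + y) + v (x - y) - 2 * v x - A y y)
        (fderiv ℝ v (x + z) - fderiv ℝ v (x - z) - (2 : ℝ) • A z) z := by
    intro z hz
    have hz' : ‖z‖ < min r₁ r₂ := by simpa using hz
    have g1 := (h1 z (hz'.trans_le (min_le_left _ _))).hasFDerivAt.comp z
      ((hasFDerivAt_id z).const_add x)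
    have g2' : DifferentiableAt ℝ v (x - z) := by
      have := h1 (-z) (by rw [norm_neg]; exact hz'.trans_le (min_le_left _ _))
      rwa [← sub_eq_add_neg] at this
    have g2 := g2'.hasFDerivAt.comp z ((hasFDerivAt_id z).const_sub x)
    have g3 := (A.hasFDerivAt (x := z)).clm_apply (hasFDerivAt_id z)
    refine (((g1.add g2).sub_const (2 * v x)).sub g3).congr_fderiv ?_
    ext w
    simp [hsymm w z]
    ring
  have hbound : ∀ z ∈ Metric.closedBall (0 : E) ‖y‖,
      ‖fderiv ℝ v (x + z) - fderiv ℝ v (x - z) - (2 : ℝ) • A z‖ ≤ ε * ‖y‖ := by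
    intro z hz
    have hz' : ‖z‖ ≤ ‖y‖ := by simpa using hz
    have hz2 : ‖z‖ < r₂ := hz'.trans_lt (hy.trans_le (min_le_right _ _))
    have g1 := h2 z hz2
    have g2 := h2 (-z) (by rwa [norm_neg])
    rw [norm_neg, map_neg, ← sub_eq_add_neg] at g2
    have g3 : fderiv ℝ v (x + z) - fderiv ℝ v (x - z) - (2 : ℝ) • A z =
        (fderiv ℝ v (x + z) - fderiv ℝ v x - A z) -
          (fderiv ℝ v (x - z) - fderiv ℝ v x - -A z) := by
      rw [two_smul]; abel
    rw [g3]
    refine (norm_sub_le _ _).trans ?_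
    nlinarith
  have hsub : Metric.closedBall (0 : E) ‖y‖ ⊆ Metric.ball 0 (min r₁ r₂) :=
    Metric.closedBall_subset_ball hy
  have key := (convex_closedBall (0 : E) ‖y‖).norm_image_sub_le_of_norm_hasFDerivWithin_le
    (fun z hz => (hder z (hsub hz)).hasFDerivWithinAt) hbound
    (Metric.mem_closedBall_self (norm_nonneg y)) (show y ∈ _ by simp)
  simp only [map_zero, add_zero, sub_zero] at key
  rw [show v x + v x - 2 * v x = 0 by ring, sub_zero, Real.norm_eq_abs] at key
  refine key.trans (le_of_eq (by ring))

end Taylor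

/-! ### Asymptotics of the fractional integrals, uniform in T. -/

section Levy

variable {E : Type*} [NormedAddCommGroup E] [InnerProductSpace ℝ E] [FiniteDimensional ℝ E]
  [MeasurableSpace E] [BorelSpace E] {ι : Type*} [Fintype ι]

/-- The fractional kernel paired with the second difference of `v` at `x` along `T`. -/
def levyIntegrand (v : E → ℝ) (x : E) (T : E →L[ℝ] E) (s : ℝ) (z : E) : ℝ :=
  (v (x + T z) + v (x - T z) - 2 * v x) * ‖z‖ ^ (-((Module.finrank ℝ E : ℝ) + 2 * s))

/-- Replacing u by v costs a bounded amount against an integrable weight, and z ↦ -z exchanges the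
two shifts. The point is that C' is chosen before T. -/
theorem exists_tail_bound {u v : E → ℝ} (e : OrthonormalBasis ι ℝ E)
    (husc : UpperSemicontinuous u) {C : ℝ} (hC : ∀ y, u y ≤ C * (1 + ‖y‖)) (hC0 : 0 ≤ C)
    {x : E} (hvm : Measurable v) (hvx : v x = u x) {C₀ : ℝ} (hC₀ : 0 ≤ C₀)
    (hvu : ∀ y, |v y - u x| ≤ |u y - u x| + C₀) {q ρ : ℝ} (hq : Module.finrank ℝ E + 1 < q)
    (hρ : 0 ≤ ρ) : ∃ C' : ℝ, 0 ≤ C' ∧ ∀ T : E →L[ℝ] E, IsSubsolution e T u →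
      (∀ z, ‖T z‖ ≤ ρ * ‖z‖) →
      Integrable (fun z => (1 + ‖z‖ ^ 2) ^ (-(q / 2)) *
        |v (x + T z) + v (x - T z) - 2 * v x|) ∧
      ∫ z, (1 + ‖z‖ ^ 2) ^ (-(q / 2)) * |v (x + T z) + v (x - T z) - 2 * v x| ≤ C' := by
  set J : ℝ := ∫ z : E, (1 + ‖z‖) * (1 + ‖z‖ ^ 2) ^ (-(q / 2)) with hJ
  have hJ0 : 0 ≤ J := integral_nonneg fun z => by positivity
  set D : ℝ := (C * (1 + ‖x‖ + ρ) + |u x|) * J with hD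
  have hD0 : 0 ≤ D := by positivity
  refine ⟨2 * (2 * D + C₀ * J), by positivity, fun T hsub hT => ?_⟩
  have hum : Measurable u := husc.measurable
  set g : E → ℝ := fun z => (1 + ‖z‖ ^ 2) ^ (-(q / 2)) * |v (x + T z) - v x| with hg
  have hgm : Measurable g := by fun_prop
  have hg0 : ∀ z, 0 ≤ g z := fun z => by positivity
  have hlint : ∫⁻ z, ENNReal.ofReal (g z) ≤ ENNReal.ofReal (2 * D + C₀ * J) := by
    have h1 := lintegral_abs_sub_le husc hC hC0 x hq hρ hsub hT
    rw [← hJ, ← hD] at h1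
    have h2 : ∫⁻ z : E, ENNReal.ofReal (C₀ * ((1 + ‖z‖) * (1 + ‖z‖ ^ 2) ^ (-(q / 2)))) =
        ENNReal.ofReal (C₀ * J) := by
      rw [hJ, ← integral_const_mul, ofReal_integral_eq_lintegral_ofReal
        ((integrable_mul_japanese hq).const_mul _) (ae_of_all _ fun z => by positivity)]
    rw [ENNReal.ofReal_add (by positivity) (by positivity), ENNReal.ofReal_mul zero_le_two,
      ← h2, ENNReal.ofReal_ofNat]
    refine le_trans ?_ (add_le_add_left h1 _)
    rw [← lintegral_add_left (by fun_prop)]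
    refine lintegral_mono fun z => ?_
    rw [← ENNReal.ofReal_mul (by positivity), ← ENNReal.ofReal_add (by positivity) (by positivity)]
    refine ENNReal.ofReal_le_ofReal ?_
    have h3 : g z ≤ (1 + ‖z‖ ^ 2) ^ (-(q / 2)) * (|u (x + T z) - u x| + C₀) := by
      simp only [hg, hvx]
      exact mul_le_mul_of_nonneg_left (hvu _) (by positivity)
    have h4 : 0 ≤ C₀ * (‖z‖ * (1 + ‖z‖ ^ 2) ^ (-(q / 2))) := by positivity
    nlinarith
  have hgi : Integrable g := by
    refine ⟨hgm.aestronglyMeasurable, ?_⟩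
    rw [hasFiniteIntegral_iff_ofReal (ae_of_all _ hg0)]
    exact hlint.trans_lt ENNReal.ofReal_lt_top
  have hgint : ∫ z, g z ≤ 2 * D + C₀ * J := by
    rw [integral_eq_lintegral_of_nonneg_ae (ae_of_all _ hg0) hgm.aestronglyMeasurable]
    exact ENNReal.toReal_le_of_le_ofReal (by positivity) hlint
  have hle : ∀ z, (1 + ‖z‖ ^ 2) ^ (-(q / 2)) * |v (x + T z) + v (x - T z) - 2 * v x| ≤
      g z + g (-z) := by
    intro z
    simp only [hg, norm_neg, map_neg, ← sub_eq_add_neg]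
    rw [← mul_add]
    refine mul_le_mul_of_nonneg_left ?_ (by positivity)
    refine le_trans (le_of_eq ?_) (abs_add_le _ _)
    ring_nf
  have hi2 : Integrable fun z => g z + g (-z) := hgi.add hgi.comp_neg
  have hi : Integrable (fun z => (1 + ‖z‖ ^ 2) ^ (-(q / 2)) *
        |v (x + T z) + v (x - T z) - 2 * v x|) :=
    hi2.mono' (Measurable.aestronglyMeasurable (by fun_prop)) (ae_of_all _ fun z => by
      rw [Real.norm_eq_abs, abs_of_nonneg (by positivity)]; exact hle z)
  refine ⟨hi, (integral_mono hi hi2 hle).trans ?_⟩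
  rw [integral_add hgi hgi.comp_neg, integral_neg_eq_self g]
  linarith

/-- The part of the fractional kernel outside the unit ball. -/
def farKernel (p : ℝ) (r : ℝ) : ℝ := if r < 1 then 0 else r ^ (-p)

theorem measurable_farKernel (p : ℝ) : Measurable (farKernel p) :=
  Measurable.ite measurableSet_Iio measurable_const (by fun_prop)

theorem nearKernel_add_farKernel (p r : ℝ) : nearKernel p r + farKernel p r = r ^ (-p) := by
  rw [nearKernel, farKernel]; split_ifs <;> simp

/-- For r ≥ 1 a larger exponent only helps and r² ≥ (1+r²)/2. Thus a single weight with exponent q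
dominates all kernels with p ≥ q. -/
theorem farKernel_le {p q r : ℝ} (hq : 0 ≤ q) (hqp : q ≤ p) :
    |farKernel p r| ≤ 2 ^ (q / 2) * (1 + r ^ 2) ^ (-(q / 2)) := by
  rw [farKernel]
  split_ifs with h
  · rw [abs_zero]; positivity
  · have h1 : 1 ≤ r := not_lt.1 h
    rw [abs_of_nonneg (by positivity)]
    calc r ^ (-p) ≤ r ^ (-q) := Real.rpow_le_rpow_of_exponent_le h1 (by linarith)
      _ = (r ^ 2) ^ (-(q / 2)) := by
        rw [← Real.rpow_natCast, ← Real.rpow_mul (by linarith)]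
        congr 1; push_cast; ring
      _ ≤ ((1 + r ^ 2) / 2) ^ (-(q / 2)) :=
        Real.rpow_le_rpow_of_nonpos (by positivity) (by nlinarith) (by linarith)
      _ = 2 ^ (q / 2) * (1 + r ^ 2) ^ (-(q / 2)) := by
        rw [Real.div_rpow (by positivity) (by positivity), Real.rpow_neg zero_le_two,
          div_inv_eq_mul, mul_comm]

/-- Asymptotics as `s → 1` of the fractional integrals, uniformly in `T`. -/
theorem exists_levy_estimate [Nontrivial E] {u v : E → ℝ} (e : OrthonormalBasis ι ℝ E)
    (husc : UpperSemicontinuous u) {C : ℝ} (hC : ∀ y, u y ≤ C * (1 + ‖y‖)) (hC0 : 0 ≤ C)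
    {x : E} (hvm : Measurable v) (hvx : v x = u x) {C₀ : ℝ} (hC₀ : 0 ≤ C₀)
    (hvu : ∀ y, |v y - u x| ≤ |u y - u x| + C₀) (hvd : ContDiffAt ℝ 2 v x) {ε : ℝ}
    (hε : 0 < ε) : ∃ ρ : ℝ, 0 < ρ ∧ ∃ C' : ℝ, 0 ≤ C' ∧ ∀ T : E →L[ℝ] E, IsSubsolution e T u →
      (∀ z, ‖T z‖ ≤ ρ * ‖z‖) →
      (∀ s ∈ Ioo (1 / 2 : ℝ) 1, Integrable (levyIntegrand v x T s)) ∧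
      ∀ s ∈ Ioo (3 / 4 : ℝ) 1, |(∫ z, levyIntegrand v x T s z) -
          (volume (Metric.closedBall (0 : E) 1)).toReal / (2 * (1 - s)) *
            ∑ i, fderiv ℝ (fderiv ℝ v) x (T (e i)) (T (e i))| ≤
        (volume (Metric.closedBall (0 : E) 1)).toReal / (2 * (1 - s)) *
          (ε * ∑ i, ‖T (e i)‖ ^ 2) + C' := by
  obtain ⟨ρ', hρ', htay⟩ := secondDiff_taylor hvd hε
  set d : ℝ := (Module.finrank ℝ E : ℝ) with hd
  have hd0 : 0 ≤ d := Nat.cast_nonneg _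
  -- Ensures ‖T z‖ < ρ' throughout the unit ball, where the Taylor bound is used.
  set ρ := ρ' / 2 with hρ
  have hρ0 : 0 < ρ := by positivity
  -- For s > 3/4 the kernel exponent d + 2s exceeds d + 3/2, which is above the threshold d + 1, so
  -- one constant bounds the tail for all such s.
  obtain ⟨C', hC'0, hC'⟩ := exists_tail_bound e husc hC hC0 hvm hvx hC₀ hvu (q := d + 3 / 2)
    (by linarith) hρ0.le
  refine ⟨ρ, hρ0, 2 ^ ((d + 3 / 2) / 2) * C', by positivity, fun T hsub hT => ?_⟩
  set δ : E → ℝ := fun z => v (x + T z) + v (x - T z) - 2 * v x with hδ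
  have hδm : Measurable δ := by fun_prop
  set A := fderiv ℝ (fderiv ℝ v) x with hA
  set b : E →L[ℝ] E →L[ℝ] ℝ := A.bilinearComp T T with hb
  set g : E →L[ℝ] E →L[ℝ] ℝ := (innerSL ℝ).bilinearComp T T with hg
  have hbz : ∀ z, b z z = A (T z) (T z) := fun z => rfl
  have hgz : ∀ z, g z z = ‖T z‖ ^ 2 := fun z => real_inner_self_eq_norm_sq _
  have hbm : Measurable fun z => b z z :=
    (b.continuous.clm_apply continuous_id).measurable
  have hdecomp : ∀ s z, levyIntegrand v x T s z =
      δ z * nearKernel (d + 2 * s) ‖z‖ + δ z * farKernel (d + 2 * s) ‖z‖ := by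
    intro s z
    rw [← mul_add, nearKernel_add_farKernel, levyIntegrand]
  have hnear : ∀ s z, |δ z * nearKernel (d + 2 * s) ‖z‖ - b z z * nearKernel (d + 2 * s) ‖z‖| ≤
      ε * (g z z * nearKernel (d + 2 * s) ‖z‖) := by
    intro s z
    rw [← sub_mul, abs_mul, abs_of_nonneg (nearKernel_nonneg _ (norm_nonneg z)), ← mul_assoc]
    by_cases hz : ‖z‖ < 1
    · refine mul_le_mul_of_nonneg_right ?_ (nearKernel_nonneg _ (norm_nonneg z))
      rw [hgz]
      refine htay (T z) ((hT z).trans_lt ?_)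
      nlinarith [norm_nonneg z]
    · rw [nearKernel, if_neg hz, mul_zero, mul_zero]
  have hnm : ∀ s, Measurable fun z : E => nearKernel (d + 2 * s) ‖z‖ := fun s =>
    (measurable_nearKernel _).comp measurable_norm
  have hfm : ∀ s, Measurable fun z : E => farKernel (d + 2 * s) ‖z‖ := fun s =>
    (measurable_farKernel _).comp measurable_norm
  have hnearI : ∀ s < 1, Integrable fun z => δ z * nearKernel (d + 2 * s) ‖z‖ -
      b z z * nearKernel (d + 2 * s) ‖z‖ := by
    intro s hs
    exact ((integral_bilin_mul_nearKernel e g hs).1.const_mul ε).mono'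
      ((hδm.mul (hnm s)).sub (hbm.mul (hnm s))).aestronglyMeasurable (ae_of_all _ fun z => hnear s z)
  have hnearI' : ∀ s < 1, Integrable fun z => δ z * nearKernel (d + 2 * s) ‖z‖ := by
    intro s hs
    refine ((hnearI s hs).add (integral_bilin_mul_nearKernel e b hs).1).congr
      (ae_of_all _ fun z => ?_)
    exact sub_add_cancel _ _
  have hfar : ∀ {q s : ℝ}, 0 ≤ q → q ≤ d + 2 * s → ∀ z,
      |δ z * farKernel (d + 2 * s) ‖z‖| ≤
        2 ^ (q / 2) * ((1 + ‖z‖ ^ 2) ^ (-(q / 2)) * |δ z|) := by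
    intro q s hq hqs z
    rw [abs_mul]
    have := mul_le_mul_of_nonneg_left (farKernel_le (r := ‖z‖) hq hqs) (abs_nonneg (δ z))
    linarith
  have hfarI : ∀ s ∈ Ioo (1 / 2 : ℝ) 1, Integrable fun z => δ z * farKernel (d + 2 * s) ‖z‖ := by
    intro s hs
    obtain ⟨C₁, _, hC₁⟩ := exists_tail_bound e husc hC hC0 hvm hvx hC₀ hvu (q := d + 2 * s)
      (by linarith [hs.1]) hρ0.le
    exact ((hC₁ T hsub hT).1.const_mul _).mono' (hδm.mul (hfm s)).aestronglyMeasurable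
      (ae_of_all _ fun z => hfar (by linarith [hs.1]) le_rfl z)
  refine ⟨fun s hs => ?_, fun s hs => ?_⟩
  · exact ((hnearI' s hs.2).add (hfarI s hs)).congr (ae_of_all _ fun z => (hdecomp s z).symm)
  · have hs' : s ∈ Ioo (1 / 2 : ℝ) 1 := ⟨by linarith [hs.1], hs.2⟩
    obtain ⟨b1, b2⟩ := integral_bilin_mul_nearKernel e b hs.2
    obtain ⟨g1, g2⟩ := integral_bilin_mul_nearKernel e g hs.2
    have e1 : ∫ z, levyIntegrand v x T s z =
        (∫ z, δ z * nearKernel (d + 2 * s) ‖z‖) + ∫ z, δ z * farKernel (d + 2 * s) ‖z‖ := by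
      rw [← integral_add (hnearI' s hs.2) (hfarI s hs')]
      simp only [hdecomp]
    have e2 : |(∫ z, δ z * nearKernel (d + 2 * s) ‖z‖) -
        ∫ z, b z z * nearKernel (d + 2 * s) ‖z‖| ≤
        ε * ∫ z, g z z * nearKernel (d + 2 * s) ‖z‖ := by
      rw [← integral_sub (hnearI' s hs.2) b1, ← integral_const_mul, ← Real.norm_eq_abs]
      exact norm_integral_le_of_norm_le (g1.const_mul ε) (ae_of_all _ fun z => hnear s z)
    have e3 : |∫ z, δ z * farKernel (d + 2 * s) ‖z‖| ≤ 2 ^ ((d + 3 / 2) / 2) * C' := by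
      rw [← Real.norm_eq_abs]
      refine (norm_integral_le_of_norm_le ((hC' T hsub hT).1.const_mul _)
        (ae_of_all _ fun z => hfar (by linarith) (by linarith [hs.1]) z)).trans ?_
      rw [integral_const_mul]
      exact mul_le_mul_of_nonneg_left (hC' T hsub hT).2 (by positivity)
    rw [b2, g2] at e2
    simp only [hbz, hgz] at e2
    rw [e1]
    rw [abs_le] at e2 e3 ⊢
    constructor <;> nlinarith [e2.1, e2.2, e3.1, e3.2]

end Levy

/-! ### Homogeneity of the fractional integrals in T. -/

section Scaling

variable {E : Type*} [NormedAddCommGroup E] [InnerProductSpace ℝ E] [FiniteDimensional ℝ E]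
  [MeasurableSpace E] [BorelSpace E]

omit [FiniteDimensional ℝ E] [MeasurableSpace E] [BorelSpace E] in
theorem levyIntegrand_smul (v : E → ℝ) (x : E) (T : E →L[ℝ] E) (s : ℝ) {r : ℝ} (hr : 0 < r)
    (z : E) : levyIntegrand v x (r • T) s z =
      r ^ ((Module.finrank ℝ E : ℝ) + 2 * s) * levyIntegrand v x T s (r • z) := by
  rw [levyIntegrand, levyIntegrand, smul_apply, map_smul, norm_smul,
    Real.norm_eq_abs, abs_of_pos hr, Real.mul_rpow hr.le (norm_nonneg z)]
  rw [mul_left_comm, ← mul_assoc (r ^ _), ← Real.rpow_add hr, add_neg_cancel, Real.rpow_zero,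
    one_mul]

/-- The kernel contributes r^{n+2s}, with n the dimension, and the change of variables r^{-n}. This
reduces arbitrarily large T to T of bounded norm. -/
theorem integral_levyIntegrand_smul (v : E → ℝ) (x : E) (T : E →L[ℝ] E) (s : ℝ) {r : ℝ}
    (hr : 0 < r) : ∫ z, levyIntegrand v x (r • T) s z =
      r ^ (2 * s) * ∫ z, levyIntegrand v x T s z := by
  simp only [levyIntegrand_smul v x T s hr]
  rw [integral_const_mul, Measure.integral_comp_smul_of_nonneg volume _ r (hR := hr.le),
    smul_eq_mul, ← mul_assoc, Real.rpow_add hr, Real.rpow_natCast]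
  field_simp

theorem integrable_levyIntegrand_smul (v : E → ℝ) (x : E) (T : E →L[ℝ] E) (s : ℝ) {r : ℝ}
    (hr : 0 < r) (h : Integrable (levyIntegrand v x (r • T) s)) :
    Integrable (levyIntegrand v x T s) := by
  have h1 : levyIntegrand v x (r • T) s = fun z =>
      r ^ ((Module.finrank ℝ E : ℝ) + 2 * s) * levyIntegrand v x T s (r • z) :=
    funext fun z => levyIntegrand_smul v x T s hr z
  have h2 : r ^ ((Module.finrank ℝ E : ℝ) + 2 * s) ≠ 0 := (Real.rpow_pos_of_pos hr _).ne'
  rw [h1, integrable_const_mul_iff h2.isUnit] at h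
  exact (integrable_comp_smul_iff volume _ hr.ne').1 h

end Scaling

/-! ### The substitution y = √M z. -/

section SquareRoot

variable {n : ℕ} {Γ : Set (Fin n → ℝ)} {f : (Fin n → ℝ) → ℝ}

/-- The linear map of the positive square root of `M`. -/
def sqrtMap (M : Matrix (Fin n) (Fin n) ℝ) :
    EuclideanSpace ℝ (Fin n) →L[ℝ] EuclideanSpace ℝ (Fin n) :=
  (Matrix.toEuclideanLin (CFC.sqrt M)).toContinuousLinearMap

theorem sqrtMap_apply (M : Matrix (Fin n) (Fin n) ℝ) (z : EuclideanSpace ℝ (Fin n)) :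
    sqrtMap M z = Matrix.toEuclideanLin (CFC.sqrt M) z := rfl

theorem sqrtMap_single (M : Matrix (Fin n) (Fin n) ℝ) (i : Fin n) :
    sqrtMap M (EuclideanSpace.basisFun (Fin n) ℝ i) =
      ∑ k, CFC.sqrt M k i • EuclideanSpace.single k (1 : ℝ) := by
  ext j
  simp [sqrtMap_apply, Matrix.toLpLin_apply, Finset.sum_apply, Pi.single_apply]

theorem sqrt_isSymm (M : Matrix (Fin n) (Fin n) ℝ) : (CFC.sqrt M).IsSymm := by
  have h := (Matrix.nonneg_iff_posSemidef.1 (CFC.sqrt_nonneg M)).1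
  rwa [Matrix.IsHermitian, Matrix.conjTranspose_eq_transpose_of_trivial] at h

theorem bilin_sum_smul {E ι : Type*} [NormedAddCommGroup E] [NormedSpace ℝ E] [Fintype ι]
    (b : E →L[ℝ] E →L[ℝ] ℝ) (c : ι → ℝ) (w : ι → E) :
    b (∑ k, c k • w k) (∑ l, c l • w l) = ∑ k, ∑ l, c k * c l * b (w k) (w l) := by
  rw [map_sum b, _root_.sum_apply]
  refine Finset.sum_congr rfl fun k _ => ?_
  rw [map_sum]
  refine Finset.sum_congr rfl fun l _ => ?_
  rw [map_smul, map_smul, smul_apply, smul_eq_mul, smul_eq_mul]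
  ring

/-- Because √M is symmetric with square M, summing the form over the columns of √M contracts it with
M. -/
theorem sum_bilin_sqrtMap {M : Matrix (Fin n) (Fin n) ℝ} (hM : M.PosDef)
    (b : EuclideanSpace ℝ (Fin n) →L[ℝ] EuclideanSpace ℝ (Fin n) →L[ℝ] ℝ) :
    ∑ i, b (sqrtMap M (EuclideanSpace.basisFun (Fin n) ℝ i))
      (sqrtMap M (EuclideanSpace.basisFun (Fin n) ℝ i)) =
    (M * Matrix.of fun i j => b (EuclideanSpace.single i 1) (EuclideanSpace.single j 1)).trace := by
  have hMs : M.IsSymm := by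
    have h := hM.1
    rwa [Matrix.IsHermitian, Matrix.conjTranspose_eq_transpose_of_trivial] at h
  have hsq : CFC.sqrt M * CFC.sqrt M = M :=
    CFC.sqrt_mul_sqrt_self M (Matrix.nonneg_iff_posSemidef.2 hM.posSemidef)
  rw [trace_mul_eq_sum _ _ hMs]
  have h1 : ∀ k l, M k l = ∑ i, CFC.sqrt M k i * CFC.sqrt M l i := by
    intro k l
    conv_lhs => rw [← hsq]
    rw [Matrix.mul_apply]
    exact Finset.sum_congr rfl fun i _ => by rw [(sqrt_isSymm M).apply l i]
  have h2 : ∀ i, b (sqrtMap M (EuclideanSpace.basisFun (Fin n) ℝ i))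
      (sqrtMap M (EuclideanSpace.basisFun (Fin n) ℝ i)) =
      ∑ k, ∑ l, CFC.sqrt M k i * CFC.sqrt M l i *
        b (EuclideanSpace.single k 1) (EuclideanSpace.single l 1) := by
    intro i
    rw [sqrtMap_single]
    exact bilin_sum_smul b (fun k => CFC.sqrt M k i) _
  simp only [h2]
  rw [Finset.sum_comm]
  refine Finset.sum_congr rfl fun k _ => ?_
  rw [Finset.sum_comm]
  refine Finset.sum_congr rfl fun l _ => ?_
  rw [h1, Finset.sum_mul, Matrix.of_apply]

theorem sum_norm_sq_sqrtMap {M : Matrix (Fin n) (Fin n) ℝ} (hM : M.PosDef) :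
    ∑ i, ‖sqrtMap M (EuclideanSpace.basisFun (Fin n) ℝ i)‖ ^ 2 = M.trace := by
  have h : ∑ i, inner ℝ (sqrtMap M (EuclideanSpace.basisFun (Fin n) ℝ i))
      (sqrtMap M (EuclideanSpace.basisFun (Fin n) ℝ i)) =
      (M * Matrix.of fun i j : Fin n => inner ℝ (EuclideanSpace.single i (1 : ℝ))
        (EuclideanSpace.single j (1 : ℝ))).trace := sum_bilin_sqrtMap hM (innerSL ℝ)
  simp only [real_inner_self_eq_norm_sq] at h
  rw [h]
  have h1 : (Matrix.of fun i j : Fin n => inner ℝ (EuclideanSpace.single i (1 : ℝ))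
      (EuclideanSpace.single j (1 : ℝ))) = 1 := by
    ext i j
    rw [Matrix.of_apply, Matrix.one_apply]
    exact orthonormal_iff_ite.1 EuclideanSpace.orthonormal_single i j
  rw [h1, mul_one]

/-- Cauchy–Schwarz: √(tr M) is the Frobenius norm of √M. -/
theorem norm_sqrtMap_le {M : Matrix (Fin n) (Fin n) ℝ} (hM : M.PosDef)
    (z : EuclideanSpace ℝ (Fin n)) : ‖sqrtMap M z‖ ≤ √M.trace * ‖z‖ := by
  set e := EuclideanSpace.basisFun (Fin n) ℝ with he
  conv_lhs => rw [← e.sum_repr' z]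
  rw [map_sum]
  refine (norm_sum_le _ _).trans ?_
  simp only [map_smul, norm_smul]
  refine (Real.sum_mul_le_sqrt_mul_sqrt _ _ _).trans ?_
  rw [sum_norm_sq_sqrtMap hM, e.sum_sq_norm_inner_right, Real.sqrt_sq (norm_nonneg z), mul_comm]

theorem det_sqrt_pos {M : Matrix (Fin n) (Fin n) ℝ} (hM : M.PosDef) : 0 < (CFC.sqrt M).det := by
  have h0 : 0 ≤ (CFC.sqrt M).det :=
    (Matrix.nonneg_iff_posSemidef.1 (CFC.sqrt_nonneg M)).det_nonneg
  have hsq : CFC.sqrt M * CFC.sqrt M = M :=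
    CFC.sqrt_mul_sqrt_self M (Matrix.nonneg_iff_posSemidef.2 hM.posSemidef)
  have h1 := hM.det_pos
  rw [← hsq, Matrix.det_mul] at h1
  exact h0.lt_of_ne fun h => by rw [← h, zero_mul] at h1; exact h1.false

theorem det_mul_integrand_sqrtMap {M : Matrix (Fin n) (Fin n) ℝ} (hM : M.PosDef) (s : ℝ)
    (v : EuclideanSpace ℝ (Fin n) → ℝ) (x z : EuclideanSpace ℝ (Fin n)) :
    (CFC.sqrt M).det * integrand M s v x (sqrtMap M z) = levyIntegrand v x (sqrtMap M) s z := by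
  have hu : IsUnit (CFC.sqrt M).det := (det_sqrt_pos hM).ne'.isUnit
  have h1 : Matrix.toEuclideanLin (CFC.sqrt M)⁻¹ (sqrtMap M z) = z := by
    rw [sqrtMap_apply, Matrix.toLpLin_apply, Matrix.toLpLin_apply]
    simp [Matrix.mulVec_mulVec, Matrix.nonsing_inv_mul _ hu]
  rw [integrand, h1, levyIntegrand, secondDiff, Matrix.det_nonsing_inv, Ring.inverse_eq_inv',
    Real.rpow_neg (norm_nonneg z), finrank_euclideanSpace, Fintype.card_fin]
  have := (det_sqrt_pos hM).ne'
  field_simp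

theorem map_sqrtMap_volume {M : Matrix (Fin n) (Fin n) ℝ} (hM : M.PosDef) :
    Measure.map (sqrtMap M) volume = ENNReal.ofReal ((CFC.sqrt M).det)⁻¹ • volume := by
  have hdet : LinearMap.det (Matrix.toEuclideanLin (CFC.sqrt M)) = (CFC.sqrt M).det :=
    LinearMap.det_toLpLin 2 _
  have hpos := det_sqrt_pos hM
  have := Measure.map_linearMap_addHaar_eq_smul_addHaar
    (volume : Measure (EuclideanSpace ℝ (Fin n))) (f := Matrix.toEuclideanLin (CFC.sqrt M))
    (by rw [hdet]; exact hpos.ne')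
  rw [hdet, abs_of_pos (inv_pos.2 hpos)] at this
  exact this

theorem sqrtMap_measurableEmbedding {M : Matrix (Fin n) (Fin n) ℝ} (hM : M.PosDef) :
    MeasurableEmbedding (sqrtMap M) := by
  refine (sqrtMap M).continuous.measurableEmbedding fun z w hzw => ?_
  have hu : IsUnit (CFC.sqrt M).det := (det_sqrt_pos hM).ne'.isUnit
  have h1 : ∀ z, Matrix.toEuclideanLin (CFC.sqrt M)⁻¹ (sqrtMap M z) = z := fun z => by
    rw [sqrtMap_apply, Matrix.toLpLin_apply, Matrix.toLpLin_apply]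
    simp [Matrix.mulVec_mulVec, Matrix.nonsing_inv_mul _ hu]
  rw [← h1 z, hzw, h1]

theorem integral_integrand {M : Matrix (Fin n) (Fin n) ℝ} (hM : M.PosDef) (s : ℝ)
    (v : EuclideanSpace ℝ (Fin n) → ℝ) (x : EuclideanSpace ℝ (Fin n)) :
    ∫ y, integrand M s v x y = ∫ z, levyIntegrand v x (sqrtMap M) s z := by
  simp only [← det_mul_integrand_sqrtMap hM]
  have hpos := det_sqrt_pos hM
  rw [integral_const_mul, ← (sqrtMap_measurableEmbedding hM).integral_map, map_sqrtMap_volume hM,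
    integral_smul_measure, ENNReal.toReal_ofReal (inv_pos.2 hpos).le, smul_eq_mul,
    mul_inv_cancel_left₀ hpos.ne']

theorem integrable_integrand {M : Matrix (Fin n) (Fin n) ℝ} (hM : M.PosDef) {s : ℝ}
    {v : EuclideanSpace ℝ (Fin n) → ℝ} {x : EuclideanSpace ℝ (Fin n)}
    (h : Integrable (levyIntegrand v x (sqrtMap M) s)) : Integrable (integrand M s v x) := by
  have hpos := det_sqrt_pos hM
  have h1 : levyIntegrand v x (sqrtMap M) s = fun z =>
      (CFC.sqrt M).det * (integrand M s v x ∘ sqrtMap M) z :=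
    funext fun z => (det_mul_integrand_sqrtMap hM s v x z).symm
  rw [h1, integrable_const_mul_iff hpos.ne'.isUnit,
    ← (sqrtMap_measurableEmbedding hM).integrable_map_iff, map_sqrtMap_volume hM,
    integrable_smul_measure (ENNReal.ofReal_pos.2 (inv_pos.2 hpos)).ne' ENNReal.ofReal_ne_top] at h
  exact h

/-- Admissibility gives 0 < F(D²ψ) ≤ tr(M D²ψ) at every test point, for every M at once. -/
theorem isSubsolution_sqrtMap (hf : StructureConditions Γ f) {u : EuclideanSpace ℝ (Fin n) → ℝ}
    (hu : Admissible Γ u) {M : Matrix (Fin n) (Fin n) ℝ} (hM : M ∈ gradientMatrices Γ f) :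
    IsSubsolution (EuclideanSpace.basisFun (Fin n) ℝ) (sqrtMap M) u := by
  intro x ψ hψ hmax
  have h1 := hu.hessian_mem x univ ψ isOpen_univ (mem_univ x) hψ.contDiffOn hmax
  rw [sum_bilin_sqrtMap (hf.posDef hM)]
  exact (hf.hessOp_pos h1).trans_le (hf.le_trace hM h1)

theorem StructureConditions.pos_dim (hf : StructureConditions Γ f) : 0 < n := by
  rcases Nat.eq_zero_or_pos n with rfl | h
  · exact absurd (eq_univ_of_univ_subset fun l _ => hf.positive_subset fun i => i.elim0) hf.ne_univ
  · exact h

theorem exists_linear_growth {u : EuclideanSpace ℝ (Fin n) → ℝ} (husc : UpperSemicontinuous u)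
    (hlin : AsymptoticallyLinear u) : ∃ C : ℝ, 0 ≤ C ∧ ∀ y, u y ≤ C * (1 + ‖y‖) := by
  obtain ⟨L, R, hLR⟩ := hlin
  obtain ⟨b, hb⟩ := (husc.upperSemicontinuousOn _).bddAbove_of_isCompact
    (isCompact_closedBall (0 : EuclideanSpace ℝ (Fin n)) R)
  refine ⟨|L| + |b|, by positivity, fun y => ?_⟩
  have h0 := norm_nonneg y
  have h1 := mul_nonneg (abs_nonneg L) h0
  have h2 := mul_nonneg (abs_nonneg b) h0
  rcases le_total R ‖y‖ with h | h
  · have h3 := (le_abs_self _).trans (hLR y h)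
    have h4 := mul_le_mul_of_nonneg_right (le_abs_self L) h0
    nlinarith [abs_nonneg L, abs_nonneg b]
  · have h3 : u y ≤ b := hb ⟨y, by simpa using h, rfl⟩
    nlinarith [abs_nonneg L, le_abs_self b]

/-- `v` is measurable, differs from `u` boundedly, agrees with `u` at `x`, and is `C²` at `x`. -/
structure IsReplacement (u v : EuclideanSpace ℝ (Fin n) → ℝ) (x : EuclideanSpace ℝ (Fin n)) :
    Prop where
  measurable : Measurable v
  eq_at : v x = u x
  bound : ∃ C₀ : ℝ, 0 ≤ C₀ ∧ ∀ y, |v y - u x| ≤ |u y - u x| + C₀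
  contDiffAt : ContDiffAt ℝ 2 v x

/-- The estimate for T = r√M, rewritten in the original variables. Both ρ and C' are independent of
M and r; large M are admitted by taking r small. -/
theorem exists_integrand_estimate (hf : StructureConditions Γ f)
    {u v : EuclideanSpace ℝ (Fin n) → ℝ} (hu : Admissible Γ u) (hlin : AsymptoticallyLinear u)
    {x : EuclideanSpace ℝ (Fin n)} (hv : IsReplacement u v x) {ε : ℝ} (hε : 0 < ε) :
    ∃ ρ : ℝ, 0 < ρ ∧ ∃ C' : ℝ, 0 ≤ C' ∧ ∀ M ∈ gradientMatrices Γ f, ∀ r : ℝ, 0 < r →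
      √M.trace * r ≤ ρ →
      (∀ s ∈ Ioo (1 / 2 : ℝ) 1, Integrable (integrand M s v x)) ∧
      ∀ s ∈ Ioo (3 / 4 : ℝ) 1, |r ^ (2 * s) * (∫ y, integrand M s v x y) -
          unitBallVolume n / (2 * (1 - s)) * (r ^ 2 * (M * hessianMatrix v x).trace)| ≤
        unitBallVolume n / (2 * (1 - s)) * (ε * (r ^ 2 * M.trace)) + C' := by
  obtain ⟨C, hC0, hC⟩ := exists_linear_growth hu.upperSemicontinuous hlin
  obtain ⟨C₀, hC₀, hvu⟩ := hv.bound
  have : Nonempty (Fin n) := ⟨⟨0, hf.pos_dim⟩⟩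
  obtain ⟨ρ, hρ, C', hC', key⟩ := exists_levy_estimate (EuclideanSpace.basisFun (Fin n) ℝ)
    hu.upperSemicontinuous hC hC0 hv.measurable hv.eq_at hC₀ hvu hv.contDiffAt hε
  refine ⟨ρ, hρ, C', hC', fun M hM r hr hrρ => ?_⟩
  have hpd := hf.posDef hM
  have hT : ∀ z, ‖(r • sqrtMap M) z‖ ≤ ρ * ‖z‖ := by
    intro z
    rw [smul_apply, norm_smul, Real.norm_eq_abs, abs_of_pos hr]
    calc r * ‖sqrtMap M z‖ ≤ r * (√M.trace * ‖z‖) :=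
          mul_le_mul_of_nonneg_left (norm_sqrtMap_le hpd z) hr.le
      _ = √M.trace * r * ‖z‖ := by ring
      _ ≤ ρ * ‖z‖ := mul_le_mul_of_nonneg_right hrρ (norm_nonneg z)
  obtain ⟨k1, k2⟩ := key _ ((isSubsolution_sqrtMap hf hu hM).smul hr) hT
  refine ⟨fun s hs => integrable_integrand hpd (integrable_levyIntegrand_smul _ _ _ _ hr (k1 s hs)),
    fun s hs => ?_⟩
  have k3 := k2 s hs
  rw [integral_levyIntegrand_smul _ _ _ _ hr, ← integral_integrand hpd] at k3
  have e1 : ∑ i, fderiv ℝ (fderiv ℝ v) x ((r • sqrtMap M) (EuclideanSpace.basisFun (Fin n) ℝ i))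
      ((r • sqrtMap M) (EuclideanSpace.basisFun (Fin n) ℝ i)) =
      r ^ 2 * (M * hessianMatrix v x).trace := by
    rw [hessianMatrix, ← sum_bilin_sqrtMap hpd, Finset.mul_sum]
    refine Finset.sum_congr rfl fun i _ => ?_
    simp only [smul_apply, map_smul, smul_eq_mul]
    ring
  have e2 : ∑ i, ‖(r • sqrtMap M) (EuclideanSpace.basisFun (Fin n) ℝ i)‖ ^ 2 =
      r ^ 2 * M.trace := by
    rw [← sum_norm_sq_sqrtMap hpd, Finset.mul_sum]
    refine Finset.sum_congr rfl fun i _ => ?_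
    rw [smul_apply, norm_smul, mul_pow, Real.norm_eq_abs, sq_abs]
  rw [e1, e2] at k3
  exact k3

end SquareRoot

/-! ### Upper and lower bounds for the limit s → 1. -/

section Limit

theorem unitBallVolume_pos (n : ℕ) : 0 < unitBallVolume n :=
  ENNReal.toReal_pos (Metric.measure_closedBall_pos _ _ one_pos).ne'
    measure_closedBall_lt_top.ne

/-- Weighted arithmetic–geometric mean of r² and 1. The loss 1-s does not depend on r, which is
essential because r may be arbitrarily small over 𝓜. -/
theorem sq_rpow_le {r s : ℝ} (hr : 0 < r) (hs0 : 0 ≤ s) (hs1 : s ≤ 1) :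
    r ^ (2 * s) ≤ r ^ 2 + (1 - s) := by
  have h := Real.geom_mean_le_arith_mean2_weighted hs0 (sub_nonneg.2 hs1) (sq_nonneg r)
    zero_le_one (by ring)
  rw [Real.one_rpow, mul_one, mul_one, ← Real.rpow_natCast, ← Real.rpow_mul hr.le,
    Real.rpow_natCast] at h
  push_cast at h
  nlinarith [sq_nonneg r]

/-- Passage from the estimate at scale `r` to a lower bound, uniform in `r`. -/
theorem le_of_scaled_estimate {ω t a ε ρ C' τ r s X : ℝ} (hω : 0 < ω) (ha : 0 < a)
    (hs0 : 0 ≤ s) (hs1 : s < 1) (hr : 0 < r) (hrτ : r ^ 2 * τ = ρ ^ 2)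
    (hat : a ≤ t - 2 * ε * τ)
    (hsmall : (1 - s) * (C' / 2 + ω / 4 * a) ≤ ω / 4 * (ε * ρ ^ 2))
    (hX : |r ^ (2 * s) * X - ω / 4 * (r ^ 2 * t)| ≤
      ω / 4 * (ε * (r ^ 2 * τ)) + (1 - s) * (C' / 2)) : ω / 4 * a ≤ X := by
  have hp : 0 < r ^ (2 * s) := Real.rpow_pos_of_pos hr _
  have h1 := (abs_le.1 hX).1
  have h2 := mul_le_mul_of_nonneg_left (sq_rpow_le hr hs0 hs1.le) (mul_pos (by positivity : 0 < ω / 4) ha).le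
  have h3 := mul_le_mul_of_nonneg_left hat (by positivity : 0 ≤ ω / 4 * r ^ 2)
  -- At scale r the slack 2ετ becomes 2ερ², independent of r. Half pays the Taylor error, the other
  -- half the terms of order 1-s.
  have h4 : ω / 4 * r ^ 2 * (t - 2 * ε * τ) = ω / 4 * (r ^ 2 * t) - 2 * (ω / 4 * (ε * ρ ^ 2)) := by
    rw [← hrτ]; ring
  rw [hrτ] at h1
  rw [h4] at h3
  refine le_of_mul_le_mul_left ?_ hp
  linarith

variable {n : ℕ} {Γ : Set (Fin n → ℝ)} {f : (Fin n → ℝ) → ℝ}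
  {u v : EuclideanSpace ℝ (Fin n) → ℝ} {x : EuclideanSpace ℝ (Fin n)}

theorem StructureConditions.trace_pos (hf : StructureConditions Γ f)
    {M : Matrix (Fin n) (Fin n) ℝ} (hM : M ∈ gradientMatrices Γ f) : 0 < M.trace := by
  have : Nonempty (Fin n) := ⟨⟨0, hf.pos_dim⟩⟩
  exact (hf.posDef hM).trace_pos

/-- The estimate of `exists_integrand_estimate`, at the largest allowed scale. -/
theorem exists_scaled_estimate (hf : StructureConditions Γ f) (hu : Admissible Γ u)
    (hlin : AsymptoticallyLinear u) (hv : IsReplacement u v x) {ε : ℝ} (hε : 0 < ε) :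
    ∃ ρ : ℝ, 0 < ρ ∧ ∃ C' : ℝ, 0 ≤ C' ∧ ∀ M ∈ gradientMatrices Γ f, ∃ r : ℝ, 0 < r ∧
      r ^ 2 * M.trace = ρ ^ 2 ∧
      (∀ s ∈ Ioo (1 / 2 : ℝ) 1, Integrable (integrand M s v x)) ∧
      ∀ s ∈ Ioo (3 / 4 : ℝ) 1,
        |r ^ (2 * s) * ((1 - s) * (1 / 2 * ∫ y, integrand M s v x y)) -
          unitBallVolume n / 4 * (r ^ 2 * (M * hessianMatrix v x).trace)| ≤
        unitBallVolume n / 4 * (ε * (r ^ 2 * M.trace)) + (1 - s) * (C' / 2) := by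
  obtain ⟨ρ, hρ, C', hC', key⟩ := exists_integrand_estimate hf hu hlin hv hε
  refine ⟨ρ, hρ, C', hC', fun M hM => ?_⟩
  have hτ := hf.trace_pos hM
  have hsq : 0 < √M.trace := Real.sqrt_pos.2 hτ
  obtain ⟨k1, k2⟩ := key M hM (ρ / √M.trace) (by positivity) (by field_simp; rfl)
  refine ⟨ρ / √M.trace, by positivity, ?_, k1, fun s hs => ?_⟩
  · rw [div_pow, Real.sq_sqrt hτ.le, div_mul_cancel₀ _ hτ.ne']
  · have hs1 : 0 < 1 - s := sub_pos.2 hs.2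
    have k3 := mul_le_mul_of_nonneg_left (k2 s hs) (by positivity : 0 ≤ (1 - s) / 2)
    rw [← abs_of_nonneg (by positivity : 0 ≤ (1 - s) / 2), ← abs_mul,
      abs_of_nonneg (by positivity : 0 ≤ (1 - s) / 2)] at k3
    have e : (1 - s) / 2 * (unitBallVolume n / (2 * (1 - s))) = unitBallVolume n / 4 := by
      field_simp
      ring
    rw [mul_sub, mul_add, ← mul_assoc _ (_ / (2 * (1 - s))), ← mul_assoc _ (_ / (2 * (1 - s))),
      e] at k3
    calc _ = _ := by congr 2; ring
      _ ≤ _ := k3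
      _ = _ := by ring

theorem integralsConverge (hf : StructureConditions Γ f) (hu : Admissible Γ u)
    (hlin : AsymptoticallyLinear u) (hv : IsReplacement u v x) : IntegralsConverge Γ f v x := by
  obtain ⟨ρ, hρ, C', hC', key⟩ := exists_scaled_estimate hf hu hlin hv one_pos
  intro s hs M hM
  obtain ⟨r, -, -, h, -⟩ := key M hM
  exact h s hs

theorem eventually_mem_Ioo_left {a : ℝ} (ha : a < 1) : ∀ᶠ s in 𝓝[<] (1 : ℝ), s ∈ Ioo a 1 :=
  Ioo_mem_nhdsLT ha

theorem tendsto_one_sub_mul (K : ℝ) : Tendsto (fun s : ℝ => (1 - s) * K) (𝓝[<] 1) (𝓝 0) := by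
  have h : Tendsto (fun s : ℝ => (1 - s) * K) (𝓝 1) (𝓝 ((1 - 1) * K)) :=
    (by fun_prop : Continuous fun s : ℝ => (1 - s) * K).tendsto 1
  rw [sub_self, zero_mul] at h
  exact h.mono_left nhdsWithin_le_nhds

/-- The threshold in s must not depend on M although the Taylor error (ε'/2) tr M may be unbounded.
Applying `le_trace` to A - ε'I gives tr(MA) - ε' tr M ≥ F(A - ε'I), which leaves exactly the slack
needed by `le_of_scaled_estimate`. -/
theorem eventually_forall_le_integral (hf : StructureConditions Γ f) (hu : Admissible Γ u)
    (hlin : AsymptoticallyLinear u) (hv : IsReplacement u v x)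
    (hA : hessianMatrix v x ∈ matrixCone Γ) {l : ℝ}
    (hl : l < unitBallVolume n / 4 * hessOp f (hessianMatrix v x)) :
    ∀ᶠ s in 𝓝[<] (1 : ℝ), ∀ M ∈ gradientMatrices Γ f,
      l ≤ (1 - s) * (1 / 2 * ∫ y, integrand M s v x y) := by
  have hω := unitBallVolume_pos n
  set η := hessOp f (hessianMatrix v x) - l / (unitBallVolume n / 4) with hη_def
  have hη : 0 < η := sub_pos.2 ((div_lt_iff₀' (by positivity)).2 hl)
  obtain ⟨ε', hε', hmem, hlt⟩ := hf.sub_smul_one_mem hA hη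
  set a := hessOp f (hessianMatrix v x - ε' • 1) with ha_def
  have ha : 0 < a := hf.hessOp_pos hmem
  have hla : l ≤ unitBallVolume n / 4 * a := by
    rw [hη_def, sub_sub_cancel] at hlt
    exact ((div_lt_iff₀' (by positivity)).1 hlt).le
  obtain ⟨ρ, hρ, C', hC', key⟩ := exists_scaled_estimate hf hu hlin hv (half_pos hε')
  have hsmall := (tendsto_one_sub_mul (C' / 2 + unitBallVolume n / 4 * a)).eventually_le_const
    (by positivity : 0 < unitBallVolume n / 4 * (ε' / 2 * ρ ^ 2))
  filter_upwards [hsmall, eventually_mem_Ioo_left (by norm_num : (3 / 4 : ℝ) < 1)] with s hs1 hs2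
  intro M hM
  obtain ⟨r, hr, hrτ, -, h⟩ := key M hM
  refine hla.trans (le_of_scaled_estimate hω ha (by linarith [hs2.1]) hs2.2 hr hrτ ?_ hs1 (h s hs2))
  have h1 := hf.le_trace hM hmem
  rw [mul_sub, Matrix.trace_sub, Matrix.mul_smul, mul_one, Matrix.trace_smul, smul_eq_mul] at h1
  linarith

theorem eventually_integral_lt (hf : StructureConditions Γ f) (hu : Admissible Γ u)
    (hlin : AsymptoticallyLinear u) (hv : IsReplacement u v x) {M : Matrix (Fin n) (Fin n) ℝ}
    (hM : M ∈ gradientMatrices Γ f) {l : ℝ}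
    (hl : unitBallVolume n / 4 * (M * hessianMatrix v x).trace < l) :
    ∀ᶠ s in 𝓝[<] (1 : ℝ), (1 - s) * (1 / 2 * ∫ y, integrand M s v x y) < l := by
  have hω := unitBallVolume_pos n
  have hτ := hf.trace_pos hM
  set t := (M * hessianMatrix v x).trace with ht
  -- M is fixed here, so ε may depend on it: the Taylor contribution equals half of the gap between
  -- l and the limit.
  set ε := (l - unitBallVolume n / 4 * t) / (unitBallVolume n / 2 * M.trace) with hε_def
  have hε : 0 < ε := div_pos (sub_pos.2 hl) (by positivity)
  obtain ⟨ρ, hρ, C', hC', key⟩ := exists_scaled_estimate hf hu hlin hv hε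
  obtain ⟨r, hr, -, -, h⟩ := key M hM
  have hlim : Tendsto (fun s : ℝ => (unitBallVolume n / 4 * (r ^ 2 * t) +
      (unitBallVolume n / 4 * (ε * (r ^ 2 * M.trace)) + (1 - s) * (C' / 2))) / r ^ (2 * s))
      (𝓝[<] 1) (𝓝 ((unitBallVolume n / 4 * (r ^ 2 * t) +
      (unitBallVolume n / 4 * (ε * (r ^ 2 * M.trace)) + 0)) / r ^ 2)) := by
    refine Tendsto.div ((tendsto_one_sub_mul _).const_add _ |>.const_add _) ?_ (by positivity)
    have h1 : Tendsto (fun s : ℝ => r ^ (2 * s)) (𝓝 1) (𝓝 (r ^ (2 * (1 : ℝ)))) :=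
      ((Real.continuous_const_rpow hr.ne').comp (by fun_prop : Continuous fun s : ℝ => 2 * s)).tendsto 1
    rw [mul_one, Real.rpow_two] at h1
    exact h1.mono_left nhdsWithin_le_nhds
  have hlt : (unitBallVolume n / 4 * (r ^ 2 * t) +
      (unitBallVolume n / 4 * (ε * (r ^ 2 * M.trace)) + 0)) / r ^ 2 < l := by
    have e : (unitBallVolume n / 4 * (r ^ 2 * t) +
      (unitBallVolume n / 4 * (ε * (r ^ 2 * M.trace)) + 0)) / r ^ 2 =
      unitBallVolume n / 4 * t + (l - unitBallVolume n / 4 * t) / 2 := by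
      rw [hε_def]
      field_simp
      ring
    rw [e]
    linarith
  filter_upwards [hlim.eventually_lt_const hlt,
    eventually_mem_Ioo_left (by norm_num : (3 / 4 : ℝ) < 1)] with s hs1 hs2
  refine lt_of_le_of_lt ?_ hs1
  rw [le_div_iff₀' (Real.rpow_pos_of_pos hr _)]
  have := (abs_le.1 (h s hs2)).2
  linarith

theorem eventually_mul_fracHessian_lt (hf : StructureConditions Γ f) (hu : Admissible Γ u)
    (hlin : AsymptoticallyLinear u) (hv : IsReplacement u v x) {M : Matrix (Fin n) (Fin n) ℝ}
    (hM : M ∈ gradientMatrices Γ f) {l : ℝ}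
    (hl : unitBallVolume n / 4 * (M * hessianMatrix v x).trace < l) :
    ∀ᶠ s in 𝓝[<] (1 : ℝ), ((1 - s : ℝ) : EReal) * fracHessian Γ f s v x < l := by
  filter_upwards [eventually_integral_lt hf hu hlin hv hM hl, self_mem_nhdsWithin] with s hs hs1
  refine lt_of_le_of_lt ?_ (EReal.coe_lt_coe_iff.2 hs)
  rw [EReal.coe_mul]
  exact mul_le_mul_of_nonneg_left (iInf₂_le M hM) (EReal.coe_nonneg.2 (sub_nonneg.2 (le_of_lt hs1)))

theorem eventually_le_mul_fracHessian (hf : StructureConditions Γ f) (hu : Admissible Γ u)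
    (hlin : AsymptoticallyLinear u) (hv : IsReplacement u v x)
    (hA : hessianMatrix v x ∈ matrixCone Γ) {l : ℝ}
    (hl : l < unitBallVolume n / 4 * hessOp f (hessianMatrix v x)) :
    ∀ᶠ s in 𝓝[<] (1 : ℝ), (l : EReal) ≤ ((1 - s : ℝ) : EReal) * fracHessian Γ f s v x := by
  filter_upwards [eventually_forall_le_integral hf hu hlin hv hA hl, self_mem_nhdsWithin]
    with s hs hs1
  have hs2 : 0 < 1 - s := sub_pos.2 hs1
  have h : ((l / (1 - s) : ℝ) : EReal) ≤ fracHessian Γ f s v x :=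
    le_iInf₂ fun M hM => EReal.coe_le_coe_iff.2 ((div_le_iff₀' hs2).2 (hs M hM))
  have e : (l : EReal) = ((1 - s : ℝ) : EReal) * ((l / (1 - s) : ℝ) : EReal) := by
    rw [← EReal.coe_mul, mul_div_cancel₀ _ hs2.ne']
  rw [e]
  exact mul_le_mul_of_nonneg_left h (EReal.coe_nonneg.2 hs2.le)

/-- The lower bound is the uniform one; the upper bound uses a single M nearly attaining the infimum
that defines F(A). -/
theorem stableLimit (hf : StructureConditions Γ f) (hu : Admissible Γ u)
    (hlin : AsymptoticallyLinear u) (hv : IsReplacement u v x)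
    (hA : hessianMatrix v x ∈ matrixCone Γ) :
    StableLimit Γ f v x (unitBallVolume n / 4 * hessOp f (hessianMatrix v x)) := by
  have hω := unitBallVolume_pos n
  refine ⟨integralsConverge hf hu hlin hv, tendsto_order.2 ⟨fun l hl => ?_, fun l hl => ?_⟩⟩
  · obtain ⟨l', h1, h2⟩ := EReal.lt_iff_exists_real_btwn.1 hl
    filter_upwards [eventually_le_mul_fracHessian hf hu hlin hv hA (EReal.coe_lt_coe_iff.1 h2)]
      with s hs
    exact h1.trans_le hs
  · obtain ⟨l', h1, h2⟩ := EReal.lt_iff_exists_real_btwn.1 hl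
    obtain ⟨M, hM, hlt⟩ := hf.exists_trace_lt hA
      (sub_pos.2 ((lt_div_iff₀' (by positivity : 0 < unitBallVolume n / 4)).2
        (EReal.coe_lt_coe_iff.1 h1)))
    rw [add_sub_cancel, lt_div_iff₀' (by positivity)] at hlt
    filter_upwards [eventually_mul_fracHessian_lt hf hu hlin hv hM hlt] with s hs
    exact hs.trans h2

theorem limsup_le_iInf_trace (hf : StructureConditions Γ f) (hu : Admissible Γ u)
    (hlin : AsymptoticallyLinear u) (hv : IsReplacement u v x) :
    limsup (fun s : ℝ => ((1 - s : ℝ) : EReal) * fracHessian Γ f s v x) (𝓝[<] 1) ≤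
      ⨅ M ∈ gradientMatrices Γ f,
        ((unitBallVolume n / 4 * (M * hessianMatrix v x).trace : ℝ) : EReal) := by
  refine le_iInf₂ fun M hM => le_of_forall_gt fun l hl => ?_
  obtain ⟨l', h1, h2⟩ := EReal.lt_iff_exists_real_btwn.1 hl
  refine lt_of_le_of_lt (limsup_le_of_le (h := ?_)) h2
  filter_upwards [eventually_mul_fracHessian_lt hf hu hlin hv hM (EReal.coe_lt_coe_iff.1 h1)]
    with s hs
  exact hs.le

/-! ### Test functions glued to u as replacements. -/

section Glue

variable {ψ : EuclideanSpace ℝ (Fin n) → ℝ} {N : Set (EuclideanSpace ℝ (Fin n))}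

theorem glue_eventuallyEq (hψ : IsTestFunction u ψ N x) : glue u ψ N =ᶠ[𝓝 x] ψ := by
  filter_upwards [hψ.isOpen.mem_nhds hψ.mem] with y hy
  exact if_pos hy

theorem hessianMatrix_congr (h : u =ᶠ[𝓝 x] v) : hessianMatrix u x = hessianMatrix v x := by
  rw [hessianMatrix, hessianMatrix, h.fderiv.fderiv_eq]

theorem isReplacement_glue (husc : UpperSemicontinuous u) (hψ : IsTestFunction u ψ N x) :
    IsReplacement u (glue u ψ N) x where
  measurable := by
    refine measurable_of_restrict_of_restrict_compl hψ.isOpen.measurableSet ?_ ?_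
    · have h : N.domRestrict (glue u ψ N) = N.domRestrict ψ := funext fun y => if_pos y.2
      rw [h]
      exact ((hψ.contDiffOn.continuousOn.mono subset_closure).domRestrict).measurable
    · have h : Nᶜ.domRestrict (glue u ψ N) = Nᶜ.domRestrict u := funext fun y => if_neg y.2
      rw [h]
      exact husc.measurable.comp measurable_subtype_coe
  eq_at := (if_pos hψ.mem).trans hψ.eq_at
  bound := by
    obtain ⟨b, hb⟩ := hψ.isBounded.isCompact_closure.exists_bound_of_continuousOn
      hψ.contDiffOn.continuousOn
    refine ⟨b + |u x|, ?_, fun y => ?_⟩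
    · have := (norm_nonneg _).trans (hb x (subset_closure hψ.mem))
      positivity
    · by_cases hy : y ∈ N
      · have h1 : glue u ψ N y = ψ y := if_pos hy
        rw [h1]
        have h2 := hb y (subset_closure hy)
        rw [Real.norm_eq_abs] at h2
        linarith [abs_sub (ψ y) (u x), abs_nonneg (u y - u x)]
      · have h1 : glue u ψ N y = u y := if_neg hy
        have := (norm_nonneg _).trans (hb x (subset_closure hψ.mem))
        rw [h1]
        linarith [abs_nonneg (u x)]
  contDiffAt := ((hψ.contDiffOn.mono subset_closure).contDiffAt
    (hψ.isOpen.mem_nhds hψ.mem)).congr_of_eventuallyEq (glue_eventuallyEq hψ)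

theorem hessianMatrix_mem_of_touchesAbove (hu : Admissible Γ u) (h : TouchesAbove u ψ N x) :
    hessianMatrix ψ x ∈ matrixCone Γ := by
  obtain ⟨hψ, hlt⟩ := h
  refine hu.hessian_mem x N ψ hψ.isOpen hψ.mem (hψ.contDiffOn.mono subset_closure) ?_
  filter_upwards [hψ.isOpen.mem_nhds hψ.mem] with y hy
  rw [hψ.eq_at, sub_self, sub_nonpos]
  rcases eq_or_ne y x with rfl | hyx
  · exact hψ.eq_at.ge
  · exact (hlt y ⟨hy, hyx⟩).le

/-- Near x, u is its own test function, since u - u is constant. -/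
theorem hessianMatrix_mem_of_contDiffAt (hu : Admissible Γ u) (h : ContDiffAt ℝ 2 u x) :
    hessianMatrix u x ∈ matrixCone Γ := by
  obtain ⟨N, hN, hc⟩ := h.contDiffOn le_rfl (by simp)
  obtain ⟨O, hON, hO, hxO⟩ := mem_nhds_iff.1 hN
  refine hu.hessian_mem x O u hO hxO (hc.mono hON) ?_
  simp [IsLocalMax, IsMaxFilter]

theorem isReplacement_self (husc : UpperSemicontinuous u) (h : ContDiffAt ℝ 2 u x) :
    IsReplacement u u x where
  measurable := husc.measurable
  eq_at := rfl
  bound := ⟨0, le_rfl, fun _ => (add_zero _).ge⟩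
  contDiffAt := h

end Glue

end Limit

end FracHessian

end

open FracHessian in
theorem theorem1p1 {n : ℕ} (Γ : Set (Fin n → ℝ)) (f : (Fin n → ℝ) → ℝ)
    (hf : StructureConditions Γ f) (u : EuclideanSpace ℝ (Fin n) → ℝ)
    (hu : Admissible Γ u) (hlin : AsymptoticallyLinear u) :
    ViscosityLimit Γ f u ∧
      ∀ x, ContDiffAt ℝ 2 u x →
        StableLimit Γ f u x (unitBallVolume n / 4 * hessOp f (hessianMatrix u x)) := by
  have husc := hu.upperSemicontinuous
  have limit_of_mem : ∀ x N ψ, IsTestFunction u ψ N x → hessianMatrix ψ x ∈ matrixCone Γ →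
      StableLimit Γ f (glue u ψ N) x (unitBallVolume n / 4 * hessOp f (hessianMatrix ψ x)) := by
    intro x N ψ hψ hA
    rw [← hessianMatrix_congr (glue_eventuallyEq hψ)] at hA ⊢
    exact stableLimit hf hu hlin (isReplacement_glue husc hψ) hA
  refine ⟨⟨fun x N ψ h => ?_, fun x N ψ h hA => limit_of_mem x N ψ h.1 hA, fun x N ψ h => ?_⟩,
    fun x h => stableLimit hf hu hlin (isReplacement_self husc h)
      (hessianMatrix_mem_of_contDiffAt hu h)⟩
  · have hA := hessianMatrix_mem_of_touchesAbove hu h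
    exact ⟨hA, limit_of_mem x N ψ h.1 hA⟩
  -- No membership in the cone is available here, so only convergence of the integrals and the upper
  -- bound are used; neither needs it.
  · have hv := isReplacement_glue husc h.1
    rw [← hessianMatrix_congr (glue_eventuallyEq h.1)]
    exact ⟨integralsConverge hf hu hlin hv, limsup_le_iInf_trace hf hu hlin hv⟩
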